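/- Let $L>0$ and let $p_0$ be a probability density on $\mathbb R$ that vanishes outside $[-L,L]$ and is uniformly continuous on $[-L,L]$. Let $\bar p_0$ be its $2L$-periodic extension (the values at the points $L+2L\mathbb Z$ are immaterial). For $t>0$ put $$p_t(x)=\int_{-\infty}^{\infty}\bar p_0(u)\,\phi_{\sqrt t}(x-u)\,du,\qquad \phi_{s}(z)=\frac{1}{s\sqrt{2\pi}}e^{-z^2/(2s^2)},$$ and for $t=0$ let $p_t$ be $\bar p_0$; each $p_t$ restricts to a probability density on $[-L,L]$. Let $(t_1,X_1),(t_2,X_2),\dots$ be independent pairs of real random variables such that, for some $t_{\max}<\infty$, $0\le t_i\le t_{\max}$ almost surely for all $i$, and, conditionally on $t_i$, $X_i$ has density $p_{t_i}$ on $[-L,L]$. (The $t_i$ may be i.i.d. random variables, and they may be deterministic.) For an integer $N\ge 0$ let $\mathcal F_N$ be the set of real vectors $f=(f_\nu)_{\nu=-N}^{N}$ with $f_\nu\ge 0$ and $\frac{2L}{2N+1}\sum_{\nu=-N}^{N} f_\nu=1$, and for $f\in\mathcal F_N$, $t\ge 0$, $x\in\mathbb R$ let $$C_{N,f}(x;t)=\sum_{k=-N}^{N}\Bigl(1-\frac{|k|}{N+1}\Bigr)c_k\,e^{-(\pi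 k/L)^2t/2}\,e^{i\pi kx/L},\qquad c_k=\frac1{2N+1}\sum_{\nu=-N}^{N}f_\nu\, e^{-2\pi i k\nu/(2N+1)}.$$ Let $N=N(n)\to\infty$ as $n\to\infty$, at any rate. For each $n$ let $\hat f_n$ be a maximum likelihood estimate, that is, almost surely a maximizer over $f\in\mathcal F_{N(n)}$ of the log-likelihood $\sum_{i=1}^n\log C_{N(n),f}(X_i;t_i)$ (with $\log 0=-\infty$), and write $\hat p_t(x)=C_{N(n),\hat f_n}(x;t)$. Then for every $t>0$ the functions $p_t$ and $\hat p_t$ are differentiable in $x$, and, as $n\to\infty$, $$\sup_{x\in\mathbb R}|\hat p_t(x)-p_t(x)|\to 0\quad\text{and}\quad \sup_{x\in\mathbb R}|\hat p_t'(x)-p_t'(x)|\to 0\qquad\text{in probability},$$ where $'$ denotes the derivative in $x$. -/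

import Mathlib

open MeasureTheory ProbabilityTheory Filter Topology
open scoped ENNReal

noncomputable section

namespace SpectralEB

/-- `p₀` is a probability density on the real line which vanishes outside `[-L, L]` and is
uniformly continuous on `[-L, L]`. -/
structure IsPrior (L : ℝ) (p₀ : ℝ → ℝ) : Prop where
  nonneg : ∀ x, 0 ≤ p₀ x
  support : ∀ x, x ∉ Set.Icc (-L) L → p₀ x = 0
  uniformCont : UniformContinuousOn p₀ (Set.Icc (-L) L)
  integral_eq_one : ∫ x, p₀ x = 1

/-- The `2L`-periodic extension of the restriction of `p₀` to `[-L, L)`. -/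
def periodize (L : ℝ) (p₀ : ℝ → ℝ) (x : ℝ) : ℝ :=
  p₀ (x - 2 * L * ⌊(x + L) / (2 * L)⌋)

/-- The marginal density `p_t` on the torus: the periodized prior convolved with the centred
Gaussian density of variance `t`; for `t = 0` it is the periodized prior itself. -/
def marginal (L : ℝ) (p₀ : ℝ → ℝ) (t x : ℝ) : ℝ :=
  if t = 0 then periodize L p₀ x
  else ∫ u, periodize L p₀ u * gaussianPDFReal 0 t.toNNReal (x - u)

/-- The probability measure on `[-L, L]` with density `p_t`. -/
def marginalLaw (L : ℝ) (p₀ : ℝ → ℝ) (t : ℝ) : Measure ℝ :=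
  (volume.restrict (Set.Icc (-L) L)).withDensity fun x => ENNReal.ofReal (marginal L p₀ t x)

/-- The observations `(T i, X i)`, `i = 0, 1, 2, …`: the pairs are independent, the variances
`T i` lie in `[0, tmax]` almost surely, and given `T i = t` the variable `X i` has law
`marginalLaw L p₀ t`. The `T i` may be i.i.d., and they may be deterministic. -/
structure IsSample {Ω : Type*} [MeasurableSpace Ω] (μ : Measure Ω) (L : ℝ) (p₀ : ℝ → ℝ)
    (tmax : ℝ) (T X : ℕ → Ω → ℝ) : Prop where
  measurable_T : ∀ i, Measurable (T i)
  measurable_X : ∀ i, Measurable (X i)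
  T_mem : ∀ i, ∀ᵐ ω ∂μ, T i ω ∈ Set.Icc 0 tmax
  indep : iIndepFun (fun i ω => (T i ω, X i ω)) μ
  condLaw : ∀ i, ∀ A B : Set ℝ, MeasurableSet A → MeasurableSet B →
    μ (T i ⁻¹' B ∩ X i ⁻¹' A) = ∫⁻ ω in T i ⁻¹' B, marginalLaw L p₀ (T i ω) A ∂μ

/-- The indices `-N, …, N`. -/
abbrev idx (N : ℕ) : Finset ℤ := Finset.Icc (-(N : ℤ)) N

/-- The discrete Fourier transform of the node values `f_{-N}, …, f_N`
(values of `f` at other integers play no role). -/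
def dft (N : ℕ) (f : ℤ → ℝ) (k : ℤ) : ℂ :=
  (1 / (2 * (N : ℂ) + 1)) * ∑ ν ∈ idx N,
    (f ν : ℂ) * Complex.exp (-(2 * Real.pi / (2 * (N : ℂ) + 1)) * Complex.I * k * ν)

/-- The order-`N` Cesàro mean model `C_{N,f}(x; t)` on the torus `[-L, L]`. The sum is real,
because the coefficients at `k` and `-k` are complex conjugates of each other. For `L = π` the
frequency `π * k / L` is `k`. -/
def cesaro (L : ℝ) (N : ℕ) (f : ℤ → ℝ) (t x : ℝ) : ℝ :=
  (∑ k ∈ idx N, ((1 - |(k : ℝ)| / ((N : ℝ) + 1) : ℝ) : ℂ) * dft N f k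
    * (Real.exp (-(Real.pi * k / L) ^ 2 * t / 2) : ℂ)
    * Complex.exp (Complex.I * ((Real.pi * k / L * x : ℝ) : ℂ))).re

/-- The constraint set: non-negative node values with `(2L / (2N+1)) ∑ f_ν = 1`. -/
def sieve (L : ℝ) (N : ℕ) : Set (ℤ → ℝ) :=
  {f | (∀ ν ∈ idx N, 0 ≤ f ν) ∧ 2 * L / (2 * (N : ℝ) + 1) * ∑ ν ∈ idx N, f ν = 1}

/-- The log-likelihood of the first `n` observations, with `log 0 = -∞`. -/
def logLik (L : ℝ) (N n : ℕ) (t x : ℕ → ℝ) (f : ℤ → ℝ) : EReal :=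
  ∑ i ∈ Finset.range n, ENNReal.log (ENNReal.ofReal (cesaro L N f (t i) (x i)))

/-- `f` maximizes the log-likelihood of the first `n` observations over the order-`N` sieve. -/
def IsSieveMLE (L : ℝ) (N n : ℕ) (t x : ℕ → ℝ) (f : ℤ → ℝ) : Prop :=
  f ∈ sieve L N ∧ ∀ g ∈ sieve L N, logLik L N n t x g ≤ logLik L N n t x f

/-- The sup-norm distance `sup_x |f x - g x|`, as an extended non-negative real. -/
def supDist (f g : ℝ → ℝ) : ℝ≥0∞ := ⨆ x, ENNReal.ofReal |f x - g x|

/-- Convergence in probability to zero. -/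
def TendstoZeroInProb {Ω : Type*} [MeasurableSpace Ω] (μ : Measure Ω) (Z : ℕ → Ω → ℝ≥0∞) :
    Prop :=
  ∀ ε : ℝ≥0∞, 0 < ε → Tendsto (fun n => μ {ω | ε ≤ Z n ω}) atTop (𝓝 0)

end SpectralEB

end

/-! Everything takes place on the circle `AddCircle (2 * L)`. There `2 * L` times the marginal
density is the Haar density of the prior `P` after Gaussian noise of variance `t`, and the Cesàro
model is a mixture of translates of one kernel, with a mixing measure Γ carried by the nodes
(`cesaro_eq_nodeMix`). The kernel is a Fejér kernel run through the heat flow, hence nonnegative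
(`fejerHeat_nonneg`). The estimator is thus a mixture maximum likelihood estimate, a concave problem
in Γ.

Only its first-order conditions are used, never the complexity of the sieve; this is why `N` may
grow at any rate. With `q i` the fitted value at observation `i`, the average of kernel over `q i`
is at most one at every node, with equality where Γ has mass (`IsSieveMLE.score_le_one`,
`IsSieveMLE.nodeMass_mul_score`). Hence Γ is self-consistent: its integral of `h` is the average of
the posterior means of `h`. Comparison with the uniform density shows that the average of `1 / q i`
is at most one.

Along an ultrafilter, Γ and the empirical measure of the observations converge weakly, to `G` and
`η`, by compactness. The law of large numbers makes `noisyLaw P t` the conditional law of the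
position under `η`. The likelihood ratios are singular at variance zero and are cut off there; for
the part removed, the posterior given an observation concentrates at that observation
(`chordSq_mul_fejerHeat_le`, `abs_fejerMix_div_sub_le`), with an error weighted by `1 / q i` and so
controlled on average.

The limit is identified in `eq_of_score_le_one`. Let S ≤ 1 be the limiting score and α the mass that
the limiting law of the variances gives to zero. Self-consistency becomes (1 - S) dG = α dP, and ∫ S
dP ≥ 1 - α because ∫ p²/g is one plus a chi-square divergence. If α = 0, the bound ∫ S dP ≤ 1 makes
this divergence vanish at some positive variance, and deconvolution gives G = P. If α > 0, then 1 -
S has mean α under G and second moment α ∫ (1 - S) dP ≤ α², so it is the constant α, and again G =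
P.

Weak convergence gives convergence of each Fourier coefficient, and the Gaussian decay at `t > 0`
upgrades this to uniform convergence of the densities and of their derivatives
(`tendstoUniformlyOn_heat`, `hasDerivAt_heat`). Probability enters only through Chebyshev's
inequality for countably many test functions; `tendstoZeroInProb_of_forall_seq` reduces the rest to
deterministic sequences. -/

namespace SpectralEB

/-! ### Heat flows on the circle as Fourier series. -/

variable {L : ℝ}

/-- The factor by which a centred Gaussian of variance `t` multiplies the `k`-th Fourier
coefficient on the circle of length `2 * L`. -/
noncomputable def decay (L t : ℝ) (k : ℤ) : ℝ := Real.exp (-(Real.pi * k / L) ^ 2 * t / 2)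

/-- The Cesàro weights `1 - |k| / (N + 1)`, extended by zero. -/
noncomputable def cesaroWeight (N : ℕ) (k : ℤ) : ℝ := max 0 (1 - |(k : ℝ)| / ((N : ℝ) + 1))

/-- The real part of the solution of the heat equation on the circle at time `t` whose initial
value has the Fourier coefficients `m`. -/
noncomputable def heat (L : ℝ) (m : ℤ → ℂ) (t : ℝ) (x : AddCircle (2 * L)) : ℝ :=
  ∑' k, decay L t k * (m k * fourier k x).re

lemma decay_pos (t : ℝ) (k : ℤ) : 0 < decay L t k := Real.exp_pos _

lemma decay_anti {s t : ℝ} (hst : s ≤ t) (k : ℤ) : decay L t k ≤ decay L s k := by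
  unfold decay
  apply Real.exp_le_exp.2
  have := mul_le_mul_of_nonneg_left hst (sq_nonneg (Real.pi * k / L))
  linarith

lemma continuous_decay (k : ℤ) : Continuous fun t => decay L t k := by
  unfold decay; fun_prop

/-- The terms are those that dominate a Jacobi theta series and its derivatives. The power `n = 1`
is needed for differentiating heat flows in space. -/
lemma summable_pow_mul_decay (hL : 0 < L) {t : ℝ} (ht : 0 < t) (n : ℕ) :
    Summable fun k : ℤ => |(k : ℝ)| ^ n * decay L t k := by
  have hT : 0 < Real.pi * t / (2 * L ^ 2) := by positivity
  convert summable_pow_mul_jacobiTheta₂_term_bound 0 hT n using 3 with k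
  · simp
  · rw [decay]
    congr 1
    field_simp
    ring

lemma summable_decay (hL : 0 < L) {t : ℝ} (ht : 0 < t) : Summable (decay L t) := by
  simpa using summable_pow_mul_decay hL ht 0

lemma cesaroWeight_nonneg (N : ℕ) (k : ℤ) : 0 ≤ cesaroWeight N k := le_max_left _ _

lemma cesaroWeight_le_one (N : ℕ) (k : ℤ) : cesaroWeight N k ≤ 1 := by
  refine max_le zero_le_one ?_
  have : 0 ≤ |(k : ℝ)| / ((N : ℝ) + 1) := by positivity
  linarith

lemma abs_cesaroWeight_le (N : ℕ) (k : ℤ) : |cesaroWeight N k| ≤ 1 := by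
  rw [abs_of_nonneg (cesaroWeight_nonneg N k)]; exact cesaroWeight_le_one N k

lemma mem_idx {N : ℕ} {k : ℤ} : k ∈ idx N ↔ |k| ≤ N := by
  rw [Finset.mem_Icc, abs_le]

lemma cesaroWeight_of_mem {N : ℕ} {k : ℤ} (hk : k ∈ idx N) :
    cesaroWeight N k = 1 - |(k : ℝ)| / ((N : ℝ) + 1) := by
  refine max_eq_right ?_
  have h : |(k : ℝ)| ≤ N := by exact_mod_cast mem_idx.1 hk
  have : |(k : ℝ)| / ((N : ℝ) + 1) ≤ 1 := by
    rw [div_le_one (by positivity)]; linarith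
  linarith

lemma cesaroWeight_of_notMem {N : ℕ} {k : ℤ} (hk : k ∉ idx N) : cesaroWeight N k = 0 := by
  refine max_eq_left ?_
  have h : (N : ℝ) + 1 ≤ |(k : ℝ)| := by
    rw [mem_idx, not_le] at hk
    exact_mod_cast hk
  have : 1 ≤ |(k : ℝ)| / ((N : ℝ) + 1) := by
    rw [one_le_div (by positivity)]; exact h
  linarith

lemma tendsto_cesaroWeight {ι : Type*} {l : Filter ι} {N : ι → ℕ} (hN : Tendsto N l atTop)
    (k : ℤ) : Tendsto (fun j => cesaroWeight (N j) k) l (𝓝 1) := by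
  have h1 : Tendsto (fun n : ℕ => |(k : ℝ)| / ((n : ℝ) + 1)) atTop (𝓝 0) :=
    tendsto_const_nhds.div_atTop
      (tendsto_atTop_add_const_right _ _ tendsto_natCast_atTop_atTop)
  have h2 : Tendsto (fun n : ℕ => max 0 (1 - |(k : ℝ)| / ((n : ℝ) + 1))) atTop (𝓝 (max 0 (1 - 0))) :=
    tendsto_const_nhds.max (tendsto_const_nhds.sub h1)
  rw [sub_zero, max_eq_right zero_le_one] at h2
  exact h2.comp hN

lemma norm_fourier_apply (k : ℤ) (x : AddCircle (2 * L)) : ‖(fourier k x : ℂ)‖ = 1 := by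
  rw [fourier_apply, Circle.norm_coe]

lemma abs_heat_term_le (m : ℤ → ℂ) (t : ℝ) (k : ℤ) (x : AddCircle (2 * L)) :
    |decay L t k * (m k * fourier k x).re| ≤ decay L t k * ‖m k‖ := by
  rw [abs_mul, abs_of_pos (decay_pos t k)]
  refine mul_le_mul_of_nonneg_left ?_ (decay_pos t k).le
  refine (Complex.abs_re_le_norm _).trans ?_
  rw [norm_mul, norm_fourier_apply, mul_one]

/-- Decay only improves with time, so one summable bound at the earliest time `τ` serves all later
times. Continuity and convergence of heat flows are therefore stated on `τ ≤ t`; at time zero the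
series of a general measure need not converge. -/
lemma heat_term_bound {m : ℤ → ℂ} {C τ t : ℝ} (hm : ∀ k, ‖m k‖ ≤ C) (ht : τ ≤ t) (k : ℤ)
    (x : AddCircle (2 * L)) :
    ‖decay L t k * (m k * fourier k x).re‖ ≤ decay L τ k * C :=
  (abs_heat_term_le m t k x).trans
    (mul_le_mul (decay_anti ht k) (hm k) (norm_nonneg _) (decay_pos τ k).le)

lemma summable_heat (hL : 0 < L) {m : ℤ → ℂ} {C t : ℝ} (hm : ∀ k, ‖m k‖ ≤ C) (ht : 0 < t)
    (x : AddCircle (2 * L)) : Summable fun k => decay L t k * (m k * fourier k x).re :=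
  .of_norm_bounded ((summable_decay hL ht).mul_right C) fun k => heat_term_bound hm le_rfl k x

lemma continuousOn_heat (hL : 0 < L) {m : ℤ → ℂ} {C τ : ℝ} (hm : ∀ k, ‖m k‖ ≤ C) (hτ : 0 < τ) :
    ContinuousOn (fun p : ℝ × AddCircle (2 * L) => heat L m p.1 p.2) {p | τ ≤ p.1} := by
  refine continuousOn_tsum (fun k => Continuous.continuousOn ?_)
    ((summable_decay hL hτ).mul_right C) fun k p hp => heat_term_bound hm hp k p.2
  exact ((continuous_decay k).comp continuous_fst).mul
    (Complex.continuous_re.comp (continuous_const.mul ((fourier k).continuous.comp continuous_snd)))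

lemma continuous_heat (hL : 0 < L) {m : ℤ → ℂ} {C t : ℝ} (hm : ∀ k, ‖m k‖ ≤ C) (ht : 0 < t) :
    Continuous (heat L m t) := by
  have h := (continuousOn_heat hL hm ht).comp_continuous (f := fun x => (t, x))
    (by fun_prop) (fun x => le_refl t)
  exact h

/-- Pointwise convergence of bounded Fourier coefficients gives uniform convergence of the
heat flows away from time zero. -/
lemma tendstoUniformlyOn_heat (hL : 0 < L) {ι : Type*} {l : Filter ι} {M : ι → ℤ → ℂ}
    {m : ℤ → ℂ} {C τ : ℝ} (hτ : 0 < τ) (hM : ∀ j k, ‖M j k‖ ≤ C) (hm : ∀ k, ‖m k‖ ≤ C)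
    (h : ∀ k, Tendsto (fun j => M j k) l (𝓝 (m k))) :
    TendstoUniformlyOn (fun j (p : ℝ × AddCircle (2 * L)) => heat L (M j) p.1 p.2)
      (fun p => heat L m p.1 p.2) l {p | τ ≤ p.1} := by
  have hs : Summable fun k => decay L τ k * (2 * C) := (summable_decay hL hτ).mul_right _
  have hb : ∀ j k, ‖decay L τ k * ‖M j k - m k‖‖ ≤ decay L τ k * (2 * C) := fun j k => by
    rw [Real.norm_of_nonneg (mul_nonneg (decay_pos τ k).le (norm_nonneg _))]
    refine mul_le_mul_of_nonneg_left ?_ (decay_pos τ k).le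
    have := norm_sub_le (M j k) (m k)
    linarith [hM j k, hm k]
  have h0 : Tendsto (fun j => ∑' k, decay L τ k * ‖M j k - m k‖) l (𝓝 0) := by
    have := tendsto_tsum_of_dominated_convergence (𝓕 := l)
      (f := fun j k => decay L τ k * ‖M j k - m k‖) (g := fun _ => (0 : ℝ)) hs
      (fun k => by simpa using ((h k).sub_const (m k)).norm.const_mul (decay L τ k))
      (Eventually.of_forall fun j k => hb j k)
    simpa using this
  rw [Metric.tendstoUniformlyOn_iff]
  intro ε hε
  filter_upwards [h0.eventually_lt_const hε] with j hj p hp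
  refine lt_of_le_of_lt ?_ hj
  have hp' : 0 < p.1 := lt_of_lt_of_le hτ hp
  rw [dist_comm, Real.dist_eq, heat, heat,
    ← (summable_heat hL (hM j) hp' p.2).tsum_sub (summable_heat hL hm hp' p.2)]
  have hle : ∀ k, ‖decay L p.1 k * (M j k * fourier k p.2).re
      - decay L p.1 k * (m k * fourier k p.2).re‖ ≤ decay L τ k * ‖M j k - m k‖ := fun k => by
    rw [← mul_sub, ← Complex.sub_re, ← sub_mul]
    exact (abs_heat_term_le (fun k => M j k - m k) p.1 k p.2).trans
      (mul_le_mul_of_nonneg_right (decay_anti hp k) (norm_nonneg _))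
  exact tsum_of_norm_bounded (Summable.hasSum (.of_norm_bounded hs (hb j))) hle

/-- The Fourier coefficients of the measure with density `h` with respect to `ν`. -/
noncomputable def coef (ν : Measure (AddCircle (2 * L))) (h : AddCircle (2 * L) → ℝ) (k : ℤ) : ℂ :=
  ∫ θ, (h θ : ℂ) * fourier (-k) θ ∂ν

lemma pos_of_fact (hL : Fact (0 < 2 * L)) : 0 < L := by linarith [hL.out]

lemma norm_coef_le {ν : Measure (AddCircle (2 * L))} [IsProbabilityMeasure ν]
    {h : AddCircle (2 * L) → ℝ} {C : ℝ} (hC : ∀ θ, |h θ| ≤ C) (k : ℤ) : ‖coef ν h k‖ ≤ C := by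
  have := norm_integral_le_of_norm_le_const (μ := ν) (C := C)
    (f := fun θ => (h θ : ℂ) * fourier (-k) θ) (Eventually.of_forall fun θ => by
      rw [norm_mul, norm_fourier_apply, mul_one, Complex.norm_real]; exact hC θ)
  simpa [coef] using this

lemma fourier_sub_apply (k : ℤ) (x θ : AddCircle (2 * L)) :
    (fourier k (x - θ) : ℂ) = fourier k x * fourier (-k) θ := by
  rw [fourier_apply, fourier_apply, fourier_apply, zsmul_sub, sub_eq_add_neg, AddCircle.toCircle_add,
    Circle.coe_mul, neg_zsmul]

lemma summable_decay_cesaroWeight (t : ℝ) (N : ℕ) :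
    Summable fun k => decay L t k * |cesaroWeight N k| :=
  summable_of_ne_finset_zero (s := idx N) fun k hk => by simp [cesaroWeight_of_notMem hk]

variable [hL : Fact (0 < 2 * L)]

lemma integrable_continuous {ν : Measure (AddCircle (2 * L))} [IsFiniteMeasure ν]
    {E : Type*} [NormedAddCommGroup E] {f : AddCircle (2 * L) → E}
    (hf : Continuous f) : Integrable f ν :=
  hf.integrable_of_hasCompactSupport (HasCompactSupport.of_compactSpace f)

/-- Mixing the kernel `heat L w` over a measure. -/
lemma integral_heat {w : ℤ → ℝ} {t : ℝ} (hw : Summable fun k => decay L t k * |w k|)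
    (ν : Measure (AddCircle (2 * L))) [IsFiniteMeasure ν] {h : AddCircle (2 * L) → ℝ}
    (hh : Continuous h) (x : AddCircle (2 * L)) :
    ∫ θ, h θ * heat L (fun k => (w k : ℂ)) t (x - θ) ∂ν
      = heat L (fun k => w k * coef ν h k) t x := by
  -- A character of a difference factors, so each term separates into a function of `x` and an
  -- integrand defining a Fourier coefficient.
  have hterm : ∀ k θ, h θ * (decay L t k * ((w k : ℂ) * fourier k (x - θ)).re)
      = (((decay L t k * w k : ℝ) : ℂ) * fourier k x * ((h θ : ℂ) * fourier (-k) θ)).re := by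
    intro k θ
    rw [fourier_sub_apply, ← Complex.re_ofReal_mul, ← Complex.re_ofReal_mul]
    congr 1
    push_cast
    ring
  have hc : ∀ k, Continuous fun θ => (h θ : ℂ) * fourier (-k) θ := fun k =>
    (Complex.continuous_ofReal.comp hh).mul (fourier (-k)).continuous
  simp only [heat, ← tsum_mul_left, hterm]
  rw [← integral_tsum_of_summable_integral_norm]
  · refine tsum_congr fun k => ?_
    have hi : Integrable (fun θ => ((decay L t k * w k : ℝ) : ℂ) * fourier k x *
        ((h θ : ℂ) * fourier (-k) θ)) ν := integrable_continuous (continuous_const.mul (hc k))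
    have := integral_re hi
    simp only [RCLike.re_to_complex] at this
    rw [this, integral_const_mul, ← Complex.re_ofReal_mul, coef]
    congr 1
    push_cast
    ring
  · intro k
    exact integrable_continuous (Complex.continuous_re.comp (continuous_const.mul (hc k)))
  · obtain ⟨C, hC⟩ : ∃ C, ∀ θ, |h θ| ≤ C := by
      obtain ⟨C, hC⟩ := isCompact_univ.exists_bound_of_continuousOn hh.continuousOn
      exact ⟨C, fun θ => hC θ (Set.mem_univ θ)⟩
    refine Summable.of_nonneg_of_le (fun k => integral_nonneg fun θ => norm_nonneg _) (fun k => ?_)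
      ((hw.mul_right (C * ν.real Set.univ)))
    have hb : ∀ θ, ‖(((decay L t k * w k : ℝ) : ℂ) * fourier k x *
        ((h θ : ℂ) * fourier (-k) θ)).re‖ ≤ decay L t k * |w k| * C := fun θ => by
      refine (Complex.abs_re_le_norm _).trans ?_
      rw [norm_mul, norm_mul, norm_mul, norm_fourier_apply, norm_fourier_apply, Complex.norm_real,
        Complex.norm_real, Real.norm_eq_abs, Real.norm_eq_abs, abs_mul, mul_one, mul_one,
        abs_of_pos (decay_pos t k)]
      exact mul_le_mul_of_nonneg_left (hC θ) (mul_nonneg (decay_pos t k).le (abs_nonneg _))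
    have := norm_integral_le_of_norm_le_const (μ := ν) (f := fun θ =>
      ‖(((decay L t k * w k : ℝ) : ℂ) * fourier k x * ((h θ : ℂ) * fourier (-k) θ)).re‖)
      (Eventually.of_forall fun θ => by rw [norm_norm]; exact hb θ)
    rw [Real.norm_of_nonneg (integral_nonneg fun θ => norm_nonneg _)] at this
    linarith

lemma summable_decay_one {t : ℝ} (ht : 0 < t) : Summable fun k => decay L t k * |(1 : ℝ)| := by
  simpa using summable_decay (pos_of_fact hL) ht

end SpectralEB

/-! ### Positivity of the Fejér heat kernel, the wrapped Gaussian, and the chord. -/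

namespace SpectralEB

variable {L : ℝ}

/-- Summing a function of `j - l` over a square amounts to a triangularly weighted sum. -/
lemma sum_range_sub_eq (g : ℤ → ℝ) (N : ℕ) :
    ∑ j ∈ Finset.range (N + 1), ∑ l ∈ Finset.range (N + 1), g ((j : ℤ) - l)
      = ∑ k ∈ idx N, ((N : ℝ) + 1 - |(k : ℝ)|) * g k := by
  induction N with
  | zero => simp [idx]
  | succ N ih =>
    have hidx : idx (N + 1) = insert (-((N : ℤ) + 1)) (insert ((N : ℤ) + 1) (idx N)) := by
      ext k
      simp only [idx, Finset.mem_insert, Finset.mem_Icc]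
      push_cast
      omega
    have h1 : ((N : ℤ) + 1) ∉ idx N := by simp [idx]
    have h2 : (-((N : ℤ) + 1)) ∉ insert ((N : ℤ) + 1) (idx N) := by
      simp only [idx, Finset.mem_insert, Finset.mem_Icc]; omega
    -- The negative and the nonnegative frequencies are counted separately, to match the new column
    -- and the new row below.
    have hS : ∀ M : ℕ, ∑ k ∈ idx M, g k
        = ∑ j ∈ Finset.range M, g (-(j : ℤ) - 1) + ∑ j ∈ Finset.range (M + 1), g j := by
      intro M
      induction M with
      | zero => simp [idx]
      | succ M ihM =>
        have hidx : idx (M + 1) = insert (-((M : ℤ) + 1)) (insert ((M : ℤ) + 1) (idx M)) := by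
          ext k
          simp only [idx, Finset.mem_insert, Finset.mem_Icc]
          push_cast
          omega
        have h1 : ((M : ℤ) + 1) ∉ idx M := by simp [idx]
        have h2 : (-((M : ℤ) + 1)) ∉ insert ((M : ℤ) + 1) (idx M) := by
          simp only [idx, Finset.mem_insert, Finset.mem_Icc]; omega
        rw [hidx, Finset.sum_insert h2, Finset.sum_insert h1, ihM,
          Finset.sum_range_succ (fun j : ℕ => g (-(j : ℤ) - 1)) M,
          Finset.sum_range_succ (fun j : ℕ => g (j : ℤ)) (M + 1)]
        push_cast
        rw [show -((M : ℤ) + 1) = -(M : ℤ) - 1 by ring]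
        ring
    -- Enlarging the square by one row and one column adds every difference from `-(N + 1)` to `N +
    -- 1` exactly once.
    have hL : ∑ j ∈ Finset.range (N + 1 + 1), ∑ l ∈ Finset.range (N + 1 + 1), g ((j : ℤ) - l)
        = (∑ j ∈ Finset.range (N + 1), ∑ l ∈ Finset.range (N + 1), g ((j : ℤ) - l))
          + ∑ k ∈ idx (N + 1), g k := by
      rw [Finset.sum_range_succ _ (N + 1)]
      simp_rw [Finset.sum_range_succ _ (N + 1)]
      rw [Finset.sum_add_distrib, add_assoc, hS]
      congr 1
      have e1 : ∑ j ∈ Finset.range (N + 1), g ((j : ℤ) - ((N + 1 : ℕ) : ℤ))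
          = ∑ j ∈ Finset.range (N + 1), g (-(j : ℤ) - 1) := by
        rw [← Finset.sum_range_reflect]
        refine Finset.sum_congr rfl fun j hj => ?_
        have : j ≤ N := Nat.lt_succ_iff.1 (Finset.mem_range.1 hj)
        congr 1
        rw [show N + 1 - 1 - j = N - j by omega, Nat.cast_sub this]
        push_cast; ring
      have e2 : ∑ l ∈ Finset.range (N + 1), g (((N + 1 : ℕ) : ℤ) - l)
          + g (((N + 1 : ℕ) : ℤ) - ((N + 1 : ℕ) : ℤ)) = ∑ j ∈ Finset.range (N + 1 + 1), g j := by
        rw [← Finset.sum_range_succ (fun l : ℕ => g (((N + 1 : ℕ) : ℤ) - l)),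
          ← Finset.sum_range_reflect]
        refine Finset.sum_congr rfl fun j hj => ?_
        have : j ≤ N + 1 := Nat.lt_succ_iff.1 (Finset.mem_range.1 hj)
        congr 1
        rw [show N + 1 + 1 - 1 - j = N + 1 - j by omega, Nat.cast_sub this]
        push_cast; ring
      rw [e1, e2]
    rw [hL, ih, hidx, Finset.sum_insert h2, Finset.sum_insert h1, Finset.sum_insert h2,
      Finset.sum_insert h1]
    have a1 : |((-((N : ℤ) + 1) : ℤ) : ℝ)| = (N : ℝ) + 1 := by
      push_cast; rw [abs_neg]; exact abs_of_nonneg (by positivity)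
    have a2 : |((((N : ℤ) + 1 : ℤ)) : ℝ)| = (N : ℝ) + 1 := by
      push_cast; exact abs_of_nonneg (by positivity)
    rw [a1, a2]
    have a3 : ∑ k ∈ idx N, (((N + 1 : ℕ) : ℝ) + 1 - |(k : ℝ)|) * g k
        = ∑ k ∈ idx N, ((N : ℝ) + 1 - |(k : ℝ)|) * g k + ∑ k ∈ idx N, g k := by
      rw [← Finset.sum_add_distrib]
      refine Finset.sum_congr rfl fun k _ => ?_
      push_cast; ring
    rw [a3]
    push_cast
    ring

/-- The Gaussian average of a rotated character. -/
lemma integral_fourier_gaussian (hL : 0 < L) {t : ℝ} (ht : 0 ≤ t) (k : ℤ) (z : AddCircle (2 * L)) :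
    ∫ y, (fourier k (z + ((Real.sqrt t * y : ℝ) : AddCircle (2 * L))) : ℂ) ∂gaussianReal 0 1
      = decay L t k * fourier k z := by
  have h : ∀ y : ℝ, (fourier k (z + ((Real.sqrt t * y : ℝ) : AddCircle (2 * L))) : ℂ)
      = fourier k z * Complex.exp (((Real.pi * k / L * Real.sqrt t : ℝ) : ℂ) * y * Complex.I) := by
    intro y
    have hL' : (L : ℂ) ≠ 0 := by exact_mod_cast hL.ne'
    rw [fourier_apply, zsmul_add, AddCircle.toCircle_add, Circle.coe_mul, ← fourier_apply,
      ← fourier_apply, fourier_coe_apply]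
    congr 2
    push_cast
    field_simp
  simp_rw [h]
  -- What remains is the characteristic function of the standard Gaussian.
  rw [integral_const_mul, ← charFun_apply_real, charFun_gaussianReal, mul_comm]
  congr 1
  rw [decay, Complex.ofReal_exp]
  congr 1
  have hs : ((Real.sqrt t : ℝ) : ℂ) ^ 2 = t := by
    rw [← Complex.ofReal_pow, Real.sq_sqrt ht]
  push_cast
  rw [mul_pow, hs]
  ring

/-- The double sum is the squared modulus of a sum of characters: the classical positivity of the
Fejér kernel. -/
lemma sum_fourier_sub_nonneg (N : ℕ) (w : AddCircle (2 * L)) :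
    0 ≤ ∑ j ∈ Finset.range (N + 1), ∑ l ∈ Finset.range (N + 1),
      (fourier ((j : ℤ) - l) w : ℂ).re := by
  have : ∑ j ∈ Finset.range (N + 1), ∑ l ∈ Finset.range (N + 1), (fourier ((j : ℤ) - l) w : ℂ).re
      = Complex.normSq (∑ j ∈ Finset.range (N + 1), (fourier (j : ℤ) w : ℂ)) := by
    rw [← Complex.ofReal_re (Complex.normSq _), Complex.normSq_eq_conj_mul_self, map_sum,
      mul_comm (∑ x ∈ Finset.range (N + 1), _) (∑ x ∈ Finset.range (N + 1), _),
      Finset.sum_mul_sum, Complex.re_sum]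
    refine Finset.sum_congr rfl fun j _ => ?_
    rw [Complex.re_sum]
    refine Finset.sum_congr rfl fun l _ => ?_
    rw [sub_eq_add_neg, fourier_add, fourier_neg]
  rw [this]
  exact Complex.normSq_nonneg _

/-- The heat kernel on the circle started from the Fejér kernel. -/
noncomputable def fejerHeat (L : ℝ) (N : ℕ) (t : ℝ) (z : AddCircle (2 * L)) : ℝ :=
  heat L (fun k => (cesaroWeight N k : ℂ)) t z

lemma heat_cesaro_eq_sum (N : ℕ) (m : ℤ → ℂ) (t : ℝ) (z : AddCircle (2 * L)) :
    heat L (fun k => cesaroWeight N k * m k) t z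
      = ∑ k ∈ idx N, cesaroWeight N k * (decay L t k * (m k * fourier k z).re) := by
  rw [heat, tsum_eq_sum (s := idx N) (fun k hk => by simp [cesaroWeight_of_notMem hk])]
  refine Finset.sum_congr rfl fun k _ => ?_
  rw [mul_assoc, Complex.re_ofReal_mul]
  ring

lemma fejerHeat_eq_sum (N : ℕ) (t : ℝ) (z : AddCircle (2 * L)) :
    fejerHeat L N t z = ∑ k ∈ idx N, cesaroWeight N k * (decay L t k * (fourier k z : ℂ).re) := by
  have := heat_cesaro_eq_sum N (fun _ => 1) t z
  simpa [fejerHeat] using this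

lemma continuous_fejerHeat (N : ℕ) :
    Continuous fun p : ℝ × AddCircle (2 * L) => fejerHeat L N p.1 p.2 := by
  simp_rw [fejerHeat_eq_sum]
  refine continuous_finsetSum _ fun k _ => continuous_const.mul
    (((continuous_decay k).comp continuous_fst).mul
      (Complex.continuous_re.comp ((fourier k).continuous.comp continuous_snd)))

/-- Multiplied by `N + 1`, the kernel is the Gaussian average of translates of a squared modulus.
Since the noise is written as `√t` times a standard Gaussian, `t = 0` is included. -/
lemma fejerHeat_nonneg (hL : 0 < L) (N : ℕ) {t : ℝ} (ht : 0 ≤ t) (z : AddCircle (2 * L)) :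
    0 ≤ fejerHeat L N t z := by
  have hcoe : Continuous fun y : ℝ => z + ((Real.sqrt t * y : ℝ) : AddCircle (2 * L)) :=
    continuous_const.add ((AddCircle.continuous_mk' _).comp (continuous_const.mul continuous_id))
  have hc : ∀ k : ℤ, Integrable
      (fun y => (fourier k (z + ((Real.sqrt t * y : ℝ) : AddCircle (2 * L))) : ℂ))
      (gaussianReal 0 1) := fun k =>
    Integrable.of_bound ((fourier k).continuous.comp hcoe).aestronglyMeasurable 1
      (Eventually.of_forall fun y => (norm_fourier_apply _ _).le)
  have hcr : ∀ k : ℤ, Integrable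
      (fun y => (fourier k (z + ((Real.sqrt t * y : ℝ) : AddCircle (2 * L))) : ℂ).re)
      (gaussianReal 0 1) := fun k => (hc k).re
  have hre : ∀ k : ℤ, decay L t k * (fourier k z : ℂ).re
      = ∫ y, (fourier k (z + ((Real.sqrt t * y : ℝ) : AddCircle (2 * L))) : ℂ).re
          ∂gaussianReal 0 1 := fun k => by
    have := integral_re (hc k)
    simp only [RCLike.re_to_complex] at this
    rw [this, integral_fourier_gaussian hL ht, Complex.re_ofReal_mul]
  have key : ((N : ℝ) + 1) * fejerHeat L N t z
      = ∫ y, ∑ j ∈ Finset.range (N + 1), ∑ l ∈ Finset.range (N + 1),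
        (fourier ((j : ℤ) - l) (z + ((Real.sqrt t * y : ℝ) : AddCircle (2 * L))) : ℂ).re
          ∂gaussianReal 0 1 := by
    rw [integral_finsetSum _ fun j _ => integrable_finsetSum _ fun l _ => hcr _]
    have : ∀ j : ℕ, ∫ y, ∑ l ∈ Finset.range (N + 1),
        (fourier ((j : ℤ) - l) (z + ((Real.sqrt t * y : ℝ) : AddCircle (2 * L))) : ℂ).re
          ∂gaussianReal 0 1
        = ∑ l ∈ Finset.range (N + 1), decay L t ((j : ℤ) - l) * (fourier ((j : ℤ) - l) z : ℂ).re := by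
      intro j
      rw [integral_finsetSum _ fun l _ => hcr _]
      exact Finset.sum_congr rfl fun l _ => (hre _).symm
    simp_rw [this]
    rw [sum_range_sub_eq (fun k => decay L t k * (fourier k z : ℂ).re), fejerHeat_eq_sum,
      Finset.mul_sum]
    refine Finset.sum_congr rfl fun k hk => ?_
    rw [cesaroWeight_of_mem hk]
    field_simp
  have h0 : 0 ≤ ((N : ℝ) + 1) * fejerHeat L N t z := by
    rw [key]
    exact integral_nonneg fun y => sum_fourier_sub_nonneg N _
  exact nonneg_of_mul_nonneg_right h0 (by positivity)

/-- The heat kernel of the circle is the wrapped Gaussian density. -/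
lemma hasSum_heat_one (hL : 0 < L) {t : ℝ} (ht : 0 < t) (z : ℝ) :
    HasSum (fun n : ℤ => 2 * L * gaussianPDFReal 0 t.toNNReal (z + n * (2 * L)))
      (heat L (fun _ => 1) t (z : AddCircle (2 * L))) := by
  have hL' : (L : ℂ) ≠ 0 := by exact_mod_cast hL.ne'
  have hpi : (Real.pi : ℂ) ≠ 0 := by exact_mod_cast Real.pi_ne_zero
  have ht' : (t : ℂ) ≠ 0 := by exact_mod_cast ht.ne'
  -- The parameters for Poisson summation: `a` encodes the time, and the purely imaginary shift `b`
  -- encodes the point `z`, so that the left-hand terms are those of the Fourier series.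
  obtain ⟨a, ha⟩ : ∃ a : ℝ, a = Real.pi * t / (2 * L ^ 2) := ⟨_, rfl⟩
  have ha0 : 0 < a := by rw [ha]; positivity
  obtain ⟨b, hb⟩ : ∃ b : ℂ, b = Complex.I * (z / (2 * L)) := ⟨_, rfl⟩
  have hP := Complex.tsum_exp_neg_quadratic (a := a) (by simpa using ha0) b
  have hsum : Summable fun k : ℤ => ((decay L t k : ℝ) : ℂ) * fourier k (z : AddCircle (2 * L)) := by
    refine .of_norm_bounded (summable_decay hL ht) fun k => ?_
    rw [norm_mul, norm_fourier_apply, mul_one, Complex.norm_real, Real.norm_of_nonneg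
      (decay_pos t k).le]
  have hl : ∀ k : ℤ, Complex.exp (-Real.pi * a * (k : ℂ) ^ 2 + 2 * Real.pi * b * k)
      = ((decay L t k : ℝ) : ℂ) * fourier k (z : AddCircle (2 * L)) := by
    intro k
    rw [fourier_coe_apply, decay, Complex.ofReal_exp, ← Complex.exp_add]
    congr 1
    rw [ha, hb]
    push_cast
    field_simp
  have hconst : (1 : ℂ) / (a : ℂ) ^ (1 / 2 : ℂ) = ((1 / Real.sqrt a : ℝ) : ℂ) := by
    have := Complex.ofReal_cpow ha0.le (1 / 2)
    push_cast at this
    rw [Real.sqrt_eq_rpow, Complex.ofReal_div, Complex.ofReal_one, this]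
  have hsq : 1 / Real.sqrt a = 2 * L * (Real.sqrt (2 * Real.pi * t))⁻¹ := by
    rw [← Real.sqrt_inv, one_div, ← Real.sqrt_inv, ← Real.sqrt_sq (by positivity : 0 ≤ 2 * L),
      ← Real.sqrt_mul (by positivity), ha]
    congr 1
    field_simp
  -- Here `n + I * b` is `n - z / (2 * L)`, so the translates appear with reversed index; the
  -- reflection of `ℤ` at the end undoes this.
  have hr : ∀ n : ℤ, ((1 / Real.sqrt a : ℝ) : ℂ) *
      Complex.exp (-Real.pi / a * ((n : ℂ) + Complex.I * b) ^ 2)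
      = ((2 * L * gaussianPDFReal 0 t.toNNReal (z + ((-n : ℤ) : ℝ) * (2 * L)) : ℝ) : ℂ) := by
    intro n
    rw [gaussianPDFReal, Real.coe_toNNReal _ ht.le, ← mul_assoc, Complex.ofReal_mul _ (Real.exp _),
      Complex.ofReal_exp, hsq]
    congr 2
    rw [ha, hb, ← mul_assoc, Complex.I_mul_I]
    push_cast
    field_simp
    ring
  simp_rw [hl] at hP
  rw [hconst, ← tsum_mul_left] at hP
  simp_rw [hr] at hP
  have hne : heat L (fun _ => 1) t (z : AddCircle (2 * L))
      = ∑' n : ℤ, 2 * L * gaussianPDFReal 0 t.toNNReal (z + ((-n : ℤ) : ℝ) * (2 * L)) := by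
    rw [← Complex.ofReal_tsum] at hP
    rw [← Complex.ofReal_re (∑' n : ℤ, _), ← hP, Complex.re_tsum hsum, heat]
    exact tsum_congr fun k => by rw [one_mul, Complex.re_ofReal_mul]
  -- An identity of `tsum`s does not contain summability. Dropping `z²` and bounding `z * n` below
  -- by `-|z| |n|` leaves a theta bound.
  have hs : Summable fun n : ℤ => 2 * L * gaussianPDFReal 0 t.toNNReal (z + n * (2 * L)) := by
    have hT : 0 < 2 * L ^ 2 / (Real.pi * t) := by positivity
    have h0 := (summable_pow_mul_jacobiTheta₂_term_bound (L * |z| / (Real.pi * t)) hT 0).mul_left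
      (2 * L * (Real.sqrt (2 * Real.pi * t))⁻¹)
    refine .of_nonneg_of_le (fun n => mul_nonneg (by positivity) (gaussianPDFReal_nonneg _ _ _))
      (fun n => ?_) h0
    rw [gaussianPDFReal, Real.coe_toNNReal _ ht.le, pow_zero, one_mul, ← mul_assoc]
    refine mul_le_mul_of_nonneg_left (Real.exp_le_exp.2 ?_) (by positivity)
    have h1 : -Real.pi * (2 * L ^ 2 / (Real.pi * t) * (n : ℝ) ^ 2
        - 2 * (L * |z| / (Real.pi * t)) * ((|n| : ℤ) : ℝ))
        = -(4 * L ^ 2 * (n : ℝ) ^ 2 - 4 * L * (|z| * |(n : ℝ)|)) / (2 * t) := by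
      push_cast
      field_simp
      ring
    rw [h1]
    refine div_le_div_of_nonneg_right (neg_le_neg ?_) (by positivity)
    have h2 : -(|z| * |(n : ℝ)|) ≤ z * n := by rw [← abs_mul]; exact neg_abs_le _
    nlinarith [sq_nonneg z]
  have hs' : Summable fun n : ℤ => 2 * L * gaussianPDFReal 0 t.toNNReal
      (z + ((-n : ℤ) : ℝ) * (2 * L)) := (Equiv.neg ℤ).summable_iff.2 hs
  have := hne ▸ hs'.hasSum
  exact (Equiv.neg ℤ).hasSum_iff.1 this

/-- Invisible in the Fourier series, but immediate from the wrapped Gaussian. Strict positivity is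
what later permits division by noisy densities. -/
lemma heat_one_pos (hL : 0 < L) {t : ℝ} (ht : 0 < t) (z : AddCircle (2 * L)) :
    0 < heat L (fun _ => 1) t z := by
  obtain ⟨z, rfl⟩ := QuotientAddGroup.mk_surjective z
  have h := hasSum_heat_one hL ht z
  have hpos : ∀ n : ℤ, 0 < 2 * L * gaussianPDFReal 0 t.toNNReal (z + n * (2 * L)) := fun n =>
    mul_pos (by positivity) (gaussianPDFReal_pos _ _ _ (by simpa using ht))
  exact h.summable.tsum_pos (fun n => (hpos n).le) 0 (hpos 0) |>.trans_eq h.tsum_eq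

/-- The multiplier `2 - 2 cos` measuring the squared distance on the circle. -/
noncomputable def chordSq (L : ℝ) (z : AddCircle (2 * L)) : ℝ := 2 - 2 * (fourier 1 z : ℂ).re

lemma continuous_chordSq : Continuous (chordSq L) :=
  continuous_const.sub (continuous_const.mul (Complex.continuous_re.comp (fourier 1).continuous))

lemma chordSq_nonneg (z : AddCircle (2 * L)) : 0 ≤ chordSq L z := by
  have := (Complex.abs_re_le_norm _).trans (norm_fourier_apply 1 z).le
  rw [chordSq]
  linarith [abs_le.1 this]

/-- Multiplication by the squared chord acts on Fourier coefficients as minus a second difference.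
-/
lemma chordSq_mul_re (k : ℤ) (z : AddCircle (2 * L)) : chordSq L z * (fourier k z : ℂ).re
    = 2 * (fourier k z : ℂ).re - (fourier (k + 1) z : ℂ).re - (fourier (k - 1) z : ℂ).re := by
  rw [chordSq, sub_eq_add_neg k 1, fourier_add, fourier_add, fourier_neg]
  simp only [Complex.mul_re, Complex.conj_re, Complex.conj_im]
  ring

/-- A summable bound for `s * exp (-s k²)`, uniform over `s ≤ σ`. -/
noncomputable def spread (σ : ℝ) : ℝ := ∑' k : ℤ, min σ (2 / (1 + (k : ℝ) ^ 2))

lemma summable_two_div : Summable fun k : ℤ => 2 / (1 + (k : ℝ) ^ 2) := by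
  have h1 : Summable fun k : ℤ => (1 : ℝ) / (k : ℝ) ^ 2 :=
    Real.summable_one_div_int_pow.2 one_lt_two
  have h2 : Summable fun k : ℤ => 2 * ((1 : ℝ) / (k : ℝ) ^ 2) := h1.mul_left 2
  refine Summable.of_norm_bounded_eventually h2 ?_
  filter_upwards [(Set.finite_singleton (0 : ℤ)).compl_mem_cofinite] with k hk
  have hk : (k : ℝ) ≠ 0 := by exact_mod_cast hk
  have : 0 < (k : ℝ) ^ 2 := by positivity
  rw [Real.norm_of_nonneg (by positivity), mul_one_div]
  exact div_le_div_of_nonneg_left (by norm_num) this (by linarith)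

lemma summable_spread {σ : ℝ} (hσ : 0 ≤ σ) :
    Summable fun k : ℤ => min σ (2 / (1 + (k : ℝ) ^ 2)) :=
  .of_nonneg_of_le (fun k => le_min hσ (by positivity)) (fun k => min_le_right _ _) summable_two_div

lemma tendsto_spread : Tendsto spread (𝓝[≥] 0) (𝓝 0) := by
  have := tendsto_tsum_of_dominated_convergence (𝓕 := 𝓝[≥] (0 : ℝ))
    (f := fun σ (k : ℤ) => min σ (2 / (1 + (k : ℝ) ^ 2))) (g := fun _ => (0 : ℝ))
    summable_two_div (fun k => ?_) ?_
  · rw [tsum_zero] at this; exact this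
  · have : Tendsto (fun σ : ℝ => min σ (2 / (1 + (k : ℝ) ^ 2))) (𝓝 0)
        (𝓝 (min 0 (2 / (1 + (k : ℝ) ^ 2)))) := tendsto_id.min tendsto_const_nhds
    rw [min_eq_left (by positivity)] at this
    exact this.mono_left nhdsWithin_le_nhds
  · filter_upwards [self_mem_nhdsWithin] with σ hσ k
    rw [Real.norm_of_nonneg (le_min hσ (by positivity))]
    exact min_le_right _ _

end SpectralEB

/-! ### Concentration of the Fejér heat kernel at short times. -/

namespace SpectralEB

variable {L : ℝ}

lemma decay_eq_exp (t : ℝ) (k : ℤ) :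
    decay L t k = Real.exp (-((Real.pi / L) ^ 2 * t / 2 * (k : ℝ) ^ 2)) := by
  rw [decay]; congr 1; ring

lemma decay_neg (t : ℝ) (k : ℤ) : decay L t (-k) = decay L t k := by
  simp [decay_eq_exp]

lemma cesaroWeight_neg (N : ℕ) (k : ℤ) : cesaroWeight N (-k) = cesaroWeight N k := by
  simp [cesaroWeight]

/-- The coefficients of the kernel are nearly convex in `k`. The triangular weight is convex except
at its tip `k = 0`, which costs `2 / (N + 1)`. The Gaussian factor loses at most a multiple of
itself proportional to `t`. The mixed term for `k > 0` has a favourable sign, since both factors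
decrease away from zero. -/
lemma second_difference_le {t : ℝ} (ht : 0 ≤ t) (N : ℕ) (k : ℤ) :
    2 * (decay L t k * cesaroWeight N k) - decay L t (k - 1) * cesaroWeight N (k - 1)
      - decay L t (k + 1) * cesaroWeight N (k + 1)
      ≤ 2 * ((Real.pi / L) ^ 2 * t / 2 * (decay L t k * cesaroWeight N k))
        + if k = 0 then 2 / ((N : ℝ) + 1) else 0 := by
  obtain ⟨s, hs⟩ : ∃ s, s = (Real.pi / L) ^ 2 * t / 2 := ⟨_, rfl⟩
  have hs0 : 0 ≤ s := by rw [hs]; positivity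
  have ha : ∀ k, decay L t k = Real.exp (-(s * (k : ℝ) ^ 2)) := fun k => by rw [decay_eq_exp, hs]
  rw [← hs]
  have hN : (0 : ℝ) < (N : ℝ) + 1 := by positivity
  wlog hk : 0 ≤ k generalizing k with H
  · have h := H (-k) (by omega)
    rw [show -k - 1 = -(k + 1) by ring, show -k + 1 = -(k - 1) by ring] at h
    simp only [decay_neg, cesaroWeight_neg, neg_eq_zero] at h
    linarith
  rcases hk.eq_or_lt with rfl | hk
  · have h1 : decay L t (0 - 1) = decay L t 1 := by rw [← decay_neg]; norm_num
    have h2 : cesaroWeight N (0 - 1) = cesaroWeight N 1 := by rw [← cesaroWeight_neg]; norm_num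
    have h3 : decay L t 0 = 1 := by simp [decay]
    have h4 : cesaroWeight N 0 = 1 := by simp [cesaroWeight]
    have h5 : 1 - s ≤ decay L t 1 := by
      rw [ha]
      have := Real.add_one_le_exp (-(s * ((1 : ℤ) : ℝ) ^ 2))
      push_cast at this ⊢
      linarith
    have h6 : 1 - 1 / ((N : ℝ) + 1) ≤ cesaroWeight N 1 := by
      have := le_max_right 0 (1 - |((1 : ℤ) : ℝ)| / ((N : ℝ) + 1))
      simpa only [cesaroWeight, Int.cast_one, abs_one] using this
    rw [zero_add, h1, h2, h3, h4, if_pos rfl]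
    have h7 := cesaroWeight_nonneg N 1
    have h8 := cesaroWeight_le_one N 1
    have h9 : 2 / ((N : ℝ) + 1) = 2 * (1 / ((N : ℝ) + 1)) := by ring
    rw [h9]
    nlinarith [mul_le_mul_of_nonneg_right h5 h7, mul_nonneg hs0 (sub_nonneg.2 h8)]
  · rw [if_neg hk.ne', add_zero]
    have p0 := decay_pos (L := L) t (k - 1)
    have p1 := decay_pos (L := L) t (k + 1)
    have p2 := decay_pos (L := L) t k
    have w0 := cesaroWeight_nonneg N (k - 1)
    have w1 := cesaroWeight_nonneg N (k + 1)
    have w2 := cesaroWeight_nonneg N k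
    have hk1 : (1 : ℝ) ≤ k := by exact_mod_cast hk
    by_cases hm : k ∈ idx N
    · have e0 : cesaroWeight N (k - 1) = cesaroWeight N k + 1 / ((N : ℝ) + 1) := by
        have hm' : k - 1 ∈ idx N := by rw [Finset.mem_Icc] at hm ⊢; omega
        rw [cesaroWeight_of_mem hm, cesaroWeight_of_mem hm', Int.cast_sub, Int.cast_one,
          abs_of_nonneg (by linarith), abs_of_nonneg (by linarith)]
        field_simp
        ring
      have e1 : cesaroWeight N k - 1 / ((N : ℝ) + 1) ≤ cesaroWeight N (k + 1) := by
        refine le_trans (le_of_eq ?_) (le_max_right _ _)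
        rw [cesaroWeight_of_mem hm, Int.cast_add, Int.cast_one,
          abs_of_nonneg (by linarith), abs_of_nonneg (by linarith)]
        field_simp
        ring
      have m1 : decay L t (k + 1) ≤ decay L t (k - 1) := by
        rw [ha, ha]
        refine Real.exp_le_exp.2 (neg_le_neg (mul_le_mul_of_nonneg_left ?_ hs0))
        push_cast
        nlinarith
      -- The right side is `2 * decay L t k * exp (-s) * cosh (2 * s * k)`; bound `cosh` below by
      -- one and `exp (-s)` by `1 - s`.
      have m2 : 2 * decay L t k * (1 - s) ≤ decay L t (k - 1) + decay L t (k + 1) := by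
        have f0 : decay L t (k - 1) = decay L t k * Real.exp (-s) * Real.exp (2 * s * k) := by
          rw [ha, ha, ← Real.exp_add, ← Real.exp_add]; congr 1; push_cast; ring
        have f1 : decay L t (k + 1) = decay L t k * Real.exp (-s) * Real.exp (-(2 * s * k)) := by
          rw [ha, ha, ← Real.exp_add, ← Real.exp_add]; congr 1; push_cast; ring
        have g0 := Real.add_one_le_exp (2 * s * k)
        have g1 := Real.add_one_le_exp (-(2 * s * k))
        have g2 := Real.add_one_le_exp (-s)
        have g3 : 0 < decay L t k * Real.exp (-s) := mul_pos p2 (Real.exp_pos _)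
        rw [f0, f1, ← mul_add]
        calc 2 * decay L t k * (1 - s) ≤ decay L t k * Real.exp (-s) * 2 := by nlinarith
          _ ≤ _ := mul_le_mul_of_nonneg_left (by linarith) g3.le
      have hd : 0 < 1 / ((N : ℝ) + 1) := by positivity
      rw [e0]
      nlinarith [mul_le_mul_of_nonneg_left e1 p1.le, mul_le_mul_of_nonneg_right m2 w2,
        mul_nonneg hd.le (sub_nonneg.2 m1)]
    · rw [cesaroWeight_of_notMem hm]
      nlinarith [mul_nonneg p0.le w0, mul_nonneg p1.le w1]

/-- The heat kernel is small away from the diagonal, uniformly for short times and large `N`. -/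
lemma chordSq_mul_fejerHeat_le {t σ : ℝ} (ht : 0 ≤ t) (hσ : (Real.pi / L) ^ 2 * t / 2 ≤ σ)
    (hσ1 : σ ≤ 1) (N : ℕ) (z : AddCircle (2 * L)) :
    chordSq L z * fejerHeat L N t z ≤ 4 / ((N : ℝ) + 1) + 4 * spread σ := by
  obtain ⟨s, hs⟩ : ∃ s, s = (Real.pi / L) ^ 2 * t / 2 := ⟨_, rfl⟩
  have hs0 : 0 ≤ s := by rw [hs]; positivity
  have hσ0 : 0 ≤ σ := by rw [← hs] at hσ; linarith
  obtain ⟨b, hb⟩ : ∃ b : ℤ → ℝ, ∀ k, b k = decay L t k * cesaroWeight N k := ⟨_, fun _ => rfl⟩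
  have hb0 : ∀ k, 0 ≤ b k := fun k => by
    rw [hb]; exact mul_nonneg (decay_pos t k).le (cesaroWeight_nonneg N k)
  obtain ⟨c, hc⟩ : ∃ c : ℤ → ℝ, ∀ k, c k = (fourier k z : ℂ).re := ⟨_, fun _ => rfl⟩
  have hc1 : ∀ k, |c k| ≤ 1 := fun k => by
    rw [hc]; exact (Complex.abs_re_le_norm _).trans (norm_fourier_apply k z).le
  have hsb : Summable b := summable_of_ne_finset_zero (s := idx N) fun k hk => by
    simp [hb, cesaroWeight_of_notMem hk]
  have hsm : Summable fun k => b (k - 1) := (Equiv.subRight (1 : ℤ)).summable_iff.2 hsb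
  have hsp : Summable fun k => b (k + 1) := (Equiv.addRight (1 : ℤ)).summable_iff.2 hsb
  have hmul : ∀ {f : ℤ → ℝ} (e : ℤ → ℤ), Summable f → Summable fun k => f k * c (e k) :=
    fun {f} e hf => .of_norm_bounded hf.norm fun k => by
      rw [norm_mul]
      exact mul_le_of_le_one_right (norm_nonneg _) (hc1 _)
  -- Summation by parts moves the second difference from the characters onto the coefficients.
  have hid : chordSq L z * fejerHeat L N t z = ∑' k, (2 * b k - b (k - 1) - b (k + 1)) * c k := by
    have e1 : ∑' k, b k * c (k + 1) = ∑' k, b (k - 1) * c k := by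
      rw [← (Equiv.addRight (1 : ℤ)).tsum_eq (fun k => b (k - 1) * c k)]
      simp
    have e2 : ∑' k, b k * c (k - 1) = ∑' k, b (k + 1) * c k := by
      rw [← (Equiv.subRight (1 : ℤ)).tsum_eq (fun k => b (k + 1) * c k)]
      simp
    have e3 : fejerHeat L N t z = ∑' k, b k * c k := by
      rw [fejerHeat, heat]
      refine tsum_congr fun k => ?_
      rw [Complex.re_ofReal_mul, hb, hc]; ring
    have e4 : ∀ k, chordSq L z * (b k * c k) = 2 * (b k * c k) - b k * c (k + 1) - b k * c (k - 1) :=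
      fun k => by
        have := chordSq_mul_re k z
        rw [hc, hc, hc]
        linear_combination (b k) * this
    have i0 := (hmul id hsb).mul_left 2
    simp only [id] at i0
    rw [e3, ← tsum_mul_left]
    simp_rw [e4]
    have i1 : Summable fun k => b (k - 1) * c k := hmul id hsm
    have i2 : Summable fun k => b (k + 1) * c k := hmul id hsp
    rw [(i0.sub (hmul _ hsb)).tsum_sub (hmul _ hsb), i0.tsum_sub (hmul _ hsb), e1, e2,
      ← i0.tsum_sub i1, ← (i0.sub i1).tsum_sub i2]
    exact tsum_congr fun k => by ring
  obtain ⟨d, hd⟩ : ∃ d : ℤ → ℝ, ∀ k, d k = 2 * b k - b (k - 1) - b (k + 1) := ⟨_, fun _ => rfl⟩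
  obtain ⟨D, hD⟩ : ∃ D : ℤ → ℝ, ∀ k, D k = 2 * (s * b k) + if k = 0 then 2 / ((N : ℝ) + 1) else 0 :=
    ⟨_, fun _ => rfl⟩
  have hdD : ∀ k, d k ≤ D k := fun k => by
    rw [hd, hD, hb, hb, hb, hs]; exact second_difference_le ht N k
  have hD0 : ∀ k, 0 ≤ D k := fun k => by
    rw [hD]
    have := mul_nonneg hs0 (hb0 k)
    have : 0 ≤ if k = 0 then 2 / ((N : ℝ) + 1) else 0 := by split_ifs <;> positivity
    linarith
  have hite : HasSum (fun k : ℤ => if k = 0 then 2 / ((N : ℝ) + 1) else 0) (2 / ((N : ℝ) + 1)) :=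
    hasSum_ite_eq 0 _
  have hsD : Summable D := by
    rw [funext hD]; exact ((hsb.mul_left s).mul_left 2).add hite.summable
  have hsd : Summable d := by
    rw [funext hd]; exact ((hsb.mul_left 2).sub hsm).sub hsp
  -- Second differences of a summable sequence sum to zero. An upper bound on `d` alone therefore
  -- controls the sum of `|d|`.
  have hd0 : ∑' k, d k = 0 := by
    simp_rw [hd]
    have e1 : ∑' k, b (k - 1) = ∑' k, b k := (Equiv.subRight (1 : ℤ)).tsum_eq b
    have e2 : ∑' k, b (k + 1) = ∑' k, b k := (Equiv.addRight (1 : ℤ)).tsum_eq b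
    rw [((hsb.mul_left 2).sub hsm).tsum_sub hsp, (hsb.mul_left 2).tsum_sub hsm, tsum_mul_left,
      e1, e2]
    ring
  have hDle : ∑' k, D k ≤ 2 * spread σ + 2 / ((N : ℝ) + 1) := by
    simp_rw [hD]
    rw [((hsb.mul_left s).mul_left 2).tsum_add hite.summable, hite.tsum_eq, tsum_mul_left]
    refine add_le_add_left (mul_le_mul_of_nonneg_left ?_ zero_le_two) _
    -- Each `s * b k` is at most `σ` because `b k ≤ 1`, and at most `2 / (1 + k ^ 2)` because `y *
    -- exp (-y) ≤ 1` for `y = s * k ^ 2`.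
    refine (hsb.mul_left s).tsum_le_tsum (fun k => ?_) (summable_spread hσ0)
    have hbk : b k ≤ Real.exp (-(s * (k : ℝ) ^ 2)) := by
      rw [hb, decay_eq_exp, hs]
      exact mul_le_of_le_one_right (Real.exp_pos _).le (cesaroWeight_le_one N k)
    have hy : 0 ≤ s * (k : ℝ) ^ 2 := by positivity
    refine le_min ?_ ?_
    · have : b k ≤ 1 := hbk.trans (Real.exp_le_one_iff.2 (neg_nonpos.2 hy))
      rw [← hs] at hσ
      nlinarith
    · rw [le_div_iff₀ (by positivity)]
      have h1 : s * (k : ℝ) ^ 2 * Real.exp (-(s * (k : ℝ) ^ 2)) ≤ 1 := by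
        rw [Real.exp_neg, ← div_eq_mul_inv, div_le_one (Real.exp_pos _)]
        linarith [Real.add_one_le_exp (s * (k : ℝ) ^ 2)]
      have h2 : Real.exp (-(s * (k : ℝ) ^ 2)) ≤ 1 := Real.exp_le_one_iff.2 (neg_nonpos.2 hy)
      have h3 : s ≤ 1 := by rw [← hs] at hσ; linarith
      calc s * b k * (1 + (k : ℝ) ^ 2) = s * b k + (s * (k : ℝ) ^ 2) * b k := by ring
        _ ≤ 1 + 1 := add_le_add
          (mul_le_one₀ h3 (hb0 k) (hbk.trans h2))
          ((mul_le_mul_of_nonneg_left hbk hy).trans h1)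
        _ = 2 := by norm_num
  rw [hid]
  simp_rw [← hd]
  -- Termwise, `d * c ≤ |d| ≤ 2 * D - d` since `|c| ≤ 1`, `d ≤ D` and `0 ≤ D`.
  calc ∑' k, d k * c k ≤ ∑' k, (2 * D k - d k) := by
        refine (hmul id hsd).tsum_le_tsum (fun k => ?_) ((hsD.mul_left 2).sub hsd)
        have h1 := abs_le.1 (hc1 k)
        have h2 := hdD k
        have h3 := hD0 k
        nlinarith
    _ = 2 * ∑' k, D k := by rw [(hsD.mul_left 2).tsum_sub hsd, hd0, tsum_mul_left, sub_zero]
    _ ≤ 2 * (2 * spread σ + 2 / ((N : ℝ) + 1)) := mul_le_mul_of_nonneg_left hDle zero_le_two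
    _ = _ := by ring

/-- A continuous function oscillates little near the diagonal of the circle, and its oscillation
elsewhere is controlled by the chord. -/
lemma exists_abs_sub_le_add_chordSq (hL : Fact (0 < 2 * L)) {h : AddCircle (2 * L) → ℝ}
    (hh : Continuous h) {ε : ℝ} (hε : 0 < ε) :
    ∃ C, 0 ≤ C ∧ ∀ x θ, |h θ - h x| ≤ ε + C * chordSq L (x - θ) := by
  have hpos : ∀ z : AddCircle (2 * L), z ≠ 0 → 0 < chordSq L z := by
    intro z hz
    refine lt_of_le_of_ne (chordSq_nonneg z) fun h0 => hz ?_
    have hre : (fourier 1 z : ℂ).re = 1 := by rw [chordSq] at h0; linarith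
    have hn := norm_fourier_apply 1 z
    have him : (fourier 1 z : ℂ).im = 0 := by
      have := Complex.normSq_apply (fourier 1 z : ℂ)
      rw [Complex.normSq_eq_norm_sq, hn, hre] at this
      nlinarith
    have h1 : (fourier 1 z : ℂ) = 1 := Complex.ext hre him
    rw [fourier_one] at h1
    have h2 : AddCircle.toCircle z = AddCircle.toCircle (0 : AddCircle (2 * L)) := by
      rw [AddCircle.toCircle_zero]; exact Circle.ext (by simpa using h1)
    exact AddCircle.injective_toCircle hL.out.ne' h2
  -- On this compact set of pairs with large oscillation the chord does not vanish, so oscillation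
  -- over chord is bounded there; off it `ε` suffices.
  let K : Set (AddCircle (2 * L) × AddCircle (2 * L)) := {p | ε ≤ |h p.2 - h p.1|}
  have hK : IsCompact K := by
    refine IsClosed.isCompact (isClosed_le continuous_const ?_)
    fun_prop
  have hcont : ContinuousOn (fun p : AddCircle (2 * L) × AddCircle (2 * L) =>
      |h p.2 - h p.1| / chordSq L (p.1 - p.2)) K := by
    refine ContinuousOn.div (by fun_prop)
      (continuous_chordSq.comp (continuous_fst.sub continuous_snd)).continuousOn fun p hp => ?_
    refine (hpos _ fun h0 => ?_).ne'
    have : ε ≤ |h p.2 - h p.1| := hp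
    rw [sub_eq_zero.1 h0, sub_self, abs_zero] at this
    exact absurd this (not_le.2 hε)
  obtain ⟨C, hC⟩ := hK.exists_bound_of_continuousOn hcont
  refine ⟨max C 0, le_max_right _ _, fun x θ => ?_⟩
  by_cases hp : (x, θ) ∈ K
  · have h1 := hC _ hp
    have hne : x - θ ≠ 0 := fun h0 => by
      have : ε ≤ |h θ - h x| := hp
      rw [sub_eq_zero.1 h0, sub_self, abs_zero] at this
      exact absurd this (not_le.2 hε)
    have h2 := hpos _ hne
    rw [Real.norm_of_nonneg (div_nonneg (abs_nonneg _) h2.le), div_le_iff₀ h2] at h1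
    nlinarith [le_max_left C 0]
  · have h1 : |h θ - h x| < ε := not_le.1 hp
    have := mul_nonneg (le_max_right C 0) (chordSq_nonneg (x - θ))
    linarith

end SpectralEB

/-! ### Noisy laws on the circle and their densities. -/

namespace SpectralEB

variable {L : ℝ}

/-- Integrating over the line by summing over the translates of a period. -/
lemma lintegral_eq_lintegral_tsum_translates {T : ℝ} (hT : 0 < T) (a : ℝ) {f : ℝ → ℝ≥0∞}
    (hf : Measurable f) :
    ∫⁻ v, f v = ∫⁻ v in Set.Ioc a (a + T), ∑' n : ℤ, f (v + n * T) := by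
  have h1 := lintegral_iUnion (μ := volume) (fun n : ℤ => measurableSet_Ioc)
    (Set.pairwise_disjoint_Ioc_add_zsmul a T) f
  rw [iUnion_Ioc_add_zsmul hT, Measure.restrict_univ] at h1
  rw [h1, lintegral_tsum (f := fun (n : ℤ) v => f (v + n * T))
    fun n => (hf.comp (measurable_id.add_const _)).aemeasurable]
  refine tsum_congr fun n => ?_
  have h2 := (measurePreserving_add_right (volume : Measure ℝ) ((n : ℝ) * T)).setLIntegral_comp_preimage
    (s := Set.Ioc (a + n • T) (a + (n + 1) • T)) measurableSet_Ioc hf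
  rw [← h2]
  congr 2
  ext v
  simp only [Set.mem_preimage, Set.mem_Ioc, zsmul_eq_mul]
  push_cast
  constructor <;> rintro ⟨h, h'⟩ <;> constructor <;> linarith

lemma continuous_noise : Continuous fun q : ℝ × (AddCircle (2 * L) × ℝ) =>
    q.2.1 + ((Real.sqrt q.1 * q.2.2 : ℝ) : AddCircle (2 * L)) :=
  (continuous_fst.comp continuous_snd).add ((AddCircle.continuous_mk' _).comp
    ((Real.continuous_sqrt.comp continuous_fst).mul (continuous_snd.comp continuous_snd)))

lemma norm_coef_one_le (P : Measure (AddCircle (2 * L))) [IsProbabilityMeasure P] (k : ℤ) :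
    ‖coef P (fun _ => 1) k‖ ≤ 1 := norm_coef_le (fun _ => by simp) k

/-- The law on the circle of `u + √t z`, where `u` has law `P` and `z` is standard Gaussian. -/
noncomputable def noisyLaw (P : Measure (AddCircle (2 * L))) (t : ℝ) : Measure (AddCircle (2 * L)) :=
  (P.prod (gaussianReal 0 1)).map fun p => p.1 + ((Real.sqrt t * p.2 : ℝ) : AddCircle (2 * L))

lemma measurable_noise (t : ℝ) : Measurable fun p : AddCircle (2 * L) × ℝ =>
    p.1 + ((Real.sqrt t * p.2 : ℝ) : AddCircle (2 * L)) :=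
  (continuous_noise.comp (Continuous.prodMk_right t)).measurable

/-- Scaling a fixed Gaussian by `√t` makes variance zero an ordinary parameter value, as is needed
for samples with vanishing noise. -/
lemma noisyLaw_zero (P : Measure (AddCircle (2 * L))) [IsProbabilityMeasure P] :
    noisyLaw P 0 = P := by
  have : (fun p : AddCircle (2 * L) × ℝ => p.1 + ((Real.sqrt 0 * p.2 : ℝ) : AddCircle (2 * L)))
      = Prod.fst := by
    funext p; simp
  rw [noisyLaw, this, Measure.map_fst_prod, measure_univ, one_smul]

lemma gaussianReal_map_sqrt_mul {t : ℝ} (ht : 0 ≤ t) :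
    (gaussianReal 0 1).map (fun y => Real.sqrt t * y) = gaussianReal 0 t.toNNReal := by
  rw [gaussianReal_map_const_mul, mul_zero]
  congr 1
  ext
  simp [Real.sq_sqrt ht, ht]

lemma lintegral_noisyLaw (P : Measure (AddCircle (2 * L))) [IsProbabilityMeasure P] {t : ℝ}
    (ht : 0 ≤ t) {g : AddCircle (2 * L) → ℝ≥0∞} (hg : Measurable g) :
    ∫⁻ x, g x ∂noisyLaw P t
      = ∫⁻ u, ∫⁻ v : ℝ, g (u + (v : AddCircle (2 * L))) ∂gaussianReal 0 t.toNNReal ∂P := by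
  rw [noisyLaw, lintegral_map hg (measurable_noise t),
    lintegral_prod (fun p : AddCircle (2 * L) × ℝ =>
      g (p.1 + ((Real.sqrt t * p.2 : ℝ) : AddCircle (2 * L))))
      (hg.comp (measurable_noise t)).aemeasurable]
  refine lintegral_congr fun u => ?_
  rw [← gaussianReal_map_sqrt_mul ht, lintegral_map (f := fun v : ℝ => g (u + (v : AddCircle (2 * L))))
    (hg.comp (AddCircle.measurable_mk'.const_add u)) (measurable_const_mul _)]

lemma integral_noisyLaw_eq (P : Measure (AddCircle (2 * L))) (t : ℝ) {g : AddCircle (2 * L) → ℝ}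
    (hg : Continuous g) :
    ∫ x, g x ∂noisyLaw P t = ∫ p, g (p.1 + ((Real.sqrt t * p.2 : ℝ) : AddCircle (2 * L)))
      ∂(P.prod (gaussianReal 0 1)) :=
  integral_map (measurable_noise t).aemeasurable hg.aestronglyMeasurable

variable [hL : Fact (0 < 2 * L)]

lemma lintegral_volume_eq (f : AddCircle (2 * L) → ℝ≥0∞) :
    ∫⁻ x, f x = ENNReal.ofReal (2 * L) * ∫⁻ x, f x ∂AddCircle.haarAddCircle := by
  rw [AddCircle.volume_eq_smul_haarAddCircle, lintegral_smul_measure, smul_eq_mul]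

lemma continuous_heat_one {t : ℝ} (ht : 0 < t) : Continuous (heat L (fun _ => 1) t) :=
  continuous_heat (C := 1) (pos_of_fact hL) (fun k => by simp) ht

/-- The image of a centred Gaussian on the circle has the heat kernel as its density. -/
lemma lintegral_gaussian_mk {t : ℝ} (ht : 0 < t) {g : AddCircle (2 * L) → ℝ≥0∞}
    (hg : Measurable g) :
    ∫⁻ v : ℝ, g v ∂gaussianReal 0 t.toNNReal
      = ∫⁻ x, g x * ENNReal.ofReal (heat L (fun _ => 1) t x) ∂AddCircle.haarAddCircle := by
  have ht' : t.toNNReal ≠ 0 := by simpa using ht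
  have hL0 := pos_of_fact hL
  have hmk : Measurable fun v : ℝ => g v := hg.comp AddCircle.measurable_mk'
  rw [gaussianReal_of_var_ne_zero _ ht', lintegral_withDensity_eq_lintegral_mul _
    (measurable_gaussianPDF _ _) hmk, lintegral_eq_lintegral_tsum_translates hL.out 0
    ((measurable_gaussianPDF _ _).mul hmk)]
  have hper : ∀ (v : ℝ) (n : ℤ), ((v + n * (2 * L) : ℝ) : AddCircle (2 * L)) = v := fun v n => by
    rw [AddCircle.coe_add, ← zsmul_eq_mul, AddCircle.coe_zsmul, AddCircle.coe_period, smul_zero,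
      add_zero]
  have hsum : ∀ v : ℝ, ∑' n : ℤ, (gaussianPDF 0 t.toNNReal * fun v : ℝ => g v) (v + n * (2 * L))
      = g v * ENNReal.ofReal (heat L (fun _ => 1) t v / (2 * L)) := fun v => by
    have h := (hasSum_heat_one hL0 ht v).div_const (2 * L)
    have hc : ∀ n : ℤ, 2 * L * gaussianPDFReal 0 t.toNNReal (v + n * (2 * L)) / (2 * L)
        = gaussianPDFReal 0 t.toNNReal (v + n * (2 * L)) := fun n =>
      mul_div_cancel_left₀ _ hL.out.ne'
    simp_rw [hc] at h
    rw [← h.tsum_eq, ENNReal.ofReal_tsum_of_nonneg (fun n => gaussianPDFReal_nonneg _ _ _)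
      h.summable, ← ENNReal.tsum_mul_left]
    refine tsum_congr fun n => ?_
    rw [Pi.mul_apply, hper, mul_comm, gaussianPDF]
  simp_rw [hsum]
  rw [AddCircle.lintegral_preimage (2 * L) 0
    (fun x => g x * ENNReal.ofReal (heat L (fun _ => 1) t x / (2 * L))), lintegral_volume_eq,
    ← lintegral_const_mul (ENNReal.ofReal (2 * L)) (f := fun x : AddCircle (2 * L) =>
      g x * ENNReal.ofReal (heat L (fun _ => 1) t x / (2 * L)))
      (hg.mul ((continuous_heat_one ht).measurable.div_const _).ennreal_ofReal)]
  refine lintegral_congr fun x => ?_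
  rw [mul_left_comm, ← ENNReal.ofReal_mul hL.out.le, mul_div_cancel₀ _ hL.out.ne']

instance (P : Measure (AddCircle (2 * L))) [IsProbabilityMeasure P] (t : ℝ) :
    IsProbabilityMeasure (noisyLaw P t) :=
  Measure.isProbabilityMeasure_map (measurable_noise t).aemeasurable

/-- The density with respect to Haar measure of `noisyLaw P t`. -/
noncomputable def noisyDensity (P : Measure (AddCircle (2 * L))) (t : ℝ) (x : AddCircle (2 * L)) : ℝ :=
  heat L (coef P fun _ => 1) t x

lemma noisyDensity_eq_integral (P : Measure (AddCircle (2 * L))) [IsProbabilityMeasure P] {t : ℝ}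
    (ht : 0 < t) (x : AddCircle (2 * L)) :
    noisyDensity P t x = ∫ u, heat L (fun _ => 1) t (x - u) ∂P := by
  have := integral_heat (summable_decay_one ht) P (h := fun _ => 1) continuous_const x
  simpa [noisyDensity] using this.symm

lemma continuous_noisyDensity (P : Measure (AddCircle (2 * L))) [IsProbabilityMeasure P] {t : ℝ}
    (ht : 0 < t) : Continuous (noisyDensity P t) :=
  continuous_heat (pos_of_fact hL) (norm_coef_one_le P) ht

lemma integrable_heat_one_sub (P : Measure (AddCircle (2 * L))) [IsProbabilityMeasure P] {t : ℝ}
    (ht : 0 < t) (x : AddCircle (2 * L)) :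
    Integrable (fun u => heat L (fun _ => 1) t (x - u)) P :=
  integrable_continuous ((continuous_heat_one ht).comp (continuous_const.sub continuous_id))

lemma noisyDensity_pos (P : Measure (AddCircle (2 * L))) [IsProbabilityMeasure P] {t : ℝ}
    (ht : 0 < t) (x : AddCircle (2 * L)) : 0 < noisyDensity P t x := by
  rw [noisyDensity_eq_integral P ht]
  refine (integral_pos_iff_support_of_nonneg (fun u => (heat_one_pos (pos_of_fact hL) ht _).le)
    (integrable_heat_one_sub P ht x)).2 ?_
  have : (Function.support fun u => heat L (fun _ => 1) t (x - u)) = Set.univ :=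
    Set.eq_univ_of_forall fun u => (heat_one_pos (pos_of_fact hL) ht _).ne'
  simp [this]

lemma lintegral_lintegral_mul_sub (P : Measure (AddCircle (2 * L))) [IsProbabilityMeasure P]
    {K g : AddCircle (2 * L) → ℝ≥0∞} (hK : Measurable K) (hg : Measurable g) :
    ∫⁻ u, ∫⁻ x, g x * K (x - u) ∂AddCircle.haarAddCircle ∂P
      = ∫⁻ x, g x * ∫⁻ u, K (x - u) ∂P ∂AddCircle.haarAddCircle := by
  have hF : Measurable fun q : AddCircle (2 * L) × AddCircle (2 * L) => g q.2 * K (q.2 - q.1) :=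
    (hg.comp measurable_snd).mul (hK.comp (measurable_snd.sub measurable_fst))
  rw [lintegral_lintegral_swap hF.aemeasurable]
  refine lintegral_congr fun x => ?_
  rw [lintegral_const_mul (g x) (f := fun u => K (x - u))
    (hK.comp (measurable_const.sub measurable_id))]

/-- Tested against `g`: condition on the prior point `u`, use the heat kernel as the density of the
wrapped noise, translate Haar measure by `u`, and exchange the integrals. -/
lemma noisyLaw_eq_withDensity (P : Measure (AddCircle (2 * L))) [IsProbabilityMeasure P] {t : ℝ}
    (ht : 0 < t) :
    noisyLaw P t = AddCircle.haarAddCircle.withDensity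
      fun x => ENNReal.ofReal (noisyDensity P t x) := by
  refine Measure.ext_of_lintegral _ fun g hg => ?_
  have hk := (continuous_heat_one (L := L) ht).measurable.ennreal_ofReal
  rw [lintegral_noisyLaw P ht.le hg, lintegral_withDensity_eq_lintegral_mul _
    (continuous_noisyDensity P ht).measurable.ennreal_ofReal hg]
  have h1 : ∀ u : AddCircle (2 * L), ∫⁻ v : ℝ, g (u + (v : AddCircle (2 * L))) ∂gaussianReal 0 t.toNNReal
      = ∫⁻ x, g x * ENNReal.ofReal (heat L (fun _ => 1) t (x - u)) ∂AddCircle.haarAddCircle := by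
    intro u
    rw [lintegral_gaussian_mk ht (g := fun x => g (u + x)) (hg.comp (measurable_const_add u)),
      ← lintegral_add_left_eq_self (μ := AddCircle.haarAddCircle)
      (fun x => g x * ENNReal.ofReal (heat L (fun _ => 1) t (x - u))) u]
    simp_rw [add_sub_cancel_left]
  rw [lintegral_congr h1, lintegral_lintegral_mul_sub P hk hg]
  refine lintegral_congr fun x => ?_
  rw [Pi.mul_apply, mul_comm, noisyDensity_eq_integral P ht, ofReal_integral_eq_lintegral_ofReal
    (integrable_heat_one_sub P ht x)
    (Eventually.of_forall fun u => (heat_one_pos (pos_of_fact hL) ht _).le)]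

lemma integral_noisyLaw (P : Measure (AddCircle (2 * L))) [IsProbabilityMeasure P] {t : ℝ}
    (ht : 0 < t) (g : AddCircle (2 * L) → ℝ) :
    ∫ x, g x ∂noisyLaw P t = ∫ x, noisyDensity P t x * g x ∂AddCircle.haarAddCircle := by
  rw [noisyLaw_eq_withDensity P ht, integral_withDensity_eq_integral_toReal_smul
    (continuous_noisyDensity P ht).measurable.ennreal_ofReal
    (Eventually.of_forall fun x => ENNReal.ofReal_lt_top)]
  refine integral_congr_ae (Eventually.of_forall fun x => ?_)
  simp only [ENNReal.toReal_ofReal (noisyDensity_pos P ht x).le, smul_eq_mul]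

lemma integral_noisyDensity (P : Measure (AddCircle (2 * L))) [IsProbabilityMeasure P] {t : ℝ}
    (ht : 0 < t) : ∫ x, noisyDensity P t x ∂AddCircle.haarAddCircle = 1 := by
  simpa using (integral_noisyLaw P ht fun _ => 1).symm

/-- The characters of the circle determine a finite measure. -/
lemma ext_of_coef_one {μ ν : Measure (AddCircle (2 * L))} [IsFiniteMeasure μ] [IsFiniteMeasure ν]
    (h : ∀ k, coef μ (fun _ => 1) k = coef ν (fun _ => 1) k) : μ = ν := by
  have hint : ∀ (ρ : Measure (AddCircle (2 * L))) [IsFiniteMeasure ρ] (f : C(AddCircle (2 * L), ℂ)),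
      Integrable f ρ := fun ρ _ f => integrable_continuous f.continuous
  have hk : ∀ k : ℤ, ∫ x, (fourier k x : ℂ) ∂μ = ∫ x, (fourier k x : ℂ) ∂ν := fun k => by
    simpa [coef] using h (-k)
  have key : ∀ f : C(AddCircle (2 * L), ℂ), ∫ x, f x ∂μ = ∫ x, f x ∂ν := by
    -- Both integrals are continuous in the uniform norm, so agreement passes from trigonometric
    -- polynomials to their closure, which is everything.
    have hcl : IsClosed {f : C(AddCircle (2 * L), ℂ) | ∫ x, f x ∂μ = ∫ x, f x ∂ν} := by
      have hc : ∀ (ρ : Measure (AddCircle (2 * L))) [IsFiniteMeasure ρ],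
          Continuous fun f : C(AddCircle (2 * L), ℂ) => ∫ x, f x ∂ρ := fun ρ _ => by
        have h1 := continuous_integral.comp (ContinuousMap.toLp (E := ℂ) 1 ρ ℂ).continuous
        refine h1.congr fun f => integral_congr_ae (ContinuousMap.coeFn_toLp ρ f)
      exact isClosed_eq (hc μ) (hc ν)
    intro f
    have hf : f ∈ (Submodule.span ℂ (Set.range (@fourier (2 * L)))).topologicalClosure := by
      rw [span_fourier_closure_eq_top]; trivial
    refine hcl.closure_subset_iff.2 (fun g hg => ?_) hf
    induction hg using Submodule.span_induction with
    | mem g hg => obtain ⟨k, rfl⟩ := hg; exact hk k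
    | zero => simp
    | add f g _ _ hf hg =>
      simp only [Set.mem_ofPred_eq, ContinuousMap.add_apply] at hf hg ⊢
      rw [integral_add (hint μ f) (hint μ g), integral_add (hint ν f) (hint ν g), hf, hg]
    | smul c f _ hf =>
      simp only [Set.mem_ofPred_eq, ContinuousMap.smul_apply] at hf ⊢
      rw [integral_smul, integral_smul, hf]
  refine ext_of_forall_integral_eq_of_IsFiniteMeasure fun f => ?_
  have := key ⟨fun x => (f x : ℂ), by fun_prop⟩
  simp only [ContinuousMap.coe_mk, integral_complex_ofReal] at this
  exact_mod_cast this

end SpectralEB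

/-! ### Cutoffs near variance zero, scores, and the chi-square divergence. -/

namespace SpectralEB

/-- The space of observations: a variance in `[0, tmax]` and a point of the circle. -/
abbrev Obs (L tmax : ℝ) : Type := Set.Icc (0 : ℝ) tmax × AddCircle (2 * L)

/-- A continuous cutoff which vanishes on `[0, 1 / (j + 1)]` and equals one from `2 / (j + 1)` on. -/
noncomputable def cutoff (j : ℕ) (t : ℝ) : ℝ := max 0 (min 1 (((j : ℝ) + 1) * t - 1))

lemma continuous_cutoff (j : ℕ) : Continuous (cutoff j) := by unfold cutoff; fun_prop

lemma cutoff_nonneg (j : ℕ) (t : ℝ) : 0 ≤ cutoff j t := le_max_left _ _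

lemma cutoff_le_one (j : ℕ) (t : ℝ) : cutoff j t ≤ 1 := max_le zero_le_one (min_le_left _ _)

lemma cutoff_mono {i j : ℕ} (hij : i ≤ j) {t : ℝ} (ht : 0 ≤ t) : cutoff i t ≤ cutoff j t := by
  have : (i : ℝ) ≤ j := by exact_mod_cast hij
  unfold cutoff
  gcongr

lemma cutoff_zero (j : ℕ) : cutoff j 0 = 0 := by
  unfold cutoff
  rw [mul_zero, zero_sub, min_eq_right (by norm_num), max_eq_left (by norm_num)]

lemma lt_of_cutoff_ne_zero {j : ℕ} {t : ℝ} (h : cutoff j t ≠ 0) : 1 / ((j : ℝ) + 1) < t := by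
  by_contra hle
  refine h (max_eq_left ?_)
  have h1 : ((j : ℝ) + 1) * t ≤ 1 := by
    rw [not_lt, le_div_iff₀ (by positivity)] at hle
    linarith
  exact (min_le_right _ _).trans (by linarith)

lemma lt_of_cutoff_ne_one {j : ℕ} {t : ℝ} (h : cutoff j t ≠ 1) : t < 2 / ((j : ℝ) + 1) := by
  by_contra hle
  refine h ?_
  have h1 : 1 ≤ ((j : ℝ) + 1) * t - 1 := by
    rw [not_lt, div_le_iff₀ (by positivity)] at hle
    linarith
  rw [cutoff, min_eq_left h1, max_eq_right zero_le_one]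

lemma tendsto_cutoff {t : ℝ} (ht : 0 < t) : Tendsto (fun j => cutoff j t) atTop (𝓝 1) := by
  have h : Tendsto (fun j : ℕ => 2 / ((j : ℝ) + 1)) atTop (𝓝 0) :=
    tendsto_const_nhds.div_atTop (tendsto_atTop_add_const_right _ _ tendsto_natCast_atTop_atTop)
  refine tendsto_const_nhds.congr' ?_
  filter_upwards [h.eventually_lt_const ht] with j hj
  by_contra hne
  exact absurd (lt_of_cutoff_ne_one (Ne.symm hne)) (not_lt.2 hj.le)

/-- Where the cutoff is nonzero the time exceeds `1 / (j + 1)`, so the time may be truncated from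
below. The truncated heat flows are continuous everywhere. -/
lemma cutoff_mul_max (j : ℕ) (t : ℝ) (F : ℝ → ℝ) :
    cutoff j t * F t = cutoff j t * F (max t (1 / ((j : ℝ) + 1))) := by
  by_cases h : cutoff j t = 0
  · simp [h]
  · rw [max_eq_left (lt_of_cutoff_ne_zero h).le]

variable {L tmax : ℝ}

lemma continuous_cutoff_mul_heat_div {Z : Type*} [TopologicalSpace Z] (hL : 0 < L)
    {m g : ℤ → ℂ} {C : ℝ} (hm : ∀ k, ‖m k‖ ≤ C) (hg : ∀ k, ‖g k‖ ≤ C)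
    (hpos : ∀ t x, 0 < t → heat L g t x ≠ 0) (j : ℕ) {T : Z → ℝ} {x y : Z → AddCircle (2 * L)}
    (hT : Continuous T) (hx : Continuous x) (hy : Continuous y) :
    Continuous fun z => cutoff j (T z) * (heat L m (T z) (x z) / heat L g (T z) (y z)) := by
  have hτ : 0 < 1 / ((j : ℝ) + 1) := by positivity
  have hT' : Continuous fun z => max (T z) (1 / ((j : ℝ) + 1)) := hT.max continuous_const
  have h1 : Continuous fun z => heat L m (max (T z) (1 / ((j : ℝ) + 1))) (x z) :=
    (continuousOn_heat hL hm hτ).comp_continuous (hT'.prodMk hx)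
      fun z => le_max_right (T z) _
  have h2 : Continuous fun z => heat L g (max (T z) (1 / ((j : ℝ) + 1))) (y z) :=
    (continuousOn_heat hL hg hτ).comp_continuous (hT'.prodMk hy)
      fun z => le_max_right (T z) _
  have h3 : (fun z => cutoff j (T z) * (heat L m (T z) (x z) / heat L g (T z) (y z)))
      = fun z => cutoff j (T z) * (heat L m (max (T z) (1 / ((j : ℝ) + 1))) (x z)
        / heat L g (max (T z) (1 / ((j : ℝ) + 1))) (y z)) := by
    funext z
    exact cutoff_mul_max j (T z) fun t => heat L m t (x z) / heat L g t (y z)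
  rw [h3]
  exact ((continuous_cutoff j).comp hT).mul
    (h1.div h2 fun z => hpos _ _ (lt_of_lt_of_le hτ (le_max_right _ _)))

variable [hL : Fact (0 < 2 * L)]

/-- Integrals of continuous functions against `noisyLaw P t` depend continuously on `t`. -/
lemma continuous_integral_noisyLaw (P : Measure (AddCircle (2 * L))) [IsProbabilityMeasure P]
    {ψ : Obs L tmax → ℝ} (hψ : Continuous ψ) :
    Continuous fun t : Set.Icc (0 : ℝ) tmax => ∫ x, ψ (t, x) ∂noisyLaw P t := by
  -- Pulled back to the fixed measure `P × N(0, 1)`, the parameter `t` sits only in the integrand,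
  -- and dominated convergence applies even at `t = 0`.
  have h : ∀ t : Set.Icc (0 : ℝ) tmax, ∫ x, ψ (t, x) ∂noisyLaw P t
      = ∫ p, ψ (t, p.1 + ((Real.sqrt t * p.2 : ℝ) : AddCircle (2 * L))) ∂(P.prod (gaussianReal 0 1)) :=
    fun t => integral_noisyLaw_eq P t (hψ.comp (Continuous.prodMk_right t))
  simp_rw [h]
  obtain ⟨C, hC⟩ := isCompact_univ.exists_bound_of_continuousOn hψ.continuousOn
  have hc : Continuous fun q : Set.Icc (0 : ℝ) tmax × (AddCircle (2 * L) × ℝ) =>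
      ψ (q.1, q.2.1 + ((Real.sqrt q.1 * q.2.2 : ℝ) : AddCircle (2 * L))) :=
    hψ.comp (continuous_fst.prodMk (continuous_noise.comp
      ((continuous_subtype_val.comp continuous_fst).prodMk continuous_snd)))
  refine continuous_of_dominated (bound := fun _ => C)
    (fun t => (hc.comp (Continuous.prodMk_right t)).aestronglyMeasurable)
    (fun t => Eventually.of_forall fun p => hC _ (Set.mem_univ _)) (integrable_const _)
    (Eventually.of_forall fun p => hc.comp (Continuous.prodMk_left p))

/-- The first-order optimality quantity at `θ`, for one observation. -/
noncomputable def scoreKernel (G : Measure (AddCircle (2 * L))) (j : ℕ) (y : Obs L tmax)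
    (θ : AddCircle (2 * L)) : ℝ :=
  cutoff j y.1 * (heat L (fun _ => 1) y.1 (y.2 - θ) / noisyDensity G y.1 y.2)

/-- The average of `scoreKernel` under the law `η` of the observations. -/
noncomputable def score (G : Measure (AddCircle (2 * L))) (η : Measure (Obs L tmax)) (j : ℕ)
    (θ : AddCircle (2 * L)) : ℝ := ∫ y, scoreKernel G j y θ ∂η

section

variable (G : Measure (AddCircle (2 * L))) [IsProbabilityMeasure G] (η : Measure (Obs L tmax))

lemma integrable_obs [IsProbabilityMeasure η] {f : Obs L tmax → ℝ} (hf : Continuous f) : Integrable f η :=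
  hf.integrable_of_hasCompactSupport (HasCompactSupport.of_compactSpace f)

lemma continuous_scoreKernel (j : ℕ) :
    Continuous fun q : Obs L tmax × AddCircle (2 * L) => scoreKernel G j q.1 q.2 :=
  continuous_cutoff_mul_heat_div (C := 1) (pos_of_fact hL) (fun k => by simp)
    (norm_coef_one_le G) (fun t x ht => (noisyDensity_pos G ht x).ne') j
    (T := fun q : Obs L tmax × AddCircle (2 * L) => (q.1.1 : ℝ))
    (by fun_prop) (by fun_prop) (by fun_prop)

lemma continuous_score [IsProbabilityMeasure η] (j : ℕ) : Continuous (score G η j) := by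
  obtain ⟨C, hC⟩ := isCompact_univ.exists_bound_of_continuousOn
    (continuous_scoreKernel (tmax := tmax) G j).continuousOn
  exact continuous_of_dominated (bound := fun _ => C)
    (fun θ => ((continuous_scoreKernel G j).comp (Continuous.prodMk_left θ)).aestronglyMeasurable)
    (fun θ => Eventually.of_forall fun y => hC (y, θ) (Set.mem_univ _)) (integrable_const _)
    (Eventually.of_forall fun y => (continuous_scoreKernel G j).comp (Continuous.prodMk_right y))

lemma scoreKernel_nonneg (j : ℕ) (y : Obs L tmax) (θ : AddCircle (2 * L)) :
    0 ≤ scoreKernel G j y θ := by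
  by_cases h : cutoff j y.1 = 0
  · simp [scoreKernel, h]
  · have ht : 0 < (y.1 : ℝ) := lt_trans (by positivity) (lt_of_cutoff_ne_zero h)
    exact mul_nonneg (cutoff_nonneg _ _) (div_nonneg (heat_one_pos (pos_of_fact hL) ht _).le
      (noisyDensity_pos G ht _).le)

lemma scoreKernel_mono {i j : ℕ} (hij : i ≤ j) (y : Obs L tmax) (θ : AddCircle (2 * L)) :
    scoreKernel G i y θ ≤ scoreKernel G j y θ := by
  by_cases h : cutoff i y.1 = 0
  · rw [scoreKernel, h, zero_mul]
    exact scoreKernel_nonneg G j y θ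
  · have ht : 0 < (y.1 : ℝ) := lt_trans (by positivity) (lt_of_cutoff_ne_zero h)
    exact mul_le_mul_of_nonneg_right (cutoff_mono hij y.1.2.1)
      (div_nonneg (heat_one_pos (pos_of_fact hL) ht _).le (noisyDensity_pos G ht _).le)

lemma score_nonneg (j : ℕ) (θ : AddCircle (2 * L)) : 0 ≤ score G η j θ :=
  integral_nonneg fun y => scoreKernel_nonneg G j y θ

/-- Monotonicity in the cutoff index, with the bound by one that the optimality conditions supply,
gives a limiting score although the likelihood ratio is singular at variance zero. -/
lemma score_mono [IsProbabilityMeasure η] (θ : AddCircle (2 * L)) : Monotone fun j => score G η j θ := fun _ _ hij =>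
  integral_mono (integrable_obs η ((continuous_scoreKernel G _).comp (Continuous.prodMk_left θ)))
    (integrable_obs η ((continuous_scoreKernel G _).comp (Continuous.prodMk_left θ)))
    fun y => scoreKernel_mono G hij y θ

/-- Averaging the score against `h` with respect to `Q`. -/
lemma integral_mul_score [IsProbabilityMeasure η] (Q : Measure (AddCircle (2 * L))) [IsProbabilityMeasure Q]
    {h : AddCircle (2 * L) → ℝ} (hh : Continuous h) (j : ℕ) :
    ∫ θ, h θ * score G η j θ ∂Q
      = ∫ y : Obs L tmax, cutoff j y.1 * (heat L (coef Q h) y.1 y.2 / noisyDensity G y.1 y.2) ∂η := by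
  have hc : Continuous fun q : AddCircle (2 * L) × Obs L tmax => h q.1 * scoreKernel G j q.2 q.1 :=
    (hh.comp continuous_fst).mul ((continuous_scoreKernel G j).comp continuous_swap)
  simp_rw [score, ← integral_const_mul]
  rw [integral_integral_swap (hc.integrable_of_hasCompactSupport (HasCompactSupport.of_compactSpace _))]
  refine integral_congr_ae (Eventually.of_forall fun y => ?_)
  by_cases hj : cutoff j y.1 = 0
  · simp [scoreKernel, hj]
  · have ht : 0 < (y.1 : ℝ) := lt_trans (by positivity) (lt_of_cutoff_ne_zero hj)
    have h1 : ∫ θ, h θ * heat L (fun _ => 1) y.1 (y.2 - θ) ∂Q = heat L (coef Q h) y.1 y.2 := by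
      have := integral_heat (summable_decay_one ht) Q hh y.2
      simp only [Complex.ofReal_one, one_mul] at this
      exact this
    simp only [scoreKernel]
    rw [← h1, ← integral_div, ← integral_const_mul]
    exact integral_congr_ae (Eventually.of_forall fun θ => by ring)

end

section

variable (P G : Measure (AddCircle (2 * L))) [IsProbabilityMeasure P] [IsProbabilityMeasure G]

/-- Expand `p² / g = 2 p - g + (p - g)² / g`; both densities integrate to one. The excess over one
is the chi-square divergence. -/
lemma integral_sq_div_eq {t : ℝ} (ht : 0 < t) :
    ∫ x, noisyDensity P t x / noisyDensity G t x ∂noisyLaw P t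
      = 1 + ∫ x, (noisyDensity P t x - noisyDensity G t x) ^ 2 / noisyDensity G t x
        ∂AddCircle.haarAddCircle := by
  have hp := continuous_noisyDensity P ht
  have hg := continuous_noisyDensity G ht
  have hg0 : ∀ x, noisyDensity G t x ≠ 0 := fun x => (noisyDensity_pos G ht x).ne'
  have h : ∀ x, noisyDensity P t x * (noisyDensity P t x / noisyDensity G t x)
      = (2 * noisyDensity P t x - noisyDensity G t x)
        + (noisyDensity P t x - noisyDensity G t x) ^ 2 / noisyDensity G t x := fun x => by
    have := hg0 x
    field_simp
    ring
  rw [integral_noisyLaw P ht]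
  simp_rw [h]
  have hc : Continuous fun x => (noisyDensity P t x - noisyDensity G t x) ^ 2 / noisyDensity G t x :=
    ((hp.sub hg).pow 2).div hg hg0
  rw [integral_add (integrable_continuous (by fun_prop)) (integrable_continuous hc), integral_sub
    (integrable_continuous (by fun_prop)) (integrable_continuous hg), integral_const_mul,
    integral_noisyDensity P ht, integral_noisyDensity G ht]
  norm_num

/-- The integrand is continuous and nonnegative, so it vanishes everywhere and the noisy laws agree.
Noise multiplies each Fourier coefficient by a nonzero factor, hence can be undone. -/
lemma eq_of_integral_sq_div_eq_zero {t : ℝ} (ht : 0 < t)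
    (h : ∫ x, (noisyDensity P t x - noisyDensity G t x) ^ 2 / noisyDensity G t x
        ∂AddCircle.haarAddCircle = 0) : G = P := by
  have hp := continuous_noisyDensity P ht
  have hg := continuous_noisyDensity G ht
  have hg0 : ∀ x, 0 < noisyDensity G t x := fun x => noisyDensity_pos G ht x
  have hc : Continuous fun x => (noisyDensity P t x - noisyDensity G t x) ^ 2 / noisyDensity G t x :=
    (hp.sub hg).pow 2 |>.div hg fun x => (hg0 x).ne'
  rw [integral_eq_zero_iff_of_nonneg (fun x => div_nonneg (sq_nonneg _) (hg0 x).le)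
    (integrable_continuous hc)] at h
  have h1 := Continuous.ae_eq_iff_eq AddCircle.haarAddCircle hc continuous_const |>.1 h
  have h2 : ∀ x, noisyDensity P t x = noisyDensity G t x := fun x => by
    have : (noisyDensity P t x - noisyDensity G t x) ^ 2 / noisyDensity G t x = 0 := congrFun h1 x
    rw [div_eq_zero_iff, or_iff_left (hg0 x).ne'] at this
    exact sub_eq_zero.1 (pow_eq_zero_iff two_ne_zero |>.1 this)
  have h3 : noisyLaw P t = noisyLaw G t := by
    rw [noisyLaw_eq_withDensity P ht, noisyLaw_eq_withDensity G ht]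
    simp_rw [h2]
  have hco : ∀ (Q : Measure (AddCircle (2 * L))) [IsProbabilityMeasure Q] (k : ℤ),
      coef (noisyLaw Q t) (fun _ => 1) k = decay L t (-k) * coef Q (fun _ => 1) k := by
    intro Q _ k
    have hi : Integrable (fun p : AddCircle (2 * L) × ℝ =>
        (fourier (-k) (p.1 + ((Real.sqrt t * p.2 : ℝ) : AddCircle (2 * L))) : ℂ))
        (Q.prod (gaussianReal 0 1)) :=
      Integrable.of_bound ((fourier (-k)).continuous.comp
        (continuous_noise.comp (Continuous.prodMk_right t))).aestronglyMeasurable 1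
        (Eventually.of_forall fun p => (norm_fourier_apply _ _).le)
    simp only [coef, Complex.ofReal_one, one_mul]
    rw [noisyLaw, integral_map (measurable_noise t).aemeasurable
      (fourier (-k)).continuous.aestronglyMeasurable, integral_prod _ hi]
    simp_rw [integral_fourier_gaussian (pos_of_fact hL) ht.le]
    rw [integral_const_mul]
  refine ext_of_coef_one fun k => ?_
  have h4 := (hco P k).symm.trans ((congrArg (fun ν => coef ν (fun _ => 1) k) h3).trans (hco G k))
  exact (mul_left_cancel₀ (by exact_mod_cast (decay_pos t (-k)).ne') h4).symm

end

end SpectralEB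

/-! ### Identification of the prior from the limiting first-order conditions. -/

namespace SpectralEB

variable {L tmax : ℝ} [hL : Fact (0 < 2 * L)]

/-- The part of the sample with vanishing noise. -/
lemma tendsto_integral_one_sub_cutoff {P : Measure (AddCircle (2 * L))} [IsProbabilityMeasure P]
    {η : Measure (Obs L tmax)} {lam : Measure (Set.Icc (0 : ℝ) tmax)} [IsProbabilityMeasure lam]
    (hη : ∀ ψ : Obs L tmax → ℝ, Continuous ψ →
      ∫ y, ψ y ∂η = ∫ t, ∫ x, ψ (t, x) ∂noisyLaw P t ∂lam)
    {h : AddCircle (2 * L) → ℝ} (hh : Continuous h) :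
    Tendsto (fun j => ∫ y : Obs L tmax, (1 - cutoff j y.1) * h y.2 ∂η) atTop
      (𝓝 (lam.real {t | (t : ℝ) = 0} * ∫ x, h x ∂P)) := by
  have h1 : ∀ j, ∫ y : Obs L tmax, (1 - cutoff j y.1) * h y.2 ∂η
      = ∫ t : Set.Icc (0 : ℝ) tmax, (1 - cutoff j t) * ∫ x, h x ∂noisyLaw P t ∂lam := fun j => by
    rw [hη (fun y => (1 - cutoff j y.1) * h y.2)
      ((continuous_const.sub ((continuous_cutoff j).comp (by fun_prop))).mul (by fun_prop))]
    simp_rw [integral_const_mul]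
  have hc : Continuous fun t : Set.Icc (0 : ℝ) tmax => ∫ x, h x ∂noisyLaw P t :=
    continuous_integral_noisyLaw P (ψ := fun y : Obs L tmax => h y.2) (hh.comp continuous_snd)
  obtain ⟨C, hC⟩ := isCompact_univ.exists_bound_of_continuousOn hc.continuousOn
  have hms : MeasurableSet {t : Set.Icc (0 : ℝ) tmax | (t : ℝ) = 0} :=
    measurable_subtype_coe (measurableSet_singleton (0 : ℝ))
  have hlim : ∫ t, Set.indicator {t : Set.Icc (0 : ℝ) tmax | (t : ℝ) = 0}
      (fun _ => ∫ x, h x ∂P) t ∂lam = lam.real {t | (t : ℝ) = 0} * ∫ x, h x ∂P := by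
    rw [integral_indicator_const _ hms, smul_eq_mul]
  simp_rw [h1]
  rw [← hlim]
  -- As `j` grows, `1 - cutoff j` tends to the indicator of variance zero, where the noisy law is
  -- `P` itself.
  refine tendsto_integral_of_dominated_convergence (fun _ => C) (fun j => ?_) (integrable_const _)
    (fun j => Eventually.of_forall fun t => ?_) (Eventually.of_forall fun t => ?_)
  · exact ((continuous_const.sub ((continuous_cutoff j).comp continuous_subtype_val)).mul
      hc).aestronglyMeasurable
  · rw [norm_mul]
    refine (mul_le_of_le_one_left (norm_nonneg _) ?_).trans (hC t (Set.mem_univ t))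
    rw [Real.norm_of_nonneg (sub_nonneg.2 (cutoff_le_one _ _))]
    linarith [cutoff_nonneg j (t : ℝ)]
  · by_cases ht : (t : ℝ) = 0
    · rw [Set.indicator_of_mem (show t ∈ {t : Set.Icc (0 : ℝ) tmax | (t : ℝ) = 0} from ht), ht,
        noisyLaw_zero]
      simp [cutoff_zero]
    · rw [Set.indicator_of_notMem (show t ∉ {t : Set.Icc (0 : ℝ) tmax | (t : ℝ) = 0} from ht)]
      have ht0 : 0 < (t : ℝ) := lt_of_le_of_ne t.2.1 (Ne.symm ht)
      have := ((tendsto_cutoff ht0).const_sub 1).mul_const (∫ x, h x ∂noisyLaw P t)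
      simpa using this

/-- The first-order conditions of the limiting likelihood problem identify the prior. -/
theorem eq_of_score_le_one {P G : Measure (AddCircle (2 * L))} [IsProbabilityMeasure P]
    [IsProbabilityMeasure G] {η : Measure (Obs L tmax)} [IsProbabilityMeasure η]
    {lam : Measure (Set.Icc (0 : ℝ) tmax)} [IsProbabilityMeasure lam]
    (hη : ∀ ψ : Obs L tmax → ℝ, Continuous ψ →
      ∫ y, ψ y ∂η = ∫ t, ∫ x, ψ (t, x) ∂noisyLaw P t ∂lam)
    (hle : ∀ j θ, score G η j θ ≤ 1)
    (hself : ∀ h : AddCircle (2 * L) → ℝ, Continuous h →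
      Tendsto (fun j => ∫ θ, h θ * score G η j θ ∂G
        + ∫ y : Obs L tmax, (1 - cutoff j y.1) * h y.2 ∂η) atTop (𝓝 (∫ θ, h θ ∂G))) :
    G = P := by
  obtain ⟨α, hα⟩ : ∃ α, α = lam.real {t | (t : ℝ) = 0} := ⟨_, rfl⟩
  have hα0 : 0 ≤ α := by rw [hα]; exact measureReal_nonneg
  -- The limiting score is only known to be measurable; test functions must be built from the
  -- continuous `score G η j`.
  let S : AddCircle (2 * L) → ℝ := fun θ => ⨆ j, score G η j θ
  have hbdd : ∀ θ, BddAbove (Set.range fun j => score G η j θ) := fun θ =>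
    ⟨1, by rintro _ ⟨j, rfl⟩; exact hle j θ⟩
  have hS : ∀ θ, Tendsto (fun j => score G η j θ) atTop (𝓝 (S θ)) := fun θ =>
    tendsto_atTop_ciSup (score_mono G η θ) (hbdd θ)
  have hS1 : ∀ θ, S θ ≤ 1 := fun θ => ciSup_le fun j => hle j θ
  have hS0 : ∀ θ, 0 ≤ S θ := fun θ => (score_nonneg G η 0 θ).trans (le_ciSup (hbdd θ) 0)
  have hSm : Measurable S := Measurable.iSup fun j => (continuous_score G η j).measurable
  have habs : ∀ j θ, |score G η j θ| ≤ 1 := fun j θ => by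
    rw [abs_of_nonneg (score_nonneg G η j θ)]; exact hle j θ
  have hSi : ∀ (Q : Measure (AddCircle (2 * L))) [IsProbabilityMeasure Q], Integrable S Q :=
    fun Q _ => Integrable.of_bound hSm.aestronglyMeasurable 1 (Eventually.of_forall fun θ => by
      rw [Real.norm_of_nonneg (hS0 θ)]; exact hS1 θ)
  have hlimQ : ∀ (Q : Measure (AddCircle (2 * L))) [IsProbabilityMeasure Q]
      (h : AddCircle (2 * L) → ℝ), Continuous h →
      Tendsto (fun j => ∫ θ, h θ * score G η j θ ∂Q) atTop (𝓝 (∫ θ, h θ * S θ ∂Q)) := by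
    intro Q _ h hh
    refine tendsto_integral_of_dominated_convergence (fun θ => |h θ|)
      (fun j => (hh.mul (continuous_score G η j)).aestronglyMeasurable)
      (integrable_continuous hh.abs) (fun j => Eventually.of_forall fun θ => ?_)
      (Eventually.of_forall fun θ => (hS θ).const_mul (h θ))
    rw [norm_mul]
    exact mul_le_of_le_one_right (norm_nonneg _) (habs j θ)
  -- the self-consistency equation in the limit
  have hb : ∀ h : AddCircle (2 * L) → ℝ, Continuous h →
      ∫ θ, h θ * (1 - S θ) ∂G = α * ∫ x, h x ∂P := by
    intro h hh
    have h1 := tendsto_nhds_unique (hself h hh)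
      ((hlimQ G h hh).add (tendsto_integral_one_sub_cutoff hη hh))
    have h2 : ∫ θ, h θ * (1 - S θ) ∂G = ∫ θ, h θ ∂G - ∫ θ, h θ * S θ ∂G := by
      rw [← integral_sub (integrable_continuous hh)]
      · exact integral_congr_ae (Eventually.of_forall fun θ => by ring)
      · obtain ⟨C, hC⟩ := isCompact_univ.exists_bound_of_continuousOn hh.continuousOn
        exact (hSi G).bdd_mul hh.aestronglyMeasurable
          (Eventually.of_forall fun θ => hC θ (Set.mem_univ θ))
    rw [h2, h1, hα]
    ring
  have hu1 : ∫ θ, (1 - S θ) ∂G = α := by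
    simpa using hb (fun _ => 1) continuous_const
  have hcut : Tendsto (fun j => ∫ t : Set.Icc (0 : ℝ) tmax, cutoff j t ∂lam) atTop (𝓝 (1 - α)) := by
    have h1 := tendsto_integral_one_sub_cutoff hη (h := fun _ => 1) continuous_const
    have h2 : ∀ j, ∫ y : Obs L tmax, (1 - cutoff j y.1) * 1 ∂η
        = 1 - ∫ t : Set.Icc (0 : ℝ) tmax, cutoff j t ∂lam := fun j => by
      rw [hη (fun y => (1 - cutoff j y.1) * 1)
        ((continuous_const.sub ((continuous_cutoff j).comp (by fun_prop))).mul continuous_const)]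
      simp only [mul_one, integral_const, probReal_univ, one_smul]
      rw [integral_sub (integrable_const _)]
      · simp
      · exact ((continuous_cutoff j).comp continuous_subtype_val).integrable_of_hasCompactSupport
          (HasCompactSupport.of_compactSpace _)
    simp_rw [h2] at h1
    have h3 := h1.const_sub 1
    simp only [sub_sub_cancel, integral_const, probReal_univ, one_smul, mul_one] at h3
    rw [hα]
    exact h3
  -- the chi-square divergence of the two noisy densities
  obtain ⟨D, hD⟩ : ∃ D : ℝ → ℝ, ∀ t, D t = ∫ x, (noisyDensity P t x - noisyDensity G t x) ^ 2
      / noisyDensity G t x ∂AddCircle.haarAddCircle := ⟨_, fun _ => rfl⟩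
  have hD0 : ∀ j (t : Set.Icc (0 : ℝ) tmax), 0 ≤ cutoff j t * D t := by
    intro j t
    by_cases hj : cutoff j t = 0
    · simp [hj]
    · have ht : 0 < (t : ℝ) := lt_trans (by positivity) (lt_of_cutoff_ne_zero hj)
      rw [hD]
      exact mul_nonneg (cutoff_nonneg _ _) (integral_nonneg fun x =>
        div_nonneg (sq_nonneg _) (noisyDensity_pos G ht x).le)
  have hcontR : ∀ j, Continuous fun y : Obs L tmax =>
      cutoff j y.1 * (noisyDensity P y.1 y.2 / noisyDensity G y.1 y.2) := fun j =>
    continuous_cutoff_mul_heat_div (C := 1) (pos_of_fact hL) (norm_coef_one_le P)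
      (norm_coef_one_le G) (fun t x ht => (noisyDensity_pos G ht x).ne') j
      (by fun_prop) (by fun_prop) (by fun_prop)
  have hinner : ∀ j (t : Set.Icc (0 : ℝ) tmax),
      ∫ x, cutoff j t * (noisyDensity P t x / noisyDensity G t x) ∂noisyLaw P t
        = cutoff j t + cutoff j t * D t := by
    intro j t
    rw [integral_const_mul]
    by_cases hj : cutoff j t = 0
    · simp [hj]
    · have ht : 0 < (t : ℝ) := lt_trans (by positivity) (lt_of_cutoff_ne_zero hj)
      rw [integral_sq_div_eq P G ht, hD]
      ring
  have hci : ∀ j, Integrable (fun t : Set.Icc (0 : ℝ) tmax => cutoff j t) lam := fun j =>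
    ((continuous_cutoff j).comp continuous_subtype_val).integrable_of_hasCompactSupport
      (HasCompactSupport.of_compactSpace _)
  have hDi : ∀ j, Integrable (fun t : Set.Icc (0 : ℝ) tmax => cutoff j t * D t) lam := by
    intro j
    have h1 := continuous_integral_noisyLaw P (hcontR j)
    have h2 : Integrable (fun t : Set.Icc (0 : ℝ) tmax => cutoff j t + cutoff j t * D t) lam := by
      refine (h1.integrable_of_hasCompactSupport (HasCompactSupport.of_compactSpace _)).congr
        (Eventually.of_forall fun t => hinner j t)
    exact (h2.sub (hci j)).congr (Eventually.of_forall fun t => add_sub_cancel_left _ _)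
  -- Integrating the score against `P` turns the numerator into the true density; under the true law
  -- the ratio then averages to one plus the divergence.
  have hscore : ∀ j, ∫ θ, score G η j θ ∂P
      = ∫ t : Set.Icc (0 : ℝ) tmax, cutoff j t ∂lam
        + ∫ t : Set.Icc (0 : ℝ) tmax, cutoff j t * D t ∂lam := by
    intro j
    have h1 := integral_mul_score G η P (h := fun _ => 1) continuous_const j
    simp only [one_mul] at h1
    rw [h1, ← integral_add (hci j) (hDi j)]
    refine (hη _ (hcontR j)).trans (integral_congr_ae (Eventually.of_forall fun t => hinner j t))
  have hscoreP : ∀ j, ∫ θ, score G η j θ ∂P ≤ ∫ θ, S θ ∂P := fun j =>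
    integral_mono (integrable_continuous (continuous_score G η j)) (hSi P)
      fun θ => le_ciSup (hbdd θ) j
  have hDnn : ∀ j, 0 ≤ ∫ t : Set.Icc (0 : ℝ) tmax, cutoff j t * D t ∂lam := fun j =>
    integral_nonneg fun t => hD0 j t
  -- The divergence is nonnegative and the cut-off mass tends to `1 - α`.
  have hSP : 1 - α ≤ ∫ θ, S θ ∂P := le_of_tendsto hcut (Eventually.of_forall fun j => by
    have h1 := hscoreP j
    rw [hscore] at h1
    linarith [hDnn j])
  rcases eq_or_ne α 0 with h0 | h0
  · -- no vanishing noise: the chi-square divergence vanishes at some positive variance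
    have hSP1 : ∫ θ, S θ ∂P ≤ 1 := by
      have := integral_mono (hSi P) (integrable_const (1 : ℝ)) hS1
      simpa using this
    -- The cut-off mass now exhausts one, and `∫ S dP ≤ 1` leaves no room for the divergence. A
    -- larger index `i` only increases the divergence term, so the bound at `i` applies to `j`.
    have hz : ∀ j, ∫ t : Set.Icc (0 : ℝ) tmax, cutoff j t * D t ∂lam = 0 := by
      intro j
      refine le_antisymm ?_ (hDnn j)
      have h1 : ∀ᶠ i in atTop, ∫ t : Set.Icc (0 : ℝ) tmax, cutoff j t * D t ∂lam
          ≤ 1 - ∫ t : Set.Icc (0 : ℝ) tmax, cutoff i t ∂lam := by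
        filter_upwards [eventually_ge_atTop j] with i hi
        have h2 : ∫ t : Set.Icc (0 : ℝ) tmax, cutoff j t * D t ∂lam
            ≤ ∫ t : Set.Icc (0 : ℝ) tmax, cutoff i t * D t ∂lam := by
          refine integral_mono (hDi j) (hDi i) fun t => ?_
          by_cases hj : cutoff j t = 0
          · simpa [hj] using hD0 i t
          · have hpos : 0 < cutoff j t := lt_of_le_of_ne (cutoff_nonneg _ _) (Ne.symm hj)
            exact mul_le_mul_of_nonneg_right (cutoff_mono hi t.2.1)
              (nonneg_of_mul_nonneg_right (hD0 j t) hpos)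
        have h3 := hscoreP i
        rw [hscore] at h3
        linarith
      have h4 := hcut.const_sub 1
      rw [h0, sub_zero, sub_self] at h4
      exact ge_of_tendsto h4 h1
    rw [h0, sub_zero] at hcut
    obtain ⟨j, hj⟩ := (hcut.eventually_const_lt zero_lt_one).exists
    have hae := (integral_eq_zero_iff_of_nonneg (fun t => hD0 j t) (hDi j)).1 (hz j)
    obtain ⟨t, ht1, ht2⟩ : ∃ t : Set.Icc (0 : ℝ) tmax, cutoff j t ≠ 0 ∧ cutoff j t * D t = 0 := by
      by_contra hcon
      have : ∀ᵐ t : Set.Icc (0 : ℝ) tmax ∂lam, cutoff j t = 0 := by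
        filter_upwards [hae] with t ht
        by_contra hne
        exact hcon ⟨t, hne, ht⟩
      rw [integral_congr_ae this, integral_zero] at hj
      exact lt_irrefl _ hj
    have htpos : 0 < (t : ℝ) := lt_trans (by positivity) (lt_of_cutoff_ne_zero ht1)
    refine eq_of_integral_sq_div_eq_zero P G htpos ?_
    rw [← hD]
    exact (mul_eq_zero.1 ht2).resolve_left ht1
  · have hαpos : 0 < α := lt_of_le_of_ne hα0 (Ne.symm h0)
    have hui : Integrable (fun θ => 1 - S θ) G := (integrable_const 1).sub (hSi G)
    have hubd : ∀ θ, ‖1 - S θ‖ ≤ 1 := fun θ => by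
      rw [Real.norm_of_nonneg (by linarith [hS1 θ])]; linarith [hS0 θ]
    -- The identity `(1 - S) dG = α dP`, tested with `1 - S`. Since `S` may be discontinuous, it is
    -- tested with `1 - score G η j` and then `j → ∞`.
    have husq : ∫ θ, (1 - S θ) * (1 - S θ) ∂G = α * (1 - ∫ θ, S θ ∂P) := by
      have h1 : Tendsto (fun j => ∫ θ, (1 - score G η j θ) * (1 - S θ) ∂G) atTop
          (𝓝 (∫ θ, (1 - S θ) * (1 - S θ) ∂G)) := by
        refine tendsto_integral_of_dominated_convergence (fun _ => 1)
          (fun j => ((continuous_const.sub (continuous_score G η j)).aestronglyMeasurable.mul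
            hui.aestronglyMeasurable)) (integrable_const _)
          (fun j => Eventually.of_forall fun θ => ?_)
          (Eventually.of_forall fun θ => ((hS θ).const_sub 1).mul_const _)
        rw [norm_mul]
        refine mul_le_one₀ ?_ (norm_nonneg _) (hubd θ)
        rw [Real.norm_of_nonneg (by linarith [hle j θ])]
        linarith [score_nonneg G η j θ]
      have h2 : Tendsto (fun j => α * (1 - ∫ θ, score G η j θ ∂P)) atTop
          (𝓝 (α * (1 - ∫ θ, S θ ∂P))) := by
        have := hlimQ P (fun _ => 1) continuous_const
        simp only [one_mul] at this
        exact (this.const_sub 1).const_mul α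
      refine tendsto_nhds_unique h1 (h2.congr fun j => ?_)
      rw [hb (fun θ => 1 - score G η j θ) (continuous_const.sub (continuous_score G η j)), integral_sub (integrable_const _)
        (integrable_continuous (continuous_score G η j))]
      simp
    -- The mean is `α`, and `hSP` bounds the second moment by `α ^ 2`. The variance is thus
    -- nonpositive, and `1 - S` is the constant `α` almost everywhere.
    have hvar : ∫ θ, ((1 - S θ) - α) ^ 2 ∂G ≤ 0 := by
      have hi2 : Integrable (fun θ => (1 - S θ) * (1 - S θ)) G :=
        hui.bdd_mul hui.aestronglyMeasurable (Eventually.of_forall hubd)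
      have h1 : ∀ θ, ((1 - S θ) - α) ^ 2 = (1 - S θ) * (1 - S θ) - 2 * α * (1 - S θ) + α ^ 2 :=
        fun θ => by ring
      simp_rw [h1]
      have hi3 : Integrable (fun θ => 2 * α * (1 - S θ)) G := hui.const_mul _
      have hi4 : Integrable (fun θ => (1 - S θ) * (1 - S θ) - 2 * α * (1 - S θ)) G := hi2.sub hi3
      rw [integral_add hi4 (integrable_const _), integral_sub hi2 hi3, integral_const_mul, hu1, husq]
      simp only [integral_const, probReal_univ, one_smul]
      nlinarith
    have hvi : Integrable (fun θ => ((1 - S θ) - α) ^ 2) G := by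
      refine Integrable.of_bound ((measurable_const.sub hSm).sub_const α |>.pow_const 2
        ).aestronglyMeasurable ((1 + α) ^ 2) (Eventually.of_forall fun θ => ?_)
      rw [Real.norm_of_nonneg (sq_nonneg _)]
      exact sq_le_sq' (by linarith [hS1 θ]) (by linarith [hS0 θ])
    have hae := (integral_eq_zero_iff_of_nonneg (fun θ => sq_nonneg _) hvi).1
      (le_antisymm hvar (integral_nonneg fun θ => sq_nonneg _))
    refine ext_of_forall_integral_eq_of_IsFiniteMeasure fun h => ?_
    have h1 := hb h h.continuous
    have h2 : ∫ θ, h θ * (1 - S θ) ∂G = α * ∫ θ, h θ ∂G := by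
      rw [← integral_const_mul]
      refine integral_congr_ae ?_
      filter_upwards [hae] with θ hθ
      have : 1 - S θ = α := sub_eq_zero.1 (pow_eq_zero_iff two_ne_zero |>.1 hθ)
      rw [this, mul_comm]
    exact mul_left_cancel₀ h0 (h2.symm.trans h1)

end SpectralEB

/-! ### Averages, empirical measures, quotients, and nodes. -/

namespace SpectralEB

/-- The average of `f 0, …, f (n - 1)`. -/
noncomputable def avg (n : ℕ) (f : ℕ → ℝ) : ℝ := (n : ℝ)⁻¹ * ∑ i ∈ Finset.range n, f i

lemma avg_add (n : ℕ) (f g : ℕ → ℝ) : avg n (fun i => f i + g i) = avg n f + avg n g := by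
  simp [avg, Finset.sum_add_distrib, mul_add]

lemma avg_sub (n : ℕ) (f g : ℕ → ℝ) : avg n (fun i => f i - g i) = avg n f - avg n g := by
  simp [avg, Finset.sum_sub_distrib, mul_sub]

lemma avg_const_mul (n : ℕ) (c : ℝ) (f : ℕ → ℝ) : avg n (fun i => c * f i) = c * avg n f := by
  simp only [avg, ← Finset.mul_sum]; ring

lemma avg_const {n : ℕ} (hn : 0 < n) (c : ℝ) : avg n (fun _ => c) = c := by
  have : (n : ℝ) ≠ 0 := by exact_mod_cast hn.ne'
  simp [avg, this]

lemma avg_mono {n : ℕ} {f g : ℕ → ℝ} (h : ∀ i < n, f i ≤ g i) : avg n f ≤ avg n g :=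
  mul_le_mul_of_nonneg_left (Finset.sum_le_sum fun i hi => h i (Finset.mem_range.1 hi))
    (by positivity)

lemma avg_congr {n : ℕ} {f g : ℕ → ℝ} (h : ∀ i < n, f i = g i) : avg n f = avg n g := by
  unfold avg
  rw [Finset.sum_congr rfl fun i hi => h i (Finset.mem_range.1 hi)]

lemma abs_avg_le {n : ℕ} {f g : ℕ → ℝ} (h : ∀ i < n, |f i| ≤ g i) : |avg n f| ≤ avg n g :=
  abs_le.2 ⟨by
    have := avg_mono (n := n) (f := fun i => -1 * g i) (g := f)
      fun i hi => by linarith [(abs_le.1 (h i hi)).1]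
    rw [avg_const_mul] at this
    linarith, avg_mono fun i hi => (abs_le.1 (h i hi)).2⟩

/-- The empirical measure of `y 0, …, y (n - 1)`. -/
noncomputable def empirical {Z : Type*} [MeasurableSpace Z] (n : ℕ) (y : ℕ → Z) : Measure Z :=
  (n : ℝ≥0∞)⁻¹ • ∑ i ∈ Finset.range n, Measure.dirac (y i)

lemma isProbabilityMeasure_empirical {Z : Type*} [MeasurableSpace Z] {n : ℕ} (hn : 0 < n)
    (y : ℕ → Z) : IsProbabilityMeasure (empirical n y) := by
  constructor
  have : (n : ℝ≥0∞) ≠ 0 := by exact_mod_cast hn.ne'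
  simp [empirical, ENNReal.inv_mul_cancel this]

/-- The empirical measure as a bundled probability measure. -/
noncomputable def empiricalProb {Z : Type*} [MeasurableSpace Z] {n : ℕ} (hn : 0 < n) (y : ℕ → Z) :
    ProbabilityMeasure Z := ⟨empirical n y, isProbabilityMeasure_empirical hn y⟩

lemma integral_empirical {Z : Type*} [MeasurableSpace Z] (n : ℕ) (y : ℕ → Z) {ψ : Z → ℝ}
    (hψ : StronglyMeasurable ψ) : ∫ z, ψ z ∂empirical n y = avg n fun i => ψ (y i) := by
  rw [empirical, integral_smul_measure, integral_finsetSum_measure fun i _ =>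
    (integrable_dirac' hψ) (by simp), avg]
  simp [integral_dirac' _ _ hψ]

/-- Quotients of uniformly convergent functions converge uniformly on a compact space, if the
limit of the denominators is positive. -/
lemma tendstoUniformly_div_of_pos {Z ι : Type*} [TopologicalSpace Z] [CompactSpace Z]
    {l : Filter ι} {a b : ι → Z → ℝ} {a₀ b₀ : Z → ℝ} (ha : TendstoUniformly a a₀ l)
    (hb : TendstoUniformly b b₀ l) (ha₀ : Continuous a₀) (hb₀ : Continuous b₀)
    (hpos : ∀ z, 0 < b₀ z) :
    TendstoUniformly (fun i z => a i z / b i z) (fun z => a₀ z / b₀ z) l := by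
  obtain ⟨A, hA⟩ := isCompact_univ.exists_bound_of_continuousOn ha₀.continuousOn
  obtain ⟨B, hB⟩ := isCompact_univ.exists_bound_of_continuousOn
    (hb₀.inv₀ fun z => (hpos z).ne').continuousOn
  -- One constant that is at least one and bounds both the limiting numerators and the reciprocals
  -- of the limiting denominators.
  obtain ⟨K, hK⟩ : ∃ K, K = max 1 (max A B) := ⟨_, rfl⟩
  have hK1 : 1 ≤ K := hK ▸ le_max_left _ _
  have hA' : ∀ z, |a₀ z| ≤ K := fun z =>
    (hA z (Set.mem_univ z)).trans (hK ▸ (le_max_left A B).trans (le_max_right _ _))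
  have hB' : ∀ z, 1 ≤ K * b₀ z := fun z => by
    have h1 : (b₀ z)⁻¹ ≤ K := (le_abs_self _).trans
      ((hB z (Set.mem_univ z)).trans (hK ▸ (le_max_right A B).trans (le_max_right _ _)))
    rwa [inv_le_iff_one_le_mul₀ (hpos z)] at h1
  rw [Metric.tendstoUniformly_iff] at ha hb ⊢
  intro ε hε
  have hKpos : 0 < K := by linarith
  -- The first bound keeps the denominators above `1 / (2 * K)`. The second makes the error factor
  -- `2 * K * δ + 2 * K ^ 3 * δ` less than `ε`.
  have hδ : 0 < min (1 / (2 * K)) (ε / (8 * K ^ 3)) := by positivity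
  filter_upwards [ha _ hδ, hb _ hδ] with i h1 h2 z
  specialize h1 z
  specialize h2 z
  rw [Real.dist_eq, abs_lt] at h1 h2
  obtain ⟨δ, hδe⟩ : ∃ δ, δ = min (1 / (2 * K)) (ε / (8 * K ^ 3)) := ⟨_, rfl⟩
  rw [← hδe] at h1 h2 hδ
  have hd1 : 2 * K * δ ≤ 1 := by
    have : δ ≤ 1 / (2 * K) := hδe ▸ min_le_left _ _
    rw [le_div_iff₀ (by positivity)] at this
    linarith
  have hd2 : 8 * K ^ 3 * δ ≤ ε := by
    have : δ ≤ ε / (8 * K ^ 3) := hδe ▸ min_le_right _ _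
    rw [le_div_iff₀ (by positivity)] at this
    linarith
  have hp := hpos z
  have hbz := hB' z
  have hbi : 1 ≤ 2 * K * b i z := by nlinarith
  have hbi0 : 0 < b i z := by
    by_contra hcon
    nlinarith [not_lt.1 hcon]
  rw [Real.dist_eq, div_sub_div _ _ hp.ne' hbi0.ne', abs_div, abs_of_pos (mul_pos hp hbi0),
    div_lt_iff₀ (mul_pos hp hbi0)]
  have hnum : |a₀ z * b i z - b₀ z * a i z| ≤ δ * b₀ z + K * δ := by
    have he : a₀ z * b i z - b₀ z * a i z = (a₀ z - a i z) * b₀ z - a₀ z * (b₀ z - b i z) := by ring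
    rw [he]
    refine (abs_sub _ _).trans (add_le_add ?_ ?_)
    · rw [abs_mul, abs_of_pos hp]
      exact mul_le_mul_of_nonneg_right (abs_le.2 ⟨h1.1.le, h1.2.le⟩) hp.le
    · rw [abs_mul]
      exact mul_le_mul (hA' z) (abs_le.2 ⟨h2.1.le, h2.2.le⟩) (abs_nonneg _) hKpos.le
  refine hnum.trans_lt ?_
  have e1 : δ * b₀ z ≤ δ * b₀ z * (2 * K * b i z) := le_mul_of_one_le_right (by positivity) hbi
  have e2 : K * δ ≤ K * δ * ((K * b₀ z) * (2 * K * b i z)) :=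
    le_mul_of_one_le_right (by positivity) (one_le_mul_of_one_le_of_one_le hbz hbi)
  have e3 : δ * b₀ z * (2 * K * b i z) + K * δ * ((K * b₀ z) * (2 * K * b i z))
      = (2 * K * δ + 2 * K ^ 3 * δ) * (b₀ z * b i z) := by ring
  have e4 : 2 * K * δ + 2 * K ^ 3 * δ < ε := by
    have : K ≤ K ^ 3 := le_self_pow₀ hK1 (by norm_num)
    have : 0 < K ^ 3 * δ := by positivity
    nlinarith
  have := mul_lt_mul_of_pos_right e4 (mul_pos hp hbi0)
  linarith

variable {L tmax : ℝ}

/-- The node `2 L ν / (2 N + 1)` on the circle. -/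
noncomputable def node (L : ℝ) (N : ℕ) (ν : ℤ) : AddCircle (2 * L) :=
  ((2 * L * ν / (2 * N + 1) : ℝ) : AddCircle (2 * L))

/-- The Fejér smoothing of the measure with density `h` with respect to `Γ`, after a heat flow of
duration `t`. -/
noncomputable def fejerMix (N : ℕ) (Γ : Measure (AddCircle (2 * L))) (h : AddCircle (2 * L) → ℝ)
    (t : ℝ) (x : AddCircle (2 * L)) : ℝ :=
  heat L (fun k => cesaroWeight N k * coef Γ h k) t x

/-- Viewing a translated kernel as a heat flow with bounded coefficients puts scores and densities
under the same convergence lemma. -/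
lemma fejerHeat_sub_eq (N : ℕ) (t : ℝ) (x θ : AddCircle (2 * L)) :
    fejerHeat L N t (x - θ) = heat L (fun k => cesaroWeight N k * fourier (-k) θ) t x := by
  rw [fejerHeat, heat, heat]
  refine tsum_congr fun k => ?_
  rw [fourier_sub_apply, mul_comm (fourier k x : ℂ), mul_assoc]

lemma norm_cesaroWeight_mul_le {c : ℂ} {C : ℝ} (hc : ‖c‖ ≤ C) (N : ℕ) (k : ℤ) :
    ‖(cesaroWeight N k : ℂ) * c‖ ≤ C := by
  rw [norm_mul, Complex.norm_real, Real.norm_eq_abs]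
  exact (mul_le_of_le_one_left (norm_nonneg _) (abs_cesaroWeight_le N k)).trans hc

variable [hL : Fact (0 < 2 * L)]

lemma fejerMix_eq_integral (N : ℕ) (Γ : Measure (AddCircle (2 * L))) [IsFiniteMeasure Γ]
    {h : AddCircle (2 * L) → ℝ} (hh : Continuous h) (t : ℝ) (x : AddCircle (2 * L)) :
    fejerMix N Γ h t x = ∫ θ, h θ * fejerHeat L N t (x - θ) ∂Γ :=
  (integral_heat (summable_decay_cesaroWeight t N) Γ hh x).symm

/-- Nodes become dense. -/
lemma exists_tendsto_node {ι : Type*} {l : Filter ι} {N : ι → ℕ} (hN : Tendsto N l atTop)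
    (θ : AddCircle (2 * L)) :
    ∃ ν : ι → ℤ, (∀ j, ν j ∈ idx (N j)) ∧ Tendsto (fun j => node L (N j) (ν j)) l (𝓝 θ) := by
  have hL0 := pos_of_fact hL
  obtain ⟨⟨a, ha⟩, rfl⟩ := (AddCircle.equivIco (2 * L) (-L)).symm.surjective θ
  have hcoe : ((AddCircle.equivIco (2 * L) (-L)).symm ⟨a, ha⟩ : AddCircle (2 * L)) = (a : ℝ) := rfl
  rw [hcoe]
  have ha1 : -L ≤ a := ha.1
  have ha2 : a < L := by have := ha.2; linarith
  -- The index of the nearest node. Representing the point in `[-L, L)` keeps the rounded index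
  -- between `-N` and `N`; the half-open end matters.
  refine ⟨fun j => ⌊a * (2 * N j + 1) / (2 * L) + 1 / 2⌋, fun j => ?_, ?_⟩
  · have hNj : (0 : ℝ) < 2 * N j + 1 := by positivity
    rw [Finset.mem_Icc, Int.le_floor, ← Int.lt_add_one_iff, Int.floor_lt]
    constructor
    · have : -(1 / 2) * (2 * (N j : ℝ) + 1) ≤ a * (2 * N j + 1) / (2 * L) := by
        rw [le_div_iff₀ hL.out]
        nlinarith
      push_cast
      linarith
    · have : a * (2 * N j + 1) / (2 * L) < 1 / 2 * (2 * (N j : ℝ) + 1) := by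
        rw [div_lt_iff₀ hL.out]
        nlinarith
      push_cast
      linarith
  · refine ((AddCircle.continuous_mk' (2 * L)).tendsto a).comp ?_
    have h0 : Tendsto (fun n : ℕ => 2 * L / (2 * (n : ℝ) + 1)) atTop (𝓝 0) :=
      tendsto_const_nhds.div_atTop (tendsto_atTop_add_const_right _ _
        (tendsto_natCast_atTop_atTop.const_mul_atTop zero_lt_two))
    rw [tendsto_iff_dist_tendsto_zero]
    refine squeeze_zero (fun _ => dist_nonneg) (fun j => ?_) (h0.comp hN)
    have hNj : (0 : ℝ) < 2 * N j + 1 := by positivity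
    have h1 := Int.floor_le (a * (2 * N j + 1) / (2 * L) + 1 / 2)
    have h2 := Int.lt_floor_add_one (a * (2 * N j + 1) / (2 * L) + 1 / 2)
    obtain ⟨ν, hν⟩ : ∃ ν : ℝ, ν = (⌊a * (2 * N j + 1) / (2 * L) + 1 / 2⌋ : ℤ) := ⟨_, rfl⟩
    obtain ⟨v, hv⟩ : ∃ v, v = a * (2 * N j + 1) / (2 * L) := ⟨_, rfl⟩
    rw [← hν, ← hv] at h1 h2
    have hav : a = 2 * L * v / (2 * N j + 1) := by
      rw [hv]; field_simp
    simp only [Function.comp_apply]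
    rw [← hν, Real.dist_eq, hav, ← sub_div, ← mul_sub, abs_div, abs_of_pos hNj, abs_mul,
      abs_of_pos hL.out]
    refine div_le_div_of_nonneg_right (mul_le_of_le_one_right hL.out.le ?_) hNj.le
    rw [abs_le]
    constructor <;> linarith

end SpectralEB

/-! ### Passage to the limit in the first-order conditions. -/

namespace SpectralEB

variable {L tmax : ℝ} [hL : Fact (0 < 2 * L)]

lemma tendsto_coef {ι : Type*} {l : Filter ι} {Γ : ι → ProbabilityMeasure (AddCircle (2 * L))}
    {G : ProbabilityMeasure (AddCircle (2 * L))} (hΓ : Tendsto Γ l (𝓝 G))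
    {h : AddCircle (2 * L) → ℝ} (hh : Continuous h) (k : ℤ) :
    Tendsto (fun j => coef (Γ j : Measure (AddCircle (2 * L))) h k) l
      (𝓝 (coef (G : Measure (AddCircle (2 * L))) h k)) :=
  (ProbabilityMeasure.tendsto_iff_forall_integral_rclike_tendsto ℂ).1 hΓ
    (BoundedContinuousFunction.mkOfCompact
      ⟨fun θ => (h θ : ℂ) * fourier (-k) θ, by fun_prop⟩)

/-- Averages of uniformly convergent functions under weakly convergent empirical measures. -/
lemma tendsto_avg_of_tendstoUniformly {Z ι : Type*} [TopologicalSpace Z] [CompactSpace Z]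
    [MeasurableSpace Z] [OpensMeasurableSpace Z] [SecondCountableTopology Z]
    {l : Filter ι} {n : ι → ℕ} (hn : ∀ j, 0 < n j) {y : ι → ℕ → Z}
    {η : ProbabilityMeasure Z} (hη : Tendsto (fun j => empiricalProb (hn j) (y j)) l (𝓝 η))
    {F : ι → Z → ℝ} {F₀ : Z → ℝ} (hF : TendstoUniformly F F₀ l) (hF₀ : Continuous F₀) :
    Tendsto (fun j => avg (n j) fun i => F j (y j i)) l (𝓝 (∫ z, F₀ z ∂(η : Measure Z))) := by
  have h1 : Tendsto (fun j => avg (n j) fun i => F₀ (y j i)) l (𝓝 (∫ z, F₀ z ∂(η : Measure Z))) := by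
    have := ProbabilityMeasure.tendsto_iff_forall_integral_tendsto.1 hη
      (BoundedContinuousFunction.mkOfCompact ⟨F₀, hF₀⟩)
    refine this.congr fun j => ?_
    exact integral_empirical (n j) (y j) (ψ := F₀) hF₀.measurable.stronglyMeasurable
  have h2 : Tendsto (fun j => avg (n j) (fun i => F j (y j i)) - avg (n j) fun i => F₀ (y j i)) l
      (𝓝 0) := by
    rw [Metric.tendsto_nhds]
    intro ε hε
    filter_upwards [Metric.tendstoUniformly_iff.1 hF (ε / 2) (half_pos hε)] with j hj
    rw [Real.dist_eq, sub_zero, ← avg_sub]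
    refine (abs_avg_le (g := fun _ => ε / 2) fun i _ => ?_).trans_lt
      (by rw [avg_const (hn j)]; linarith)
    have := hj (y j i)
    rw [dist_comm, Real.dist_eq] at this
    exact this.le
  simpa using h2.add h1

/-- Averages of ratios of heat flows, cut off near time zero. -/
lemma tendsto_avg_ratio {ι : Type*} {l : Filter ι} {n : ι → ℕ} (hn : ∀ j, 0 < n j)
    {y : ι → ℕ → Obs L tmax} {η : ProbabilityMeasure (Obs L tmax)}
    (hη : Tendsto (fun j => empiricalProb (hn j) (y j)) l (𝓝 η))
    {M Q : ι → ℤ → ℂ} {m g : ℤ → ℂ} {C : ℝ} (hM : ∀ j k, ‖M j k‖ ≤ C) (hm : ∀ k, ‖m k‖ ≤ C)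
    (hQ : ∀ j k, ‖Q j k‖ ≤ C) (hg : ∀ k, ‖g k‖ ≤ C)
    (hMm : ∀ k, Tendsto (fun j => M j k) l (𝓝 (m k)))
    (hQg : ∀ k, Tendsto (fun j => Q j k) l (𝓝 (g k)))
    (hpos : ∀ t x, 0 < t → 0 < heat L g t x) (c : ℕ) :
    Tendsto (fun j => avg (n j) fun i => cutoff c (y j i).1 *
        (heat L (M j) (y j i).1 (y j i).2 / heat L (Q j) (y j i).1 (y j i).2)) l
      (𝓝 (∫ z : Obs L tmax, cutoff c z.1 * (heat L m z.1 z.2 / heat L g z.1 z.2)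
        ∂(η : Measure (Obs L tmax)))) := by
  have hL0 := pos_of_fact hL
  have hτ : 0 < 1 / ((c : ℝ) + 1) := by positivity
  -- Truncating the time from below is invisible behind the cutoff and keeps every heat flow in the
  -- region of uniform convergence.
  let p : Obs L tmax → ℝ × AddCircle (2 * L) := fun z => (max z.1 (1 / ((c : ℝ) + 1)), z.2)
  have hp : Continuous p := by fun_prop
  have hpm : ∀ z, p z ∈ {q : ℝ × AddCircle (2 * L) | 1 / ((c : ℝ) + 1) ≤ q.1} :=
    fun z => le_max_right (z.1 : ℝ) _
  have hunif : ∀ {A : ι → ℤ → ℂ} {a : ℤ → ℂ}, (∀ j k, ‖A j k‖ ≤ C) → (∀ k, ‖a k‖ ≤ C) →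
      (∀ k, Tendsto (fun j => A j k) l (𝓝 (a k))) →
      TendstoUniformly (fun j z => heat L (A j) (p z).1 (p z).2)
        (fun z => heat L a (p z).1 (p z).2) l := by
    intro A a hA ha hAa
    have := (tendstoUniformlyOn_heat hL0 hτ hA ha hAa).comp p
    rw [← tendstoUniformlyOn_univ]
    exact this.mono fun z _ => hpm z
  have hcont : ∀ {a : ℤ → ℂ}, (∀ k, ‖a k‖ ≤ C) → Continuous fun z => heat L a (p z).1 (p z).2 :=
    fun ha => (continuousOn_heat hL0 ha hτ).comp_continuous hp hpm
  have hppos : ∀ z, 0 < heat L g (p z).1 (p z).2 := fun z =>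
    hpos _ _ (lt_of_lt_of_le hτ (hpm z))
  have hdiv := tendstoUniformly_div_of_pos (hunif hM hm hMm) (hunif hQ hg hQg) (hcont hm) (hcont hg)
    hppos
  have hmul : TendstoUniformly (fun j (z : Obs L tmax) => cutoff c z.1 *
      (heat L (M j) (p z).1 (p z).2 / heat L (Q j) (p z).1 (p z).2))
      (fun z => cutoff c z.1 * (heat L m (p z).1 (p z).2 / heat L g (p z).1 (p z).2)) l := by
    rw [Metric.tendstoUniformly_iff] at hdiv ⊢
    intro ε hε
    filter_upwards [hdiv ε hε] with j hj z
    refine lt_of_le_of_lt ?_ (hj z)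
    rw [Real.dist_eq, Real.dist_eq, ← mul_sub, abs_mul, abs_of_nonneg (cutoff_nonneg _ _)]
    exact mul_le_of_le_one_left (abs_nonneg _) (cutoff_le_one _ _)
  have hcm : Continuous fun z : Obs L tmax =>
      cutoff c z.1 * (heat L m (p z).1 (p z).2 / heat L g (p z).1 (p z).2) :=
    ((continuous_cutoff c).comp (by fun_prop)).mul ((hcont hm).div (hcont hg) fun z => (hppos z).ne')
  have key := tendsto_avg_of_tendstoUniformly hn hη hmul hcm
  have hrw : ∀ (a b : ℤ → ℂ) (z : Obs L tmax),
      cutoff c z.1 * (heat L a (p z).1 (p z).2 / heat L b (p z).1 (p z).2)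
        = cutoff c z.1 * (heat L a z.1 z.2 / heat L b z.1 z.2) := fun a b z =>
    (cutoff_mul_max c z.1 fun t => heat L a t z.2 / heat L b t z.2).symm
  simp_rw [hrw] at key
  exact key

/-- For short times the posterior concentrates at the observation. -/
lemma abs_fejerMix_div_sub_le {Γ : Measure (AddCircle (2 * L))} [IsProbabilityMeasure Γ]
    {h : AddCircle (2 * L) → ℝ} (hh : Continuous h) {ε C σ t : ℝ} (hC : 0 ≤ C)
    (hosc : ∀ x θ, |h θ - h x| ≤ ε + C * chordSq L (x - θ)) (ht : 0 ≤ t)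
    (hσ : (Real.pi / L) ^ 2 * t / 2 ≤ σ) (hσ1 : σ ≤ 1) (N : ℕ) (x : AddCircle (2 * L))
    (hq : 0 < fejerMix N Γ (fun _ => 1) t x) :
    |fejerMix N Γ h t x / fejerMix N Γ (fun _ => 1) t x - h x|
      ≤ ε + C * (4 / ((N : ℝ) + 1) + 4 * spread σ) * (1 / fejerMix N Γ (fun _ => 1) t x) := by
  have hL0 := pos_of_fact hL
  have hKc : Continuous fun θ => fejerHeat L N t (x - θ) :=
    (continuous_fejerHeat N).comp (continuous_const.prodMk (continuous_const.sub continuous_id))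
  have hK0 : ∀ θ, 0 ≤ fejerHeat L N t (x - θ) := fun θ => fejerHeat_nonneg hL0 N ht _
  have hq1 : fejerMix N Γ (fun _ => 1) t x = ∫ θ, fejerHeat L N t (x - θ) ∂Γ := by
    rw [fejerMix_eq_integral N Γ continuous_const]; simp
  have hi1 : Integrable (fun θ => h θ * fejerHeat L N t (x - θ)) Γ :=
    integrable_continuous (hh.mul hKc)
  have hi2 : Integrable (fun θ => h x * fejerHeat L N t (x - θ)) Γ :=
    integrable_continuous (continuous_const.mul hKc)
  -- The unnormalized posterior mean of `h - h x`: the oscillation bound splits it into an `ε` part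
  -- and a chord part, and the chord tames the kernel.
  have hdiff : fejerMix N Γ h t x - h x * fejerMix N Γ (fun _ => 1) t x
      = ∫ θ, (h θ - h x) * fejerHeat L N t (x - θ) ∂Γ := by
    rw [hq1, fejerMix_eq_integral N Γ hh, ← integral_const_mul, ← integral_sub hi1 hi2]
    exact integral_congr_ae (Eventually.of_forall fun θ => by ring)
  have hbound : |∫ θ, (h θ - h x) * fejerHeat L N t (x - θ) ∂Γ|
      ≤ ε * fejerMix N Γ (fun _ => 1) t x + C * (4 / ((N : ℝ) + 1) + 4 * spread σ) := by
    have hle : ∀ θ, ‖(h θ - h x) * fejerHeat L N t (x - θ)‖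
        ≤ ε * fejerHeat L N t (x - θ) + C * (4 / ((N : ℝ) + 1) + 4 * spread σ) := fun θ => by
      rw [norm_mul, Real.norm_eq_abs, Real.norm_of_nonneg (hK0 θ)]
      calc |h θ - h x| * fejerHeat L N t (x - θ)
          ≤ (ε + C * chordSq L (x - θ)) * fejerHeat L N t (x - θ) :=
            mul_le_mul_of_nonneg_right (hosc x θ) (hK0 θ)
        _ = ε * fejerHeat L N t (x - θ) + C * (chordSq L (x - θ) * fejerHeat L N t (x - θ)) := by
            ring
        _ ≤ _ := by
            have := mul_le_mul_of_nonneg_left (chordSq_mul_fejerHeat_le ht hσ hσ1 N (x - θ)) hC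
            linarith
    have hi3 : Integrable (fun θ => ε * fejerHeat L N t (x - θ)) Γ :=
      integrable_continuous (continuous_const.mul hKc)
    refine (norm_integral_le_of_norm_le (hi3.add (integrable_const _))
      (Eventually.of_forall hle)).trans (le_of_eq ?_)
    simp only [Pi.add_apply]
    rw [integral_add hi3 (integrable_const _), integral_const_mul, ← hq1]
    simp
  have he : fejerMix N Γ h t x / fejerMix N Γ (fun _ => 1) t x - h x
      = (fejerMix N Γ h t x - h x * fejerMix N Γ (fun _ => 1) t x)
        / fejerMix N Γ (fun _ => 1) t x := by
    field_simp
  rw [he, hdiff, abs_div, abs_of_pos hq, div_le_iff₀ hq]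
  refine hbound.trans (le_of_eq ?_)
  field_simp

/-- Consistency of the node measures under the first-order conditions for the maximum likelihood
estimate, for a deterministic array of observations which obeys the law of large numbers. -/
theorem tendsto_of_first_order_conditions {ι : Type*} {l : Filter ι}
    {P : ProbabilityMeasure (AddCircle (2 * L))} {N n : ι → ℕ} {y : ι → ℕ → Obs L tmax}
    {Γ : ι → ProbabilityMeasure (AddCircle (2 * L))} (hN : Tendsto N l atTop)
    (hn : ∀ j, 0 < n j) {q : ι → ℕ → ℝ}
    (hqdef : ∀ j i, q j i = fejerMix (N j) (Γ j : Measure (AddCircle (2 * L))) (fun _ => 1)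
      (y j i).1 (y j i).2)
    (hq : ∀ j, ∀ i < n j, 0 < q j i)
    (hscore : ∀ j, ∀ ν ∈ idx (N j),
      avg (n j) (fun i => fejerHeat L (N j) (y j i).1 ((y j i).2 - node L (N j) ν) / q j i) ≤ 1)
    (hunif : ∀ j, avg (n j) (fun i => 1 / q j i) ≤ 1)
    (hself : ∀ j (h : AddCircle (2 * L) → ℝ), Continuous h →
      ∫ θ, h θ ∂(Γ j : Measure (AddCircle (2 * L))) = avg (n j) fun i =>
        fejerMix (N j) (Γ j : Measure (AddCircle (2 * L))) h (y j i).1 (y j i).2 / q j i)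
    (hlln : ∀ ψ : C(Obs L tmax, ℝ), Tendsto (fun j => avg (n j) fun i =>
      ψ (y j i) - ∫ x, ψ ((y j i).1, x) ∂noisyLaw (P : Measure (AddCircle (2 * L))) (y j i).1)
      l (𝓝 0)) :
    Tendsto Γ l (𝓝 P) := by
  have hL0 := pos_of_fact hL
  -- Along an ultrafilter, compactness supplies limits of the mixing and the empirical measures at
  -- once; it remains to show that the former limit is always `P`.
  rw [tendsto_iff_ultrafilter]
  intro u hu
  let E : ι → ProbabilityMeasure (Obs L tmax) := fun j => empiricalProb (hn j) (y j)
  obtain ⟨G, hG⟩ : ∃ G, Tendsto Γ u (𝓝 G) := ⟨_, (u.map Γ).le_nhds_lim⟩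
  obtain ⟨η, hη⟩ : ∃ η, Tendsto E u (𝓝 η) := ⟨_, (u.map E).le_nhds_lim⟩
  have hNu : Tendsto N u atTop := hN.mono_left hu
  let lam : ProbabilityMeasure (Set.Icc (0 : ℝ) tmax) :=
    η.map (f := Prod.fst) measurable_fst.aemeasurable
  have hlamint : ∀ f : Set.Icc (0 : ℝ) tmax → ℝ, Continuous f →
      ∫ t, f t ∂(lam : Measure (Set.Icc (0 : ℝ) tmax)) = ∫ z, f z.1 ∂(η : Measure (Obs L tmax)) :=
    fun f hf => integral_map measurable_fst.aemeasurable hf.aestronglyMeasurable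
  have hconst : ∀ F : Obs L tmax → ℝ, Continuous F →
      Tendsto (fun j => avg (n j) fun i => F (y j i)) u (𝓝 (∫ z, F z ∂(η : Measure (Obs L tmax)))) :=
    fun F hF => tendsto_avg_of_tendstoUniformly hn hη (F := fun _ => F) (F₀ := F)
      (Metric.tendstoUniformly_iff.2 fun ε hε => Eventually.of_forall fun j z => by
        rwa [dist_self]) hF
  -- The law of large numbers identifies the conditional law of the position; the law of the
  -- variances is whatever the ultrafilter produces.
  have hηeq : ∀ ψ : Obs L tmax → ℝ, Continuous ψ → ∫ z, ψ z ∂(η : Measure (Obs L tmax))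
      = ∫ t, ∫ x, ψ (t, x) ∂noisyLaw (P : Measure (AddCircle (2 * L))) t
        ∂(lam : Measure (Set.Icc (0 : ℝ) tmax)) := by
    intro ψ hψ
    have hc := continuous_integral_noisyLaw (P : Measure (AddCircle (2 * L))) hψ
    have h1 := (hconst ψ hψ).sub (hconst _ (hc.comp continuous_fst))
    have h2 := (hlln ⟨ψ, hψ⟩).mono_left hu
    rw [hlamint _ hc]
    refine sub_eq_zero.1 (tendsto_nhds_unique h1 (h2.congr fun j => ?_))
    exact avg_sub _ _ _
  have hweight : ∀ {A : ι → ℂ} {a : ℂ} (k : ℤ), Tendsto A u (𝓝 a) →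
      Tendsto (fun j => (cesaroWeight (N j) k : ℂ) * A j) u (𝓝 a) := fun k hA => by
    have h1 : Tendsto (fun j => (cesaroWeight (N j) k : ℂ)) u (𝓝 1) := by
      rw [← Complex.ofReal_one]
      exact (Complex.continuous_ofReal.tendsto 1).comp (tendsto_cesaroWeight hNu k)
    simpa using h1.mul hA
  have hQb : ∀ j k, ‖(cesaroWeight (N j) k : ℂ)
      * coef (Γ j : Measure (AddCircle (2 * L))) (fun _ => 1) k‖ ≤ 1 := fun j k =>
    norm_cesaroWeight_mul_le (norm_coef_one_le _ k) _ _
  have hQlim := fun k => hweight k (tendsto_coef hG (h := fun _ => 1) continuous_const k)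
  have hGpos : ∀ t x, 0 < t →
      0 < heat L (coef (G : Measure (AddCircle (2 * L))) fun _ => 1) t x := fun t x ht =>
    noisyDensity_pos _ ht x
  have hqheat : ∀ j i, q j i = heat L (fun k => (cesaroWeight (N j) k : ℂ)
      * coef (Γ j : Measure (AddCircle (2 * L))) (fun _ => 1) k) (y j i).1 (y j i).2 := hqdef
  -- the score bound passes to the limit
  have hle : ∀ c θ, score (G : Measure (AddCircle (2 * L))) (η : Measure (Obs L tmax)) c θ ≤ 1 := by
    intro c θ
    -- Optimality is known at nodes only, so the point is approached by nodes.
    obtain ⟨ν, hνm, hν⟩ := exists_tendsto_node hNu θ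
    have hlim := tendsto_avg_ratio hn hη (C := 1)
      (M := fun j k => (cesaroWeight (N j) k : ℂ) * fourier (-k) (node L (N j) (ν j)))
      (m := fun k => fourier (-k) θ)
      (fun j k => norm_cesaroWeight_mul_le (norm_fourier_apply _ _).le _ _)
      (fun k => (norm_fourier_apply _ _).le) hQb
      (norm_coef_one_le (G : Measure (AddCircle (2 * L))))
      (fun k => hweight k (((fourier (-k)).continuous.tendsto θ).comp hν)) hQlim hGpos c
    have hval : score (G : Measure (AddCircle (2 * L))) (η : Measure (Obs L tmax)) c θ
        = ∫ z : Obs L tmax, cutoff c z.1 * (heat L (fun k => fourier (-k) θ) z.1 z.2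
          / heat L (coef (G : Measure (AddCircle (2 * L))) fun _ => 1) z.1 z.2)
          ∂(η : Measure (Obs L tmax)) := by
      refine integral_congr_ae (Eventually.of_forall fun z => ?_)
      have : heat L (fun _ => 1) z.1 (z.2 - θ) = heat L (fun k => fourier (-k) θ) z.1 z.2 :=
        tsum_congr fun k => by rw [fourier_sub_apply, mul_comm (fourier k z.2 : ℂ), one_mul]
      simp only [scoreKernel, this]
      rfl
    rw [hval]
    refine le_of_tendsto hlim (Eventually.of_forall fun j => ?_)
    refine (avg_mono fun i hi => ?_).trans (hscore j (ν j) (hνm j))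
    rw [← hqheat, ← fejerHeat_sub_eq]
    exact mul_le_of_le_one_left (div_nonneg (fejerHeat_nonneg hL0 _ (y j i).1.2.1 _) (hq j i hi).le)
      (cutoff_le_one _ _)
  -- self-consistency passes to the limit
  have hlimself : ∀ h : AddCircle (2 * L) → ℝ, Continuous h →
      Tendsto (fun c => ∫ θ, h θ * score (G : Measure (AddCircle (2 * L)))
          (η : Measure (Obs L tmax)) c θ ∂(G : Measure (AddCircle (2 * L)))
        + ∫ z : Obs L tmax, (1 - cutoff c z.1) * h z.2 ∂(η : Measure (Obs L tmax))) atTop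
        (𝓝 (∫ θ, h θ ∂(G : Measure (AddCircle (2 * L))))) := by
    intro h hh
    obtain ⟨B, hB⟩ : ∃ B, ∀ θ, |h θ| ≤ B := by
      obtain ⟨B, hB⟩ := isCompact_univ.exists_bound_of_continuousOn hh.continuousOn
      exact ⟨B, fun θ => hB θ (Set.mem_univ θ)⟩
    -- At a fixed cutoff, the posterior mean is kept where the cutoff is on and replaced by `h` at
    -- the observation where it is off. This has a continuous limit.
    have hlimc : ∀ c, Tendsto (fun j => avg (n j) (fun i => cutoff c (y j i).1 *
        (fejerMix (N j) (Γ j : Measure (AddCircle (2 * L))) h (y j i).1 (y j i).2 / q j i)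
        + (1 - cutoff c (y j i).1) * h (y j i).2)) u
        (𝓝 (∫ θ, h θ * score (G : Measure (AddCircle (2 * L)))
          (η : Measure (Obs L tmax)) c θ ∂(G : Measure (AddCircle (2 * L)))
        + ∫ z : Obs L tmax, (1 - cutoff c z.1) * h z.2 ∂(η : Measure (Obs L tmax)))) := by
      intro c
      have h1 := tendsto_avg_ratio hn hη (C := max B 1)
        (M := fun j k => (cesaroWeight (N j) k : ℂ) * coef (Γ j : Measure (AddCircle (2 * L))) h k)
        (m := coef (G : Measure (AddCircle (2 * L))) h)
        (fun j k => (norm_cesaroWeight_mul_le (norm_coef_le hB k) _ _).trans (le_max_left _ _))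
        (fun k => (norm_coef_le hB k).trans (le_max_left _ _))
        (fun j k => (hQb j k).trans (le_max_right _ _))
        (fun k => (norm_coef_one_le (G : Measure (AddCircle (2 * L))) k).trans (le_max_right _ _))
        (fun k => hweight k (tendsto_coef hG hh k)) hQlim hGpos c
      have h2 := hconst (fun z => (1 - cutoff c z.1) * h z.2)
        ((continuous_const.sub ((continuous_cutoff c).comp (by fun_prop))).mul (by fun_prop))
      rw [integral_mul_score (G : Measure (AddCircle (2 * L))) (η : Measure (Obs L tmax))
        (G : Measure (AddCircle (2 * L))) hh c]
      refine (h1.add h2).congr fun j => ?_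
      rw [← avg_add]
      refine avg_congr fun i _ => ?_
      rw [← hqheat]
      rfl
    have hΓlim : Tendsto (fun j => ∫ θ, h θ ∂(Γ j : Measure (AddCircle (2 * L)))) u
        (𝓝 (∫ θ, h θ ∂(G : Measure (AddCircle (2 * L))))) :=
      ProbabilityMeasure.tendsto_iff_forall_integral_tendsto.1 hG
        (BoundedContinuousFunction.mkOfCompact ⟨h, hh⟩)
    rw [Metric.tendsto_nhds]
    intro ε hε
    obtain ⟨C, hC0, hC⟩ := exists_abs_sub_le_add_chordSq hL hh (half_pos hε)
    -- The value of `(π / L) ^ 2 * t / 2` at `t = 2 / (c + 1)`, from which time on the cutoff equals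
    -- one.
    obtain ⟨σ, hσ⟩ : ∃ σ : ℕ → ℝ, ∀ c, σ c = (Real.pi / L) ^ 2 / ((c : ℝ) + 1) := ⟨_, fun _ => rfl⟩
    have hσlim : Tendsto σ atTop (𝓝 0) := by
      rw [funext hσ]
      exact tendsto_const_nhds.div_atTop
        (tendsto_atTop_add_const_right _ _ tendsto_natCast_atTop_atTop)
    have hσ0 : ∀ c, 0 ≤ σ c := fun c => by rw [hσ]; positivity
    have hspread : Tendsto (fun c => C * (4 * spread (σ c))) atTop (𝓝 0) := by
      have h1 := tendsto_spread.comp (tendsto_nhdsWithin_iff.2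
        ⟨hσlim, Eventually.of_forall fun c => hσ0 c⟩)
      have h2 := (h1.const_mul 4).const_mul C
      simpa using h2
    filter_upwards [hσlim.eventually_le_const zero_lt_one,
      hspread.eventually_lt_const (half_pos hε)] with c hc1 hc2
    -- The replacement error is the concentration bound, which carries a factor `1 / q j i`.
    -- Individual factors may be huge, but their average is at most one by `hunif`.
    have hbd : ∀ j, |avg (n j) (fun i => cutoff c (y j i).1 *
        (fejerMix (N j) (Γ j : Measure (AddCircle (2 * L))) h (y j i).1 (y j i).2 / q j i)
        + (1 - cutoff c (y j i).1) * h (y j i).2)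
        - ∫ θ, h θ ∂(Γ j : Measure (AddCircle (2 * L)))|
        ≤ ε / 2 + C * (4 / ((N j : ℝ) + 1) + 4 * spread (σ c)) := by
      intro j
      have hKnn : 0 ≤ C * (4 / ((N j : ℝ) + 1) + 4 * spread (σ c)) := by
        have : 0 ≤ spread (σ c) := tsum_nonneg fun k => le_min (hσ0 c) (by positivity)
        positivity
      rw [hself j h hh, ← avg_sub]
      refine (abs_avg_le (g := fun i => ε / 2
        + C * (4 / ((N j : ℝ) + 1) + 4 * spread (σ c)) * (1 / q j i)) fun i hi => ?_).trans ?_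
      · have hinv : 0 ≤ 1 / q j i := one_div_nonneg.2 (hq j i hi).le
        have he : cutoff c (y j i).1 *
            (fejerMix (N j) (Γ j : Measure (AddCircle (2 * L))) h (y j i).1 (y j i).2 / q j i)
            + (1 - cutoff c (y j i).1) * h (y j i).2
            - fejerMix (N j) (Γ j : Measure (AddCircle (2 * L))) h (y j i).1 (y j i).2 / q j i
            = -((1 - cutoff c (y j i).1) *
              (fejerMix (N j) (Γ j : Measure (AddCircle (2 * L))) h (y j i).1 (y j i).2 / q j i
                - h (y j i).2)) := by ring
        rw [he, abs_neg, abs_mul, abs_of_nonneg (sub_nonneg.2 (cutoff_le_one _ _))]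
        by_cases hcut : cutoff c (y j i).1 = 1
        · rw [hcut, sub_self, zero_mul]
          have := mul_nonneg hKnn hinv
          linarith
        · refine (mul_le_of_le_one_left (abs_nonneg _)
            (by linarith [cutoff_nonneg c (y j i).1])).trans ?_
          have hqi := hq j i hi
          rw [hqdef] at hqi ⊢
          refine abs_fejerMix_div_sub_le hh hC0 hC (y j i).1.2.1 ?_ hc1 _ _ hqi
          have ht := (lt_of_cutoff_ne_one hcut).le
          rw [hσ]
          calc (Real.pi / L) ^ 2 * ((y j i).1 : ℝ) / 2
              ≤ (Real.pi / L) ^ 2 * (2 / ((c : ℝ) + 1)) / 2 := by gcongr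
            _ = (Real.pi / L) ^ 2 / ((c : ℝ) + 1) := by ring
      · rw [avg_add, avg_const (hn j), avg_const_mul]
        have := mul_le_mul_of_nonneg_left (hunif j) hKnn
        linarith
    -- First `N → ∞` with the cutoff fixed; the remaining `spread` term is small by the choice of
    -- `c`.
    have hNlim : Tendsto (fun j => ε / 2 + C * (4 / ((N j : ℝ) + 1) + 4 * spread (σ c))) u
        (𝓝 (ε / 2 + C * (0 + 4 * spread (σ c)))) := by
      have h0 : Tendsto (fun n : ℕ => 4 / ((n : ℝ) + 1)) atTop (𝓝 0) :=
        tendsto_const_nhds.div_atTop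
          (tendsto_atTop_add_const_right _ _ tendsto_natCast_atTop_atTop)
      exact (((h0.comp hNu).add_const _).const_mul C).const_add _
    have hfin := le_of_tendsto_of_tendsto ((hlimc c).sub hΓlim).abs hNlim
      (Eventually.of_forall hbd)
    rw [Real.dist_eq]
    rw [zero_add] at hfin
    linarith
  have hGP : (G : Measure (AddCircle (2 * L))) = P := eq_of_score_le_one hηeq hle hlimself
  have : G = P := Subtype.ext hGP
  rw [← this]
  exact hG

end SpectralEB

/-! ### From the density on the line to the prior on the circle. -/

namespace SpectralEB

variable {L : ℝ} {p₀ : ℝ → ℝ}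

lemma IsPrior.measurable (hp : IsPrior L p₀) : Measurable p₀ := by
  classical
  have h : p₀ = (Set.Icc (-L) L).piecewise p₀ 0 := by
    funext x
    by_cases hx : x ∈ Set.Icc (-L) L
    · rw [Set.piecewise_eq_of_mem _ _ _ hx]
    · rw [Set.piecewise_eq_of_notMem _ _ _ hx, hp.support x hx]; rfl
  rw [h]
  exact ContinuousOn.measurable_piecewise hp.uniformCont.continuousOn continuousOn_const
    measurableSet_Icc

lemma IsPrior.integrable (hp : IsPrior L p₀) : Integrable p₀ :=
  Integrable.of_integral_ne_zero (by rw [hp.integral_eq_one]; norm_num)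

lemma IsPrior.lintegral_eq_one (hp : IsPrior L p₀) : ∫⁻ x, ENNReal.ofReal (p₀ x) = 1 := by
  rw [← ofReal_integral_eq_lintegral_ofReal hp.integrable (Eventually.of_forall hp.nonneg),
    hp.integral_eq_one, ENNReal.ofReal_one]

lemma measurable_periodize (hp : IsPrior L p₀) : Measurable (periodize L p₀) := by
  unfold periodize
  exact hp.measurable.comp (by fun_prop)

lemma periodize_nonneg (hp : IsPrior L p₀) (x : ℝ) : 0 ≤ periodize L p₀ x := hp.nonneg _

lemma periodize_add_zsmul (hL : 0 < L) (x : ℝ) (n : ℤ) :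
    periodize L p₀ (x + n * (2 * L)) = periodize L p₀ x := by
  unfold periodize
  have h : (x + n * (2 * L) + L) / (2 * L) = (x + L) / (2 * L) + n := by field_simp; ring
  rw [h, Int.floor_add_intCast]
  congr 1
  push_cast
  ring

lemma periodize_eq_of_mem (hL : 0 < L) {x : ℝ} (hx : x ∈ Set.Ico (-L) L) :
    periodize L p₀ x = p₀ x := by
  unfold periodize
  have h : ⌊(x + L) / (2 * L)⌋ = 0 := by
    rw [Int.floor_eq_zero_iff]
    refine ⟨div_nonneg (by linarith [hx.1]) (by linarith), ?_⟩
    rw [div_lt_one (by linarith)]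
    linarith [hx.2]
  rw [h]
  simp

/-- Only the endpoint `L` is exceptional: it is wrapped to `-L`. -/
lemma periodize_ae_eq (hL : 0 < L) :
    ∀ᵐ x, x ∈ Set.Icc (-L) L → periodize L p₀ x = p₀ x := by
  have h : ∀ᵐ x : ℝ, x ≠ L := by simp [ae_iff]
  filter_upwards [h] with x hx hm
  exact periodize_eq_of_mem hL ⟨hm.1, lt_of_le_of_ne hm.2 hx⟩

/-- The prior as a measure on the circle. -/
noncomputable def priorLaw (L : ℝ) (p₀ : ℝ → ℝ) : Measure (AddCircle (2 * L)) :=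
  (volume.withDensity fun x => ENNReal.ofReal (p₀ x)).map ((↑) : ℝ → AddCircle (2 * L))

lemma lintegral_priorLaw (hp : IsPrior L p₀) {g : AddCircle (2 * L) → ℝ≥0∞} (hg : Measurable g) :
    ∫⁻ x, g x ∂priorLaw L p₀ = ∫⁻ x : ℝ, ENNReal.ofReal (p₀ x) * g x := by
  rw [priorLaw, lintegral_map hg AddCircle.measurable_mk',
    lintegral_withDensity_eq_lintegral_mul _ hp.measurable.ennreal_ofReal
      (g := fun x : ℝ => g x) (hg.comp AddCircle.measurable_mk')]
  rfl

lemma isProbabilityMeasure_priorLaw (hp : IsPrior L p₀) :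
    IsProbabilityMeasure (priorLaw L p₀) := by
  constructor
  have := lintegral_priorLaw hp (g := fun _ => 1) measurable_const
  simpa [hp.lintegral_eq_one] using this

lemma lintegral_ofReal_mul_eq_setLIntegral (hp : IsPrior L p₀) (f : ℝ → ℝ≥0∞) :
    ∫⁻ x, ENNReal.ofReal (p₀ x) * f x = ∫⁻ x in Set.Icc (-L) L, ENNReal.ofReal (p₀ x) * f x := by
  rw [← lintegral_indicator measurableSet_Icc]
  refine lintegral_congr fun x => ?_
  by_cases hx : x ∈ Set.Icc (-L) L
  · rw [Set.indicator_of_mem hx]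
  · rw [Set.indicator_of_notMem hx, hp.support x hx, ENNReal.ofReal_zero, zero_mul]

lemma setLIntegral_Icc_eq_Ioc (f : ℝ → ℝ≥0∞) :
    ∫⁻ x in Set.Icc (-L) L, f x = ∫⁻ x in Set.Ioc (-L) (-L + 2 * L), f x := by
  rw [show -L + 2 * L = L by ring]
  exact setLIntegral_congr Ioc_ae_eq_Icc.symm

variable [hL : Fact (0 < 2 * L)]

/-- For positive times the marginal density is a heat flow. -/
lemma marginal_eq (hp : IsPrior L p₀) {t : ℝ} (ht : 0 < t) (x : ℝ) :
    marginal L p₀ t x = noisyDensity (priorLaw L p₀) t x / (2 * L) := by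
  have hL0 := pos_of_fact hL
  have := isProbabilityMeasure_priorLaw hp
  have hmeas : Measurable fun u => periodize L p₀ u * gaussianPDFReal 0 t.toNNReal (x - u) :=
    (measurable_periodize hp).mul ((measurable_gaussianPDFReal 0 _).comp (measurable_const.sub measurable_id))
  have hnn : ∀ u, 0 ≤ periodize L p₀ u * gaussianPDFReal 0 t.toNNReal (x - u) := fun u =>
    mul_nonneg (periodize_nonneg hp u) (gaussianPDFReal_nonneg _ _ _)
  have hKc : Continuous fun u : AddCircle (2 * L) =>
      heat L (fun _ => 1) t ((x : AddCircle (2 * L)) - u) / (2 * L) :=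
    ((continuous_heat_one ht).comp (continuous_const.sub continuous_id)).div_const _
  rw [marginal, if_neg ht.ne', integral_eq_lintegral_of_nonneg_ae (Eventually.of_forall hnn)
    hmeas.aestronglyMeasurable, noisyDensity_eq_integral _ ht, ← integral_div,
    integral_eq_lintegral_of_nonneg_ae (Eventually.of_forall fun u =>
      div_nonneg (heat_one_pos hL0 ht _).le hL.out.le) hKc.aestronglyMeasurable]
  congr 1
  -- Over the translates of one period the prior is constant and the Gaussians add up to the heat
  -- kernel. The factor `1 / (2 * L)` converts from normalized Haar measure to length.
  have hsum : ∀ u : ℝ, ∑' n : ℤ, ENNReal.ofReal (periodize L p₀ (u + n * (2 * L))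
      * gaussianPDFReal 0 t.toNNReal (x - (u + n * (2 * L))))
      = ENNReal.ofReal (periodize L p₀ u)
        * ENNReal.ofReal (heat L (fun _ => 1) t ((x : AddCircle (2 * L)) - u) / (2 * L)) := by
    intro u
    have h := (hasSum_heat_one hL0 ht (x - u)).div_const (2 * L)
    have hc : ∀ n : ℤ, 2 * L * gaussianPDFReal 0 t.toNNReal (x - u + n * (2 * L)) / (2 * L)
        = gaussianPDFReal 0 t.toNNReal (x - u + n * (2 * L)) := fun n =>
      mul_div_cancel_left₀ _ hL.out.ne'
    simp_rw [hc] at h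
    rw [AddCircle.coe_sub] at h
    rw [← h.tsum_eq, ENNReal.ofReal_tsum_of_nonneg (fun n => gaussianPDFReal_nonneg _ _ _)
      h.summable, ← ENNReal.tsum_mul_left, ← (Equiv.neg ℤ).tsum_eq]
    refine tsum_congr fun n => ?_
    rw [periodize_add_zsmul hL0, ENNReal.ofReal_mul (periodize_nonneg hp u)]
    congr 3
    simp only [Equiv.neg_apply]
    push_cast
    ring
  rw [lintegral_eq_lintegral_tsum_translates hL.out (-L) hmeas.ennreal_ofReal,
    ← setLIntegral_Icc_eq_Ioc]
  simp_rw [hsum]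
  rw [lintegral_priorLaw hp (g := fun u => ENNReal.ofReal
    (heat L (fun _ => 1) t ((x : AddCircle (2 * L)) - u) / (2 * L)))
    hKc.measurable.ennreal_ofReal, lintegral_ofReal_mul_eq_setLIntegral hp]
  refine setLIntegral_congr_fun_ae measurableSet_Icc ?_
  filter_upwards [periodize_ae_eq (p₀ := p₀) hL0] with u hu hm
  rw [hu hm]

/-- The image of `marginalLaw` on the circle. -/
lemma marginalLaw_preimage (hp : IsPrior L p₀) {t : ℝ} (ht : 0 ≤ t)
    {A : Set (AddCircle (2 * L))} (hA : MeasurableSet A) :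
    marginalLaw L p₀ t (((↑) : ℝ → AddCircle (2 * L)) ⁻¹' A) = noisyLaw (priorLaw L p₀) t A := by
  have hL0 := pos_of_fact hL
  have := isProbabilityMeasure_priorLaw hp
  have hA' : MeasurableSet (((↑) : ℝ → AddCircle (2 * L)) ⁻¹' A) := AddCircle.measurable_mk' hA
  have hind : Measurable (A.indicator (fun _ => (1 : ℝ≥0∞))) := measurable_const.indicator hA
  have h1 : marginalLaw L p₀ t (((↑) : ℝ → AddCircle (2 * L)) ⁻¹' A)
      = ∫⁻ x in Set.Icc (-L) L, ENNReal.ofReal (marginal L p₀ t x)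
        * A.indicator (fun _ => 1) (x : AddCircle (2 * L)) := by
    rw [marginalLaw, withDensity_apply _ hA', ← lintegral_indicator hA']
    refine lintegral_congr fun x => ?_
    by_cases hx : (x : AddCircle (2 * L)) ∈ A
    · rw [Set.indicator_of_mem (show x ∈ ((↑) : ℝ → AddCircle (2 * L)) ⁻¹' A from hx),
        Set.indicator_of_mem hx, mul_one]
    · rw [Set.indicator_of_notMem (show x ∉ ((↑) : ℝ → AddCircle (2 * L)) ⁻¹' A from hx),
        Set.indicator_of_notMem hx, mul_zero]
  rw [h1]
  rcases ht.eq_or_lt with rfl | ht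
  · rw [noisyLaw_zero, ← lintegral_indicator_one hA, lintegral_priorLaw hp
      (g := A.indicator 1) hind, lintegral_ofReal_mul_eq_setLIntegral hp]
    refine setLIntegral_congr_fun_ae measurableSet_Icc ?_
    filter_upwards [periodize_ae_eq (p₀ := p₀) hL0] with u hu hm
    rw [marginal, if_pos rfl, hu hm]
    rfl
  · simp_rw [marginal_eq hp ht]
    rw [setLIntegral_Icc_eq_Ioc, AddCircle.lintegral_preimage (2 * L) (-L) (fun x =>
      ENNReal.ofReal (noisyDensity (priorLaw L p₀) t x / (2 * L)) * A.indicator (fun _ => 1) x),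
      lintegral_volume_eq, noisyLaw_eq_withDensity _ ht, withDensity_apply _ hA,
      ← lintegral_indicator hA, ← lintegral_const_mul (ENNReal.ofReal (2 * L))
      (f := fun x => ENNReal.ofReal (noisyDensity (priorLaw L p₀) t x / (2 * L))
        * A.indicator (fun _ => 1) x)
      (((continuous_noisyDensity _ ht).div_const _).measurable.ennreal_ofReal.mul hind)]
    refine lintegral_congr fun x => ?_
    rw [← mul_assoc, ← ENNReal.ofReal_mul hL.out.le, mul_div_cancel₀ _ hL.out.ne']
    by_cases hx : x ∈ A
    · simp [hx]
    · simp [hx]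

end SpectralEB

/-! ### The law of large numbers for the observations. -/

namespace SpectralEB

/-- The weak law of large numbers for independent, centred, uniformly bounded variables. -/
lemma tendsto_measure_le_abs_avg {Ω : Type*} [MeasurableSpace Ω] {μ : Measure Ω}
    [IsProbabilityMeasure μ] {Y : ℕ → Ω → ℝ} (hY : ∀ i, Measurable (Y i))
    (hind : iIndepFun Y μ) (hmean : ∀ i, ∫ ω, Y i ω ∂μ = 0) {C : ℝ} (hC : ∀ i ω, |Y i ω| ≤ C)
    {δ : ℝ} (hδ : 0 < δ) :
    Tendsto (fun n => μ {ω | δ ≤ |avg n fun i => Y i ω|}) atTop (𝓝 0) := by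
  have hLp : ∀ i, MemLp (Y i) 2 μ := fun i =>
    MemLp.of_bound (hY i).aestronglyMeasurable C (Eventually.of_forall fun ω => hC i ω)
  have hvar : ∀ i, variance (Y i) μ ≤ C ^ 2 := fun i => by
    have := variance_le_sq_of_bounded (μ := μ) (a := -C) (b := C)
      (Eventually.of_forall fun ω => abs_le.1 (hC i ω)) (hY i).aemeasurable
    linarith [show ((C - -C) / 2) ^ 2 = C ^ 2 by ring]
  -- Chebyshev's inequality; by independence the variance of the sum grows at most linearly, with no
  -- need for identical laws.
  have hbound : ∀ n : ℕ, 0 < n → μ {ω | δ ≤ |avg n fun i => Y i ω|}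
      ≤ ENNReal.ofReal (C ^ 2 / δ ^ 2 * (1 / (n : ℝ))) := by
    intro n hn
    have hn' : (0 : ℝ) < n := by exact_mod_cast hn
    set S : Ω → ℝ := ∑ i ∈ Finset.range n, Y i
    have hS : MemLp S 2 μ := memLp_finsetSum' _ fun i _ => hLp i
    have hS0 : ∫ ω, S ω ∂μ = 0 := by
      simp only [S, Finset.sum_apply]
      rw [integral_finsetSum _ fun i _ => (hLp i).integrable one_le_two]
      simp [hmean]
    have hSv : variance S μ ≤ n * C ^ 2 := by
      rw [IndepFun.variance_sum (fun i _ => hLp i) fun i _ j _ hij => hind.indepFun hij]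
      refine (Finset.sum_le_sum fun i _ => hvar i).trans (by simp)
    have hc : (0 : ℝ) < n * δ := by positivity
    have h := meas_ge_le_variance_div_sq hS hc
    rw [hS0] at h
    simp only [sub_zero] at h
    have hset : {ω | δ ≤ |avg n fun i => Y i ω|} = {ω | (n : ℝ) * δ ≤ |S ω|} := by
      ext ω
      simp only [Set.mem_ofPred_eq, avg, S, Finset.sum_apply, abs_mul, abs_inv, abs_of_pos hn']
      rw [inv_mul_eq_div, le_div_iff₀' hn']
    rw [hset]
    refine h.trans (ENNReal.ofReal_le_ofReal ?_)
    calc variance S μ / (n * δ) ^ 2 ≤ n * C ^ 2 / (n * δ) ^ 2 := by gcongr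
      _ = C ^ 2 / δ ^ 2 * (1 / (n : ℝ)) := by field_simp
  have hlim : Tendsto (fun n : ℕ => ENNReal.ofReal (C ^ 2 / δ ^ 2 * (1 / (n : ℝ)))) atTop (𝓝 0) := by
    have := (tendsto_one_div_atTop_nhds_zero_nat (𝕜 := ℝ)).const_mul (C ^ 2 / δ ^ 2)
    rw [mul_zero] at this
    simpa using ENNReal.tendsto_ofReal this
  refine tendsto_of_tendsto_of_tendsto_of_le_of_le' tendsto_const_nhds hlim
    (Eventually.of_forall fun _ => zero_le) ?_
  filter_upwards [eventually_gt_atTop 0] with n hn using hbound n hn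

variable {L tmax : ℝ} {p₀ : ℝ → ℝ}

/-- An observation as a point of the compact space `Obs L tmax`. -/
noncomputable def toObs (L : ℝ) {tmax : ℝ} (h0 : 0 ≤ tmax) (p : ℝ × ℝ) : Obs L tmax :=
  (Set.projIcc 0 tmax h0 p.1, (p.2 : AddCircle (2 * L)))

lemma measurable_toObs (h0 : 0 ≤ tmax) : Measurable (toObs L h0) :=
  (continuous_projIcc.measurable.comp measurable_fst).prodMk
    (AddCircle.measurable_mk'.comp measurable_snd)

variable [hL : Fact (0 < 2 * L)]

/-- The laws `noisyLaw P t` as a Markov kernel. -/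
noncomputable def noisyKernel (P : Measure (AddCircle (2 * L))) [IsProbabilityMeasure P] :
    Kernel (Set.Icc (0 : ℝ) tmax) (AddCircle (2 * L)) where
  toFun t := noisyLaw P t
  measurable' := by
    refine Measure.measurable_of_measurable_coe _ fun A hA => ?_
    have hm : Measurable fun q : Set.Icc (0 : ℝ) tmax × (AddCircle (2 * L) × ℝ) =>
        q.2.1 + ((Real.sqrt q.1 * q.2.2 : ℝ) : AddCircle (2 * L)) :=
      (measurable_fst.comp measurable_snd).add (AddCircle.measurable_mk'.comp (by fun_prop))
    have := measurable_measure_prodMk_left (ν := P.prod (gaussianReal 0 1)) (hm hA)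
    simp_rw [noisyLaw, Measure.map_apply (measurable_noise _) hA]
    exact this

instance isMarkovKernel_noisyKernel (P : Measure (AddCircle (2 * L))) [IsProbabilityMeasure P] :
    IsMarkovKernel (noisyKernel P : Kernel (Set.Icc (0 : ℝ) tmax) (AddCircle (2 * L))) :=
  ⟨fun t => by change IsProbabilityMeasure (noisyLaw P t); infer_instance⟩

section

variable {Ω : Type*} [MeasurableSpace Ω] {μ : Measure Ω} [IsProbabilityMeasure μ]
  {T X : ℕ → Ω → ℝ}

/-- The joint law of an observation. -/
lemma IsSample.map_toObs (hTX : IsSample μ L p₀ tmax T X) (hp : IsPrior L p₀) (h0 : 0 ≤ tmax)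
    [IsProbabilityMeasure (priorLaw L p₀)] (i : ℕ) :
    μ.map (fun ω => toObs L h0 (T i ω, X i ω))
      = (μ.map fun ω => Set.projIcc 0 tmax h0 (T i ω)) ⊗ₘ noisyKernel (priorLaw L p₀) := by
  have hτ : Measurable fun ω => Set.projIcc 0 tmax h0 (T i ω) :=
    continuous_projIcc.measurable.comp (hTX.measurable_T i)
  have hobs : Measurable fun ω => toObs L h0 (T i ω, X i ω) :=
    (measurable_toObs h0).comp ((hTX.measurable_T i).prodMk (hTX.measurable_X i))
  have := Measure.isProbabilityMeasure_map (μ := μ) hobs.aemeasurable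
  refine Measure.ext_prod fun {B A} hB hA => ?_
  rw [Measure.compProd_apply_prod hB hA, Measure.map_apply hobs (hB.prod hA),
    setLIntegral_map hB (Kernel.measurable_coe _ hA) hτ]
  have hB' : MeasurableSet (Set.projIcc 0 tmax h0 ⁻¹' B) := continuous_projIcc.measurable hB
  have h := hTX.condLaw i (((↑) : ℝ → AddCircle (2 * L)) ⁻¹' A) (Set.projIcc 0 tmax h0 ⁻¹' B)
    (AddCircle.measurable_mk' hA) hB'
  refine Eq.trans ?_ (h.trans ?_)
  · rfl
  · refine lintegral_congr_ae (ae_restrict_of_ae ?_)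
    -- Almost surely the variance lies in the interval, where the projection changes nothing.
    filter_upwards [hTX.T_mem i] with ω hω
    rw [marginalLaw_preimage hp hω.1 hA]
    change noisyLaw _ _ A = noisyLaw _ (Set.projIcc 0 tmax h0 (T i ω) : ℝ) A
    rw [Set.projIcc_of_mem h0 hω]

/-- The deviation of `ψ` at an observation from its conditional mean given the variance. -/
noncomputable def deviation (P : Measure (AddCircle (2 * L))) (ψ : C(Obs L tmax, ℝ))
    (y : Obs L tmax) : ℝ :=
  ψ y - ∫ x, ψ (y.1, x) ∂noisyLaw P y.1

lemma continuous_deviation (P : Measure (AddCircle (2 * L))) [IsProbabilityMeasure P]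
    (ψ : C(Obs L tmax, ℝ)) : Continuous (deviation P ψ) :=
  ψ.continuous.sub ((continuous_integral_noisyLaw P ψ.continuous).comp continuous_fst)

lemma abs_deviation_le (P : Measure (AddCircle (2 * L))) [IsProbabilityMeasure P]
    (ψ : C(Obs L tmax, ℝ)) (y : Obs L tmax) : |deviation P ψ y| ≤ 2 * ‖ψ‖ := by
  have h1 : |ψ y| ≤ ‖ψ‖ := ψ.norm_coe_le_norm y
  have h2 : |∫ x, ψ (y.1, x) ∂noisyLaw P y.1| ≤ ‖ψ‖ := by
    have := norm_integral_le_of_norm_le_const (μ := noisyLaw P y.1) (C := ‖ψ‖)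
      (Eventually.of_forall fun x => ψ.norm_coe_le_norm (y.1, x))
    simpa using this
  exact (abs_sub _ _).trans (by linarith)

lemma IsSample.integral_deviation (hTX : IsSample μ L p₀ tmax T X) (hp : IsPrior L p₀)
    (h0 : 0 ≤ tmax) [IsProbabilityMeasure (priorLaw L p₀)] (ψ : C(Obs L tmax, ℝ)) (i : ℕ) :
    ∫ ω, deviation (priorLaw L p₀) ψ (toObs L h0 (T i ω, X i ω)) ∂μ = 0 := by
  have hτ : Measurable fun ω => Set.projIcc 0 tmax h0 (T i ω) :=
    continuous_projIcc.measurable.comp (hTX.measurable_T i)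
  have hobs : Measurable fun ω => toObs L h0 (T i ω, X i ω) :=
    (measurable_toObs h0).comp ((hTX.measurable_T i).prodMk (hTX.measurable_X i))
  have := Measure.isProbabilityMeasure_map (μ := μ) hτ.aemeasurable
  have hc := continuous_deviation (priorLaw L p₀) ψ
  have hψ : ∀ t : Set.Icc (0 : ℝ) tmax, Integrable (fun x => ψ (t, x)) (noisyLaw (priorLaw L p₀) t) :=
    fun t => integrable_continuous (ψ.continuous.comp (Continuous.prodMk_right t))
  rw [← integral_map hobs.aemeasurable hc.aestronglyMeasurable, hTX.map_toObs hp h0,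
    Measure.integral_compProd (integrable_obs _ hc)]
  refine integral_eq_zero_of_ae (Eventually.of_forall fun t => ?_)
  change ∫ x, (ψ (t, x) - ∫ x, ψ (t, x) ∂noisyLaw (priorLaw L p₀) t)
    ∂noisyLaw (priorLaw L p₀) t = 0
  rw [integral_sub (hψ t) (integrable_const _)]
  simp

/-- The law of large numbers for the deviations. -/
lemma IsSample.tendsto_avg_deviation (hTX : IsSample μ L p₀ tmax T X) (hp : IsPrior L p₀)
    (h0 : 0 ≤ tmax) [IsProbabilityMeasure (priorLaw L p₀)] (ψ : C(Obs L tmax, ℝ))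
    {δ : ℝ} (hδ : 0 < δ) :
    Tendsto (fun n => μ {ω | δ ≤ |avg n fun i =>
      deviation (priorLaw L p₀) ψ (toObs L h0 (T i ω, X i ω))|}) atTop (𝓝 0) := by
  have hm : Measurable fun p : ℝ × ℝ => deviation (priorLaw L p₀) ψ (toObs L h0 p) :=
    (continuous_deviation _ ψ).measurable.comp (measurable_toObs h0)
  exact tendsto_measure_le_abs_avg
    (fun i => hm.comp ((hTX.measurable_T i).prodMk (hTX.measurable_X i)))
    (hTX.indep.comp (fun _ => _) fun _ => hm) (hTX.integral_deviation hp h0 ψ)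
    (fun i ω => abs_deviation_le _ ψ _) hδ

end

end SpectralEB

/-! ### The sieve as a family of mixtures. -/

namespace SpectralEB

variable {L : ℝ}

/-- The mass at the node `ν` of the measure given by the node values `f`. -/
noncomputable def nodeMass (L : ℝ) (N : ℕ) (f : ℤ → ℝ) (ν : ℤ) : ℝ :=
  2 * L / (2 * N + 1) * f ν

/-- The measure on the circle given by the node values `f`. -/
noncomputable def sieveLaw (L : ℝ) (N : ℕ) (f : ℤ → ℝ) : Measure (AddCircle (2 * L)) :=
  ∑ ν ∈ idx N, ENNReal.ofReal (nodeMass L N f ν) • Measure.dirac (node L N ν)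

lemma nodeMass_nonneg {N : ℕ} {f : ℤ → ℝ} (hL : 0 < L) (hf : f ∈ sieve L N) {ν : ℤ}
    (hν : ν ∈ idx N) : 0 ≤ nodeMass L N f ν :=
  mul_nonneg (by positivity) (hf.1 ν hν)

/-- The Fejér mixture given by the node values `f`. -/
noncomputable def nodeMix (L : ℝ) (N : ℕ) (f : ℤ → ℝ) (t : ℝ) (x : AddCircle (2 * L)) : ℝ :=
  ∑ ν ∈ idx N, nodeMass L N f ν * fejerHeat L N t (x - node L N ν)

lemma sum_nodeMass {N : ℕ} {f : ℤ → ℝ} (hf : f ∈ sieve L N) : ∑ ν ∈ idx N, nodeMass L N f ν = 1 := by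
  simp only [nodeMass, ← Finset.mul_sum]
  exact hf.2

lemma nodeMix_convex (N : ℕ) (f g : ℤ → ℝ) (s t : ℝ) (x : AddCircle (2 * L)) :
    nodeMix L N (fun ν => (1 - s) * f ν + s * g ν) t x
      = (1 - s) * nodeMix L N f t x + s * nodeMix L N g t x := by
  simp only [nodeMix, nodeMass, Finset.mul_sum, ← Finset.sum_add_distrib]
  exact Finset.sum_congr rfl fun ν _ => by ring

lemma sieve_convex {N : ℕ} {f g : ℤ → ℝ} (hf : f ∈ sieve L N) (hg : g ∈ sieve L N) {s : ℝ}
    (hs0 : 0 ≤ s) (hs1 : s ≤ 1) : (fun ν => (1 - s) * f ν + s * g ν) ∈ sieve L N := by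
  refine ⟨fun ν hν => add_nonneg (mul_nonneg (sub_nonneg.2 hs1) (hf.1 ν hν))
    (mul_nonneg hs0 (hg.1 ν hν)), ?_⟩
  rw [Finset.sum_add_distrib, ← Finset.mul_sum, ← Finset.mul_sum]
  linear_combination (1 - s) * hf.2 + s * hg.2

lemma fourier_neg_node (hL : 0 < L) (N : ℕ) (k ν : ℤ) :
    (fourier (-k) (node L N ν) : ℂ)
      = Complex.exp (-(2 * Real.pi / (2 * (N : ℂ) + 1)) * Complex.I * k * ν) := by
  rw [node, fourier_coe_apply]
  congr 1
  have h1 : (L : ℂ) ≠ 0 := by exact_mod_cast hL.ne'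
  have h2 : (2 * (N : ℂ) + 1) ≠ 0 := by exact_mod_cast (by positivity : (2 * (N : ℝ) + 1) ≠ 0)
  push_cast
  field_simp

lemma fourier_coe_eq_exp (k : ℤ) (x : ℝ) :
    (fourier k (x : AddCircle (2 * L)) : ℂ)
      = Complex.exp (Complex.I * ((Real.pi * k / L * x : ℝ) : ℂ)) := by
  rw [fourier_coe_apply]
  congr 1
  push_cast
  rw [mul_assoc 2, mul_assoc 2, mul_assoc 2, mul_div_mul_left _ _ two_ne_zero]
  ring

/-- The Cesàro model is a Fejér mixture. -/
lemma cesaro_eq_nodeMix (hL : 0 < L) (N : ℕ) (f : ℤ → ℝ) (t x : ℝ) :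
    cesaro L N f t x = nodeMix L N f t x / (2 * L) := by
  have h2 : (2 * (N : ℝ) + 1) ≠ 0 := by positivity
  -- Exchanging nodes and frequencies exposes the discrete Fourier transform; the two sides then
  -- agree term by term.
  have hswap : nodeMix L N f t x = ∑ k ∈ idx N, ∑ ν ∈ idx N, nodeMass L N f ν *
      (cesaroWeight N k * (decay L t k *
        (fourier k (x : AddCircle (2 * L)) * fourier (-k) (node L N ν) : ℂ).re)) := by
    rw [nodeMix, Finset.sum_comm]
    refine Finset.sum_congr rfl fun ν _ => ?_
    rw [fejerHeat_eq_sum, Finset.mul_sum]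
    simp_rw [fourier_sub_apply]
  rw [hswap, Finset.sum_div, cesaro, Complex.re_sum]
  refine Finset.sum_congr rfl fun k hk => ?_
  rw [cesaroWeight_of_mem hk, dft, ← fourier_coe_eq_exp, mul_assoc, mul_assoc, Complex.re_ofReal_mul,
    Finset.mul_sum, Finset.sum_mul, Complex.re_sum, Finset.mul_sum, Finset.sum_div]
  refine Finset.sum_congr rfl fun ν _ => ?_
  rw [← fourier_neg_node hL, nodeMass]
  have hc : (1 / (2 * (N : ℂ) + 1)) * ((f ν : ℂ) * fourier (-k) (node L N ν))
      * ((Real.exp (-(Real.pi * k / L) ^ 2 * t / 2) : ℂ) * fourier k (x : AddCircle (2 * L)))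
      = ((f ν / (2 * N + 1) * decay L t k : ℝ) : ℂ)
        * (fourier k (x : AddCircle (2 * L)) * fourier (-k) (node L N ν)) := by
    rw [decay]
    push_cast
    ring
  rw [hc, Complex.re_ofReal_mul]
  field_simp

/-- A full geometric sum over powers of a `(2N + 1)`-th root of unity, which is nontrivial because
`0 < |k| ≤ N`. -/
lemma sum_fourier_neg_node (hL : 0 < L) {N : ℕ} {k : ℤ} (hk : k ∈ idx N) (h0 : k ≠ 0) :
    ∑ ν ∈ idx N, (fourier (-k) (node L N ν) : ℂ) = 0 := by
  have h2 : (2 * (N : ℂ) + 1) ≠ 0 := by exact_mod_cast (by positivity : (2 * (N : ℝ) + 1) ≠ 0)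
  set a : ℂ := -(2 * Real.pi / (2 * (N : ℂ) + 1)) * Complex.I * k with ha
  have hz1 : Complex.exp a ≠ 1 := by
    intro h
    obtain ⟨m, hm⟩ := Complex.exp_eq_one_iff.1 h
    have h3 : -(k : ℂ) = m * (2 * (N : ℂ) + 1) := by
      have hpi := Complex.two_pi_I_ne_zero
      apply mul_right_cancel₀ hpi
      rw [ha] at hm
      field_simp at hm ⊢
      linear_combination hm
    have h4 : -k = m * (2 * (N : ℤ) + 1) := by exact_mod_cast h3
    rw [Finset.mem_Icc] at hk
    have hm0 : m ≠ 0 := by rintro rfl; apply h0; linarith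
    rcases lt_or_gt_of_ne hm0 with hm | hm <;> nlinarith
  have hzp : Complex.exp a ^ (2 * N + 1) = 1 := by
    rw [← Complex.exp_nat_mul, Complex.exp_eq_one_iff]
    refine ⟨-k, ?_⟩
    rw [ha]
    push_cast
    field_simp
  have hmap : idx N = (Finset.range (2 * N + 1)).image fun j : ℕ => (j : ℤ) - N := by
    ext ν
    simp only [Finset.mem_Icc, Finset.mem_image, Finset.mem_range]
    constructor
    · intro h
      exact ⟨(ν + N).toNat, by omega, by omega⟩
    · rintro ⟨j, hj, rfl⟩
      omega
  rw [hmap, Finset.sum_image fun i _ j _ h => by simpa using h]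
  have : ∀ j : ℕ, (fourier (-k) (node L N ((j : ℤ) - N)) : ℂ)
      = Complex.exp (-(a * N)) * Complex.exp a ^ j := by
    intro j
    rw [fourier_neg_node hL, ← Complex.exp_nat_mul, ← Complex.exp_add]
    congr 1
    push_cast
    ring
  simp_rw [this]
  rw [← Finset.mul_sum, geom_sum_eq hz1, hzp]
  simp

/-- The node values of the uniform density. -/
lemma const_mem_sieve (hL : 0 < L) (N : ℕ) : (fun _ => 1 / (2 * L)) ∈ sieve L N := by
  refine ⟨fun _ _ => by positivity, ?_⟩
  have hc : (idx N).card = 2 * N + 1 := by simp [idx]; omega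
  rw [Finset.sum_const, hc, nsmul_eq_mul]
  push_cast
  field_simp

/-- Equally weighted nodes annihilate every nonzero frequency of the kernel. The uniform density is
thus an exact member of the sieve, and the competitor that keeps the fitted density from
degenerating. -/
lemma nodeMix_const (hL : 0 < L) (N : ℕ) (t : ℝ) (x : AddCircle (2 * L)) :
    nodeMix L N (fun _ => 1 / (2 * L)) t x = 1 := by
  have hc : (idx N).card = 2 * N + 1 := by simp [idx]; omega
  have h2 : (2 * (N : ℝ) + 1) ≠ 0 := by positivity
  have hm : ∀ ν, nodeMass L N (fun _ => 1 / (2 * L)) ν = 1 / (2 * N + 1) := fun ν => by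
    rw [nodeMass]; field_simp
  simp only [nodeMix, hm, ← Finset.mul_sum, fejerHeat_eq_sum]
  rw [Finset.sum_comm, Finset.sum_eq_single 0]
  · have h0 : ∀ z : AddCircle (2 * L), (fourier 0 z : ℂ).re = 1 := fun z => by simp
    simp only [h0]
    rw [Finset.sum_const, hc, cesaroWeight_of_mem (by simp [idx])]
    simp [decay]
    field_simp
  · intro k hk h0
    simp_rw [fourier_sub_apply]
    rw [← Finset.mul_sum, ← Finset.mul_sum, ← Complex.re_sum, ← Finset.mul_sum,
      sum_fourier_neg_node hL hk h0]
    simp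
  · intro h
    simp [idx] at h

/-- The node values of a unit mass at the node `ν`. -/
lemma single_mem_sieve (hL : 0 < L) {N : ℕ} {ν : ℤ} (hν : ν ∈ idx N) :
    (Pi.single ν ((2 * N + 1) / (2 * L)) : ℤ → ℝ) ∈ sieve L N := by
  have h2 : (2 * (N : ℝ) + 1) ≠ 0 := by positivity
  refine ⟨fun κ _ => ?_, ?_⟩
  · by_cases h : κ = ν
    · subst h; rw [Pi.single_eq_same]; positivity
    · rw [Pi.single_eq_of_ne h]
  · rw [Finset.sum_pi_single', if_pos hν]
    field_simp

lemma nodeMix_single (hL : 0 < L) {N : ℕ} {ν : ℤ} (hν : ν ∈ idx N) (t : ℝ)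
    (x : AddCircle (2 * L)) :
    nodeMix L N (Pi.single ν ((2 * N + 1) / (2 * L))) t x = fejerHeat L N t (x - node L N ν) := by
  have h2 : (2 * (N : ℝ) + 1) ≠ 0 := by positivity
  rw [nodeMix, Finset.sum_eq_single ν (fun κ _ h => by simp [nodeMass, h]) (absurd hν)]
  rw [nodeMass, Pi.single_eq_same]
  field_simp

lemma nodeMix_nonneg (hL : 0 < L) {N : ℕ} {f : ℤ → ℝ} (hf : f ∈ sieve L N) {t : ℝ} (ht : 0 ≤ t)
    (x : AddCircle (2 * L)) : 0 ≤ nodeMix L N f t x :=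
  Finset.sum_nonneg fun _ hν => mul_nonneg (nodeMass_nonneg hL hf hν)
    (fejerHeat_nonneg hL N ht _)

lemma logLik_eq_coe {N n : ℕ} {t x : ℕ → ℝ} {f : ℤ → ℝ}
    (h : ∀ i < n, 0 < cesaro L N f (t i) (x i)) :
    logLik L N n t x f
      = ((∑ i ∈ Finset.range n, Real.log (cesaro L N f (t i) (x i)) : ℝ) : EReal) := by
  have hs : ∀ (s : Finset ℕ) (u : ℕ → ℝ), ((∑ i ∈ s, u i : ℝ) : EReal) = ∑ i ∈ s, (u i : EReal) :=
    fun s u => map_sum (⟨⟨(↑), EReal.coe_zero⟩, EReal.coe_add⟩ : ℝ →+ EReal) u s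
  rw [logLik, hs]
  exact Finset.sum_congr rfl fun i hi => ENNReal.log_ofReal_of_pos (h i (Finset.mem_range.1 hi))

lemma cesaro_pos_of_logLik_ne_bot {N n : ℕ} {t x : ℕ → ℝ} {f : ℤ → ℝ}
    (h : logLik L N n t x f ≠ ⊥) {i : ℕ} (hi : i < n) : 0 < cesaro L N f (t i) (x i) := by
  by_contra hle
  refine h ?_
  rw [logLik, ← Finset.add_sum_erase _ _ (Finset.mem_range.2 hi), ENNReal.log_ofReal,
    if_pos (not_lt.1 hle), EReal.bot_add]

/-- The first-order optimality conditions of a maximizer of a log-likelihood. -/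
lemma sum_div_le_of_forall_sum_log_le {n : ℕ} {a b : ℕ → ℝ} (ha : ∀ i < n, 0 < a i)
    (hb : ∀ i < n, 0 ≤ b i)
    (h : ∀ s : ℝ, 0 < s → s < 1 → ∑ i ∈ Finset.range n, Real.log ((1 - s) * a i + s * b i)
      ≤ ∑ i ∈ Finset.range n, Real.log (a i)) :
    ∑ i ∈ Finset.range n, b i / a i ≤ n := by
  have key : ∀ s : ℝ, 0 < s → s < 1 →
      ∑ i ∈ Finset.range n, (b i - a i) / ((1 - s) * a i + s * b i) ≤ 0 := by
    intro s hs0 hs1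
    -- The inequality `log y ≥ 1 - 1 / y` at the ratio of mixed to original value replaces
    -- differentiation. Dividing by `s` and letting `s → 0` gives the condition.
    have h1 : s * ∑ i ∈ Finset.range n, (b i - a i) / ((1 - s) * a i + s * b i)
        ≤ ∑ i ∈ Finset.range n, Real.log ((1 - s) * a i + s * b i)
          - ∑ i ∈ Finset.range n, Real.log (a i) := by
      rw [Finset.mul_sum, ← Finset.sum_sub_distrib]
      refine Finset.sum_le_sum fun i hi => ?_
      have hai := ha i (Finset.mem_range.1 hi)
      have hm : 0 < (1 - s) * a i + s * b i :=
        add_pos_of_pos_of_nonneg (mul_pos (sub_pos.2 hs1) hai)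
          (mul_nonneg hs0.le (hb i (Finset.mem_range.1 hi)))
      rw [← Real.log_div hm.ne' hai.ne']
      refine le_trans (le_of_eq ?_) (Real.one_sub_inv_le_log_of_pos (div_pos hm hai))
      rw [inv_div, one_sub_div hm.ne', mul_div_assoc']
      congr 1
      ring
    have h2 := h1.trans (sub_nonpos.2 (h s hs0 hs1))
    exact nonpos_of_mul_nonpos_right h2 hs0
  have hlim : Tendsto (fun s : ℝ => ∑ i ∈ Finset.range n, (b i - a i) / ((1 - s) * a i + s * b i))
      (𝓝[>] 0) (𝓝 (∑ i ∈ Finset.range n, (b i - a i) / a i)) := by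
    refine tendsto_finsetSum _ fun i hi => ?_
    refine Tendsto.div tendsto_const_nhds ?_ (ha i (Finset.mem_range.1 hi)).ne'
    have : Continuous fun s : ℝ => (1 - s) * a i + s * b i := by fun_prop
    simpa using (this.tendsto 0).mono_left nhdsWithin_le_nhds
  have h0 : ∑ i ∈ Finset.range n, (b i - a i) / a i ≤ 0 := by
    refine le_of_tendsto hlim ?_
    filter_upwards [Ioo_mem_nhdsGT (zero_lt_one' ℝ)] with s hs using key s hs.1 hs.2
  have h1 : ∑ i ∈ Finset.range n, (b i - a i) / a i = ∑ i ∈ Finset.range n, b i / a i - n := by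
    rw [Finset.sum_congr rfl fun i hi => show (b i - a i) / a i = b i / a i - 1 by
      rw [sub_div, div_self (ha i (Finset.mem_range.1 hi)).ne']]
    simp
  linarith

/-! ### First-order conditions for the maximum likelihood estimate. -/

section

variable {N n : ℕ} {t x : ℕ → ℝ} {f : ℤ → ℝ}

/-- The uniform density has finite log-likelihood, so the maximum is not `⊥` and no observation has
fitted value zero. -/
lemma IsSieveMLE.nodeMix_pos (hL : 0 < L) (hf : IsSieveMLE L N n t x f) {i : ℕ} (hi : i < n) :
    0 < nodeMix L N f (t i) (x i) := by
  have hu : ∀ i < n, 0 < cesaro L N (fun _ => 1 / (2 * L)) (t i) (x i) := fun i _ => by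
    rw [cesaro_eq_nodeMix hL, nodeMix_const hL]; positivity
  have h := hf.2 _ (const_mem_sieve hL N)
  rw [logLik_eq_coe hu] at h
  have h1 := cesaro_pos_of_logLik_ne_bot (ne_of_gt ((EReal.bot_lt_coe _).trans_le h)) hi
  rw [cesaro_eq_nodeMix hL] at h1
  exact (div_pos_iff_of_pos_right (by positivity)).1 h1

/-- The sieve is convex and the model affine in the node values, so the likelihood cannot increase
along the segment towards `g`. All later conditions are special choices of `g`. -/
lemma IsSieveMLE.avg_div_le_one (hL : 0 < L) (hf : IsSieveMLE L N n t x f) (hn : 0 < n)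
    (ht : ∀ i < n, 0 ≤ t i) {g : ℤ → ℝ} (hg : g ∈ sieve L N) :
    avg n (fun i => nodeMix L N g (t i) (x i) / nodeMix L N f (t i) (x i)) ≤ 1 := by
  have hn' : (0 : ℝ) < n := by exact_mod_cast hn
  rw [avg, inv_mul_le_iff₀ hn', mul_one]
  have ha : ∀ i < n, 0 < nodeMix L N f (t i) (x i) := fun i hi => hf.nodeMix_pos hL hi
  have hb : ∀ i < n, 0 ≤ nodeMix L N g (t i) (x i) := fun i hi => nodeMix_nonneg hL hg (ht i hi) _
  refine sum_div_le_of_forall_sum_log_le ha hb fun s hs0 hs1 => ?_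
  have hpos : ∀ i < n, 0 < (1 - s) * nodeMix L N f (t i) (x i) + s * nodeMix L N g (t i) (x i) :=
    fun i hi => add_pos_of_pos_of_nonneg (mul_pos (sub_pos.2 hs1) (ha i hi))
      (mul_nonneg hs0.le (hb i hi))
  have h := hf.2 _ (sieve_convex hf.1 hg hs0.le hs1.le)
  rw [logLik_eq_coe fun i hi => by
      rw [cesaro_eq_nodeMix hL, nodeMix_convex]; exact div_pos (hpos i hi) (by positivity),
    logLik_eq_coe fun i hi => by
      rw [cesaro_eq_nodeMix hL]; exact div_pos (ha i hi) (by positivity), EReal.coe_le_coe_iff] at h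
  simp only [cesaro_eq_nodeMix hL, nodeMix_convex] at h
  have h2 : (2 * L) ≠ 0 := by positivity
  rw [Finset.sum_congr rfl fun i hi => Real.log_div (hpos i (Finset.mem_range.1 hi)).ne' h2,
    Finset.sum_congr rfl fun i hi => Real.log_div (ha i (Finset.mem_range.1 hi)).ne' h2,
    Finset.sum_sub_distrib, Finset.sum_sub_distrib] at h
  linarith

lemma IsSieveMLE.score_le_one (hL : 0 < L) (hf : IsSieveMLE L N n t x f) (hn : 0 < n)
    (ht : ∀ i < n, 0 ≤ t i) {ν : ℤ} (hν : ν ∈ idx N) :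
    avg n (fun i => fejerHeat L N (t i) ((x i : AddCircle (2 * L)) - node L N ν)
      / nodeMix L N f (t i) (x i)) ≤ 1 := by
  have h := hf.avg_div_le_one hL hn ht (single_mem_sieve hL hν)
  simpa only [nodeMix_single hL hν] using h

lemma IsSieveMLE.avg_inv_le_one (hL : 0 < L) (hf : IsSieveMLE L N n t x f) (hn : 0 < n)
    (ht : ∀ i < n, 0 ≤ t i) :
    avg n (fun i => 1 / nodeMix L N f (t i) (x i)) ≤ 1 := by
  have h := hf.avg_div_le_one hL hn ht (const_mem_sieve hL N)
  simpa only [nodeMix_const hL] using h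

lemma avg_finsetSum {ι : Type*} (s : Finset ι) (n : ℕ) (F : ι → ℕ → ℝ) :
    avg n (fun i => ∑ ν ∈ s, F ν i) = ∑ ν ∈ s, avg n (F ν) := by
  simp only [avg, ← Finset.mul_sum]
  rw [Finset.sum_comm]

/-- Complementary slackness at a maximum likelihood estimate. -/
lemma IsSieveMLE.nodeMass_mul_score (hL : 0 < L) (hf : IsSieveMLE L N n t x f) (hn : 0 < n)
    (ht : ∀ i < n, 0 ≤ t i) {ν : ℤ} (hν : ν ∈ idx N) :
    nodeMass L N f ν * avg n (fun i => fejerHeat L N (t i) ((x i : AddCircle (2 * L)) - node L N ν)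
      / nodeMix L N f (t i) (x i)) = nodeMass L N f ν := by
  set S : ℤ → ℝ := fun ν => avg n (fun i =>
    fejerHeat L N (t i) ((x i : AddCircle (2 * L)) - node L N ν) / nodeMix L N f (t i) (x i)) with hS
  have hm : ∀ κ ∈ idx N, 0 ≤ nodeMass L N f κ := fun κ hκ => nodeMass_nonneg hL hf.1 hκ
  -- Weighted by the masses, the kernels add up to the fitted density, which cancels. Scores at most
  -- one with weighted mean one must equal one wherever there is mass.
  have htot : ∑ κ ∈ idx N, nodeMass L N f κ * S κ = 1 := by
    simp only [hS, ← avg_const_mul]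
    rw [← avg_finsetSum, ← avg_const hn 1]
    refine avg_congr fun i hi => ?_
    simp only [← mul_div_assoc]
    rw [← Finset.sum_div]
    exact div_self (hf.nodeMix_pos hL hi).ne'
  have hz : ∑ κ ∈ idx N, nodeMass L N f κ * (1 - S κ) = 0 := by
    simp only [mul_sub, mul_one, Finset.sum_sub_distrib, htot, sum_nodeMass hf.1, sub_self]
  have := (Finset.sum_eq_zero_iff_of_nonneg fun κ hκ => mul_nonneg (hm κ hκ)
    (sub_nonneg.2 (hf.score_le_one hL hn ht hκ))).1 hz ν hν
  linarith

variable [hL : Fact (0 < 2 * L)]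

lemma integral_sieveLaw {E : Type*} [NormedAddCommGroup E] [NormedSpace ℝ E] [CompleteSpace E]
    (hf : f ∈ sieve L N) (h : AddCircle (2 * L) → E) :
    ∫ θ, h θ ∂sieveLaw L N f = ∑ ν ∈ idx N, nodeMass L N f ν • h (node L N ν) := by
  have hL0 := pos_of_fact hL
  rw [sieveLaw, integral_finsetSum_measure fun ν _ =>
    (integrable_dirac (by finiteness)).smul_measure ENNReal.ofReal_ne_top]
  refine Finset.sum_congr rfl fun ν hν => ?_
  rw [integral_smul_measure, integral_dirac,
    ENNReal.toReal_ofReal (nodeMass_nonneg hL0 hf hν)]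

lemma isProbabilityMeasure_sieveLaw (hf : f ∈ sieve L N) :
    IsProbabilityMeasure (sieveLaw L N f) := by
  have hL0 := pos_of_fact hL
  constructor
  simp only [sieveLaw, Measure.coe_finsetSum, Finset.sum_apply, Measure.smul_apply, measure_univ,
    smul_eq_mul, mul_one]
  rw [← ENNReal.ofReal_sum_of_nonneg fun ν hν => nodeMass_nonneg hL0 hf hν,
    sum_nodeMass hf, ENNReal.ofReal_one]

lemma fejerMix_sieveLaw (hf : f ∈ sieve L N) {h : AddCircle (2 * L) → ℝ} (hh : Continuous h)
    (s : ℝ) (z : AddCircle (2 * L)) :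
    fejerMix N (sieveLaw L N f) h s z = ∑ ν ∈ idx N,
      nodeMass L N f ν * (h (node L N ν) * fejerHeat L N s (z - node L N ν)) := by
  have := isProbabilityMeasure_sieveLaw hf
  rw [fejerMix_eq_integral _ _ hh, integral_sieveLaw hf]
  rfl

lemma nodeMix_eq_fejerMix (hf : f ∈ sieve L N) (s : ℝ) (z : AddCircle (2 * L)) :
    nodeMix L N f s z = fejerMix N (sieveLaw L N f) (fun _ => 1) s z := by
  rw [fejerMix_sieveLaw hf continuous_const, nodeMix]
  simp only [one_mul]

/-- The self-consistency equation of a maximum likelihood estimate. -/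
lemma IsSieveMLE.integral_sieveLaw_eq (hf : IsSieveMLE L N n t x f) (hn : 0 < n)
    (ht : ∀ i < n, 0 ≤ t i) {h : AddCircle (2 * L) → ℝ} (hh : Continuous h) :
    ∫ θ, h θ ∂sieveLaw L N f = avg n fun i =>
      fejerMix N (sieveLaw L N f) h (t i) (x i) / nodeMix L N f (t i) (x i) := by
  have hL0 := pos_of_fact hL
  simp only [fejerMix_sieveLaw hf.1 hh, Finset.sum_div]
  rw [integral_sieveLaw hf.1, avg_finsetSum]
  refine Finset.sum_congr rfl fun ν hν => ?_
  -- By complementary slackness each mass may be multiplied by its score, which spreads it over the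
  -- observations as a posterior weight.
  conv_lhs => rw [← hf.nodeMass_mul_score hL0 hn ht hν]
  rw [smul_eq_mul, mul_assoc, mul_comm _ (h _), ← avg_const_mul, ← avg_const_mul]
  exact avg_congr fun i _ => by ring

end

end SpectralEB

/-! ### Convergence in probability, and uniform convergence of densities and derivatives. -/

namespace SpectralEB

/-- Convergence in probability follows from convergence along all sequences of sample points along
which countably many statistics, each tending to zero in probability, tend to zero. -/
lemma tendstoZeroInProb_of_forall_seq {Ω : Type*} [MeasurableSpace Ω] {μ : Measure Ω}
    {Y : ℕ → ℕ → Ω → ℝ} {G : ℕ → Set Ω} {Z : ℕ → Ω → ℝ≥0∞}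
    (hY : ∀ m, ∀ δ : ℝ, 0 < δ → Tendsto (fun n => μ {ω | δ ≤ |Y m n ω|}) atTop (𝓝 0))
    (hG : ∀ n, ∀ᵐ ω ∂μ, ω ∈ G n)
    (hZ : ∀ (n : ℕ → ℕ) (ω : ℕ → Ω), Tendsto n atTop atTop → (∀ j, 0 < n j) →
      (∀ j, ω j ∈ G (n j)) → (∀ m, Tendsto (fun j => Y m (n j) (ω j)) atTop (𝓝 0)) →
      Tendsto (fun j => Z (n j) (ω j)) atTop (𝓝 0)) :
    TendstoZeroInProb μ Z := by
  intro ε hε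
  have hlim : Tendsto (fun j : ℕ => 1 / ((j : ℝ) + 1)) atTop (𝓝 0) :=
    tendsto_one_div_add_atTop_nhds_zero_nat
  -- Otherwise each `K` yields a bad sample point at which the first `K` statistics are below `1 /
  -- (K + 1)`. Along these points every statistic tends to zero, contradicting `hZ`.
  have key : ∃ K : ℕ, ∀ n, K < n → ∀ ω ∈ G n, ε ≤ Z n ω →
      ∃ m < K, 1 / ((K : ℝ) + 1) ≤ |Y m n ω| := by
    by_contra! h
    choose n hn ω hω hε' hY' using h
    have hconv := hZ n ω (tendsto_atTop_mono (fun j => (hn j).le) tendsto_id)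
      (fun j => (Nat.zero_le j).trans_lt (hn j)) hω fun m => by
        refine squeeze_zero_norm' ?_ hlim
        filter_upwards [eventually_gt_atTop m] with j hj using (hY' j m hj).le
    exact absurd (ge_of_tendsto' hconv hε') (not_le.2 hε)
  obtain ⟨K, hK⟩ := key
  have hsum : Tendsto (fun n => ∑ m ∈ Finset.range K, μ {ω | 1 / ((K : ℝ) + 1) ≤ |Y m n ω|})
      atTop (𝓝 0) := by
    have := tendsto_finsetSum (Finset.range K) fun m _ =>
      hY m (1 / ((K : ℝ) + 1)) (by positivity)
    simpa using this
  refine tendsto_of_tendsto_of_tendsto_of_le_of_le' tendsto_const_nhds hsum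
    (Eventually.of_forall fun _ => zero_le) ?_
  filter_upwards [eventually_gt_atTop K] with n hn
  calc μ {ω | ε ≤ Z n ω}
      ≤ μ (⋃ m ∈ Finset.range K, {ω | 1 / ((K : ℝ) + 1) ≤ |Y m n ω|}) := by
        refine measure_mono_ae ?_
        filter_upwards [hG n] with ω hω hZω
        obtain ⟨m, hm, hm'⟩ := hK n hn ω hω hZω
        exact Set.mem_biUnion (Finset.mem_coe.2 (Finset.mem_range.2 hm)) hm'
    _ ≤ _ := measure_biUnion_finset_le _ _

lemma tendsto_supDist {ι : Type*} {l : Filter ι} {F : ι → ℝ → ℝ} {f : ℝ → ℝ}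
    (h : TendstoUniformly F f l) : Tendsto (fun j => supDist (F j) f) l (𝓝 0) := by
  rw [ENNReal.tendsto_nhds_zero]
  intro ε hε
  rcases eq_or_ne ε ⊤ with rfl | htop
  · exact Eventually.of_forall fun _ => le_top
  filter_upwards [Metric.tendstoUniformly_iff.1 h ε.toReal (ENNReal.toReal_pos hε.ne' htop)]
    with j hj
  refine iSup_le fun x => ENNReal.ofReal_le_of_le_toReal ?_
  rw [← Real.dist_eq, dist_comm]
  exact (hj x).le

lemma differentiable_cesaro (L : ℝ) (N : ℕ) (f : ℤ → ℝ) (t : ℝ) :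
    Differentiable ℝ (cesaro L N f t) := by
  have h : ∀ c : ℝ, Differentiable ℝ fun x : ℝ => ((c * x : ℝ) : ℂ) := fun c =>
    Complex.ofRealCLM.differentiable.comp (differentiable_id.const_mul c)
  refine Complex.reCLM.differentiable.comp (Differentiable.fun_sum fun k _ => ?_)
  exact ((h _).const_mul _).cexp.const_mul _

/-- The multiplier which turns the heat flow at time `t / 2` into the derivative of the heat flow
at time `t`. -/
noncomputable def derivCoef (L t : ℝ) (k : ℤ) : ℂ :=
  2 * Real.pi * Complex.I * k / (2 * L : ℝ) * decay L (t / 2) k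

lemma decay_half_mul_self (L t : ℝ) (k : ℤ) :
    decay L (t / 2) k * decay L (t / 2) k = decay L t k := by
  rw [decay, decay, ← Real.exp_add]
  congr 1
  ring

/-- Half of the Gaussian decay absorbs the factor `k` that differentiation produces. -/
lemma exists_norm_derivCoef_le {L : ℝ} (hL : 0 < L) {t : ℝ} (ht : 0 < t) :
    ∃ D : ℝ, ∀ k, ‖derivCoef L t k‖ ≤ D := by
  have hs := summable_pow_mul_decay hL (half_pos ht) 1
  refine ⟨Real.pi / L * ∑' k : ℤ, |(k : ℝ)| ^ 1 * decay L (t / 2) k, fun k => ?_⟩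
  have h1 : ‖derivCoef L t k‖ = Real.pi / L * (|(k : ℝ)| ^ 1 * decay L (t / 2) k) := by
    rw [derivCoef]
    simp only [norm_mul, norm_div, Complex.norm_real, Complex.norm_I, Complex.norm_ofNat,
      Complex.norm_intCast, Real.norm_eq_abs, abs_of_pos Real.pi_pos, abs_of_pos hL,
      abs_of_pos (decay_pos _ _), abs_of_pos (two_pos (α := ℝ))]
    field_simp
  rw [h1]
  exact mul_le_mul_of_nonneg_left (hs.le_tsum k fun j _ =>
    mul_nonneg (by positivity) (decay_pos _ _).le) (by positivity)

/-- Termwise differentiation. Writing the derivative as a heat flow at time `t / 2` with bounded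
coefficients lets the uniform convergence of heat flows cover derivatives as well. -/
lemma hasDerivAt_heat {L : ℝ} (hL : 0 < L) {m : ℤ → ℂ} {C t : ℝ} (hm : ∀ k, ‖m k‖ ≤ C)
    (ht : 0 < t) (x : ℝ) :
    HasDerivAt (fun y : ℝ => heat L m t (y : AddCircle (2 * L)))
      (heat L (fun k => derivCoef L t k * m k) (t / 2) x) x := by
  obtain ⟨D, hD⟩ := exists_norm_derivCoef_le hL ht
  have hterm : ∀ (k : ℤ) (y : ℝ),
      HasDerivAt (fun y : ℝ => decay L t k * (m k * fourier k (y : AddCircle (2 * L))).re)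
        (decay L (t / 2) k * (derivCoef L t k * m k * fourier k (y : AddCircle (2 * L))).re) y := by
    intro k y
    have h1 := (hasDerivAt_fourier (2 * L) k y).const_mul (m k)
    have h2 := (Complex.reCLM.hasFDerivAt.comp_hasDerivAt y h1).const_mul (decay L t k)
    convert! h2 using 1
    rw [← decay_half_mul_self L t k, mul_assoc (decay L (t / 2) k), derivCoef]
    congr 1
    simp only [Complex.reCLM_apply]
    rw [← Complex.re_ofReal_mul]
    congr 1
    ring
  have hbound : ∀ (k : ℤ) (y : ℝ), ‖decay L (t / 2) k
      * (derivCoef L t k * m k * fourier k (y : AddCircle (2 * L))).re‖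
      ≤ decay L (t / 2) k * (D * C) := by
    intro k y
    rw [Real.norm_eq_abs]
    refine (abs_heat_term_le (fun k => derivCoef L t k * m k) _ _ _).trans
      (mul_le_mul_of_nonneg_left ?_ (decay_pos _ _).le)
    rw [norm_mul]
    exact mul_le_mul (hD k) (hm k) (norm_nonneg _) ((norm_nonneg _).trans (hD k))
  exact hasDerivAt_tsum ((summable_decay hL (half_pos ht)).mul_right _) hterm hbound
    (summable_heat hL hm ht ((0 : ℝ) : AddCircle (2 * L))) x

variable {L : ℝ} [hL : Fact (0 < 2 * L)]

/-- The measure of a point of the sieve as a probability measure. -/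
noncomputable def sieveProb {N : ℕ} {f : ℤ → ℝ} (hf : f ∈ sieve L N) :
    ProbabilityMeasure (AddCircle (2 * L)) :=
  ⟨sieveLaw L N f, isProbabilityMeasure_sieveLaw hf⟩

section

variable {ι : Type*} {l : Filter ι} {N : ι → ℕ} {f : ι → ℤ → ℝ}
  {P : ProbabilityMeasure (AddCircle (2 * L))}

lemma cesaro_eq_heat {N : ℕ} {f : ℤ → ℝ} (hf : f ∈ sieve L N) (t : ℝ) :
    cesaro L N f t = fun x : ℝ => heat L (fun k => cesaroWeight N k
      * coef (sieveLaw L N f) (fun _ => 1) k) t (x : AddCircle (2 * L)) / (2 * L) := by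
  funext x
  rw [cesaro_eq_nodeMix (pos_of_fact hL), nodeMix_eq_fejerMix hf, fejerMix]

lemma norm_cesaroWeight_mul_coef_le {N : ℕ} {f : ℤ → ℝ} (hf : f ∈ sieve L N) (k : ℤ) :
    ‖(cesaroWeight N k : ℂ) * coef (sieveLaw L N f) (fun _ => 1) k‖ ≤ 1 :=
  have := isProbabilityMeasure_sieveLaw hf
  norm_cesaroWeight_mul_le (norm_coef_one_le _ k) N k

lemma tendsto_cesaroWeight_mul_coef (hf : ∀ j, f j ∈ sieve L (N j)) (hN : Tendsto N l atTop)
    (hP : Tendsto (fun j => sieveProb (hf j)) l (𝓝 P)) (k : ℤ) :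
    Tendsto (fun j => (cesaroWeight (N j) k : ℂ) * coef (sieveLaw L (N j) (f j)) (fun _ => 1) k) l
      (𝓝 (coef (P : Measure (AddCircle (2 * L))) (fun _ => 1) k)) := by
  have h1 := (Complex.continuous_ofReal.tendsto 1).comp (tendsto_cesaroWeight hN k)
  have h2 := h1.mul (tendsto_coef hP (h := fun _ => 1) continuous_const k)
  rw [Complex.ofReal_one, one_mul] at h2
  exact h2

lemma tendstoUniformly_heat_div {M : ι → ℤ → ℂ} {m : ℤ → ℂ} {C t : ℝ} (ht : 0 < t)
    (hM : ∀ j k, ‖M j k‖ ≤ C) (hm : ∀ k, ‖m k‖ ≤ C)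
    (h : ∀ k, Tendsto (fun j => M j k) l (𝓝 (m k))) (c : ℝ) :
    TendstoUniformly (fun j (x : ℝ) => heat L (M j) t (x : AddCircle (2 * L)) / c)
      (fun x : ℝ => heat L m t (x : AddCircle (2 * L)) / c) l := by
  have h1 := tendstoUniformlyOn_heat (pos_of_fact hL) ht hM hm h
  have h2 : TendstoUniformly (fun j (x : ℝ) => heat L (M j) t (x : AddCircle (2 * L)))
      (fun x : ℝ => heat L m t (x : AddCircle (2 * L))) l := by
    have := h1.comp fun x : ℝ => (t, (x : AddCircle (2 * L)))
    rw [← tendstoUniformlyOn_univ]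
    exact this.mono fun x _ => le_refl t
  simp only [div_eq_inv_mul]
  exact (uniformContinuous_const_smul c⁻¹).comp_tendstoUniformly h2

lemma tendsto_supDist_cesaro (hf : ∀ j, f j ∈ sieve L (N j)) (hN : Tendsto N l atTop)
    (hP : Tendsto (fun j => sieveProb (hf j)) l (𝓝 P)) {t : ℝ} (ht : 0 < t) :
    Tendsto (fun j => supDist (cesaro L (N j) (f j) t)
      fun x : ℝ => noisyDensity (P : Measure (AddCircle (2 * L))) t x / (2 * L)) l (𝓝 0) := by
  refine tendsto_supDist ?_
  simp_rw [cesaro_eq_heat (hf _)]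
  exact tendstoUniformly_heat_div ht (fun j => norm_cesaroWeight_mul_coef_le (hf j))
    (norm_coef_one_le _) (tendsto_cesaroWeight_mul_coef hf hN hP) _

lemma hasDerivAt_noisyDensity_div (P : Measure (AddCircle (2 * L))) [IsProbabilityMeasure P]
    {t : ℝ} (ht : 0 < t) (x : ℝ) :
    HasDerivAt (fun x : ℝ => noisyDensity P t x / (2 * L))
      (heat L (fun k => derivCoef L t k * coef P (fun _ => 1) k) (t / 2) x / (2 * L)) x :=
  (hasDerivAt_heat (pos_of_fact hL) (norm_coef_one_le P) ht x).div_const _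

lemma tendsto_supDist_deriv_cesaro (hf : ∀ j, f j ∈ sieve L (N j)) (hN : Tendsto N l atTop)
    (hP : Tendsto (fun j => sieveProb (hf j)) l (𝓝 P)) {t : ℝ} (ht : 0 < t) :
    Tendsto (fun j => supDist (deriv (cesaro L (N j) (f j) t))
      (deriv fun x : ℝ => noisyDensity (P : Measure (AddCircle (2 * L))) t x / (2 * L)))
      l (𝓝 0) := by
  obtain ⟨D, hD⟩ := exists_norm_derivCoef_le (pos_of_fact hL) ht
  have hle : ∀ {c : ℂ} (k), ‖c‖ ≤ 1 → ‖derivCoef L t k * c‖ ≤ D := fun {c} k hc => by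
    rw [norm_mul]
    exact (mul_le_of_le_one_right (norm_nonneg _) hc).trans (hD k)
  have h1 : ∀ j, deriv (cesaro L (N j) (f j) t) = fun x : ℝ => heat L (fun k => derivCoef L t k
      * (cesaroWeight (N j) k * coef (sieveLaw L (N j) (f j)) (fun _ => 1) k)) (t / 2)
        (x : AddCircle (2 * L)) / (2 * L) := fun j => funext fun x => by
    rw [cesaro_eq_heat (hf j)]
    exact ((hasDerivAt_heat (pos_of_fact hL) (norm_cesaroWeight_mul_coef_le (hf j)) ht
      x).div_const (2 * L)).deriv
  have h2 : deriv (fun x : ℝ => noisyDensity (P : Measure (AddCircle (2 * L))) t x / (2 * L))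
      = fun x : ℝ => heat L (fun k => derivCoef L t k
        * coef (P : Measure (AddCircle (2 * L))) (fun _ => 1) k) (t / 2) x / (2 * L) :=
    funext fun x => (hasDerivAt_noisyDensity_div _ ht x).deriv
  refine tendsto_supDist ?_
  simp_rw [h1, h2]
  exact tendstoUniformly_heat_div (half_pos ht)
    (fun j k => hle k (norm_cesaroWeight_mul_coef_le (hf j) k))
    (fun k => hle k (norm_coef_one_le _ k))
    (fun k => (tendsto_cesaroWeight_mul_coef hf hN hP k).const_mul _) _

end

/-- Maximum likelihood estimates converge along every sequence of sample points along which the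
deviations of a dense family of test functions tend to zero. -/
lemma tendsto_sieveProb {tmax : ℝ} (h0 : 0 ≤ tmax) {P : ProbabilityMeasure (AddCircle (2 * L))}
    {N n : ℕ → ℕ} {T X : ℕ → ℕ → ℝ} {f : ℕ → ℤ → ℝ} (hN : Tendsto N atTop atTop)
    (hn : ∀ j, 0 < n j) (hT : ∀ j i, T j i ∈ Set.Icc 0 tmax)
    (hf : ∀ j, IsSieveMLE L (N j) (n j) (T j) (X j) (f j))
    (hdev : ∀ m, Tendsto (fun j => avg (n j) fun i =>
      deviation (P : Measure (AddCircle (2 * L)))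
        (TopologicalSpace.denseSeq C(Obs L tmax, ℝ) m) (toObs L h0 (T j i, X j i))) atTop (𝓝 0)) :
    Tendsto (fun j => sieveProb (hf j).1) atTop (𝓝 P) := by
  have hL0 := pos_of_fact hL
  have hobs : ∀ j i, ((toObs L h0 (T j i, X j i)).1 : ℝ) = T j i := fun j i => by
    rw [toObs, Set.projIcc_of_mem h0 (hT j i)]
  have hobs2 : ∀ j i, (toObs L h0 (T j i, X j i)).2 = (X j i : AddCircle (2 * L)) := fun _ _ => rfl
  refine tendsto_of_first_order_conditions (n := n) (N := N)
    (y := fun j i => toObs L h0 (T j i, X j i))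
    (q := fun j i => nodeMix L (N j) (f j) (T j i) (X j i)) hN hn ?_ ?_ ?_ ?_ ?_ ?_
  · intro j i
    rw [hobs, hobs2]
    exact nodeMix_eq_fejerMix (hf j).1 _ _
  · exact fun j i hi => (hf j).nodeMix_pos hL0 hi
  · intro j ν hν
    simp only [hobs, hobs2]
    exact (hf j).score_le_one hL0 (hn j) (fun i _ => (hT j i).1) hν
  · exact fun j => (hf j).avg_inv_le_one hL0 (hn j) fun i _ => (hT j i).1
  · intro j h hh
    simp only [hobs, hobs2]
    exact (hf j).integral_sieveLaw_eq (hn j) (fun i _ => (hT j i).1) hh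
  · intro ψ
    rw [Metric.tendsto_nhds]
    intro ε hε
    -- Deviations are linear in the test function and at most twice its norm, so an approximation
    -- within `ε / 4` costs at most `ε / 2`.
    obtain ⟨m, hm⟩ := (TopologicalSpace.denseRange_denseSeq C(Obs L tmax, ℝ)).exists_dist_lt ψ
      (show 0 < ε / 4 by positivity)
    filter_upwards [Metric.tendsto_nhds.1 (hdev m) (ε / 2) (half_pos hε)] with j hj
    set φ := TopologicalSpace.denseSeq C(Obs L tmax, ℝ) m
    have hsub : ∀ y : Obs L tmax, deviation (P : Measure (AddCircle (2 * L))) (ψ - φ) y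
        = deviation (P : Measure (AddCircle (2 * L))) ψ y
          - deviation (P : Measure (AddCircle (2 * L))) φ y := by
      intro y
      have hi : ∀ χ : C(Obs L tmax, ℝ), Integrable (fun x => χ (y.1, x))
          (noisyLaw (P : Measure (AddCircle (2 * L))) y.1) :=
        fun χ => integrable_continuous (χ.continuous.comp (Continuous.prodMk_right y.1))
      simp only [deviation, ContinuousMap.sub_apply]
      rw [integral_sub (hi ψ) (hi φ)]
      ring
    have hle : |avg (n j) fun i => deviation (P : Measure (AddCircle (2 * L))) (ψ - φ)
        (toObs L h0 (T j i, X j i))| ≤ 2 * ‖ψ - φ‖ := by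
      have := abs_avg_le (n := n j) (g := fun _ => 2 * ‖ψ - φ‖)
        fun i _ => abs_deviation_le (P : Measure (AddCircle (2 * L))) (ψ - φ)
          (toObs L h0 (T j i, X j i))
      rwa [avg_const (hn j)] at this
    simp only [hsub, avg_sub] at hle
    rw [dist_eq_norm] at hm
    rw [Real.dist_eq, sub_zero] at hj ⊢
    have h1 := abs_le.1 hle
    have h2 := abs_lt.1 hj
    change |avg (n j) fun i => deviation (P : Measure (AddCircle (2 * L))) ψ
      (toObs L h0 (T j i, X j i))| < ε
    rw [abs_lt]
    constructor <;> linarith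

end SpectralEB

theorem mainTheorem9 {Ω : Type*} [MeasurableSpace Ω] (μ : Measure Ω) [IsProbabilityMeasure μ]
    (L : ℝ) (hL : 0 < L) (p₀ : ℝ → ℝ) (hp₀ : SpectralEB.IsPrior L p₀)
    (tmax : ℝ) (T X : ℕ → Ω → ℝ) (hTX : SpectralEB.IsSample μ L p₀ tmax T X)
    (N : ℕ → ℕ) (hN : Tendsto N atTop atTop)
    (fhat : ℕ → Ω → ℤ → ℝ)
    (hfhat : ∀ n, ∀ᵐ ω ∂μ,
      SpectralEB.IsSieveMLE L (N n) n (fun i => T i ω) (fun i => X i ω) (fhat n ω))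
    (t : ℝ) (ht : 0 < t) :
    Differentiable ℝ (SpectralEB.marginal L p₀ t) ∧
    (∀ n ω, Differentiable ℝ (SpectralEB.cesaro L (N n) (fhat n ω) t)) ∧
    SpectralEB.TendstoZeroInProb μ (fun n ω =>
      SpectralEB.supDist (SpectralEB.cesaro L (N n) (fhat n ω) t)
        (SpectralEB.marginal L p₀ t)) ∧
    SpectralEB.TendstoZeroInProb μ (fun n ω =>
      SpectralEB.supDist (deriv (SpectralEB.cesaro L (N n) (fhat n ω) t))
        (deriv (SpectralEB.marginal L p₀ t))) := by
  have hfact : Fact (0 < 2 * L) := ⟨by linarith⟩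
  have hprob := SpectralEB.isProbabilityMeasure_priorLaw hp₀
  obtain ⟨P, hP⟩ : ∃ P : ProbabilityMeasure (AddCircle (2 * L)),
      (P : Measure (AddCircle (2 * L))) = SpectralEB.priorLaw L p₀ := ⟨⟨_, hprob⟩, rfl⟩
  have hmarg : SpectralEB.marginal L p₀ t = fun x : ℝ =>
      SpectralEB.noisyDensity (P : Measure (AddCircle (2 * L))) t x / (2 * L) := by
    rw [hP]
    exact funext (SpectralEB.marginal_eq hp₀ ht)
  -- An almost sure event of a probability measure is nonempty, so some variance lies in the
  -- interval.
  have h0 : 0 ≤ tmax := by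
    obtain ⟨ω, hω⟩ := (hTX.T_mem 0).exists
    exact hω.1.trans hω.2
  have hdev : ∀ m, ∀ δ : ℝ, 0 < δ → Tendsto (fun n => μ {ω | δ ≤ |SpectralEB.avg n fun i =>
      SpectralEB.deviation (P : Measure (AddCircle (2 * L)))
        (TopologicalSpace.denseSeq C(SpectralEB.Obs L tmax, ℝ) m)
        (SpectralEB.toObs L h0 (T i ω, X i ω))|}) atTop (𝓝 0) := fun m δ hδ => by
    rw [hP]
    exact hTX.tendsto_avg_deviation hp₀ h0 _ hδ
  have hgood : ∀ n, ∀ᵐ ω ∂μ, ω ∈ {ω | (∀ i, T i ω ∈ Set.Icc 0 tmax) ∧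
      SpectralEB.IsSieveMLE L (N n) n (fun i => T i ω) (fun i => X i ω) (fhat n ω)} := by
    intro n
    filter_upwards [ae_all_iff.2 hTX.T_mem, hfhat n] with ω h1 h2 using ⟨h1, h2⟩
  rw [hmarg]
  refine ⟨fun x => (SpectralEB.hasDerivAt_noisyDensity_div _ ht x).differentiableAt,
    fun n ω => SpectralEB.differentiable_cesaro _ _ _ _, ?_, ?_⟩
  · refine SpectralEB.tendstoZeroInProb_of_forall_seq hdev hgood fun n ω hn hpos hω hY => ?_
    exact SpectralEB.tendsto_supDist_cesaro (fun j => (hω j).2.1) (hN.comp hn)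
      (SpectralEB.tendsto_sieveProb h0 (hN.comp hn) hpos (fun j => (hω j).1)
        (fun j => (hω j).2) hY) ht
  · refine SpectralEB.tendstoZeroInProb_of_forall_seq hdev hgood fun n ω hn hpos hω hY => ?_
    exact SpectralEB.tendsto_supDist_deriv_cesaro (fun j => (hω j).2.1) (hN.comp hn)
      (SpectralEB.tendsto_sieveProb h0 (hN.comp hn) hpos (fun j => (hω j).1)
        (fun j => (hω j).2) hY) ht
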